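/- Let $M$ be a connected, non-compact smooth $n$-manifold (Hausdorff, second countable, without boundary) and let $F: TM\to[0,\infty)$ be a Finsler metric on $M$: $F$ is $C^\infty$ on $TM\setminus 0$, and on every $T_xM$ it is positively homogeneous of degree one and strongly convex, i.e. $g_{ij}=\frac12[F^2]_{y^iy^j}$ is positive definite at every $y\ne 0$ ($F$ need not be reversible). Let $d(x,y)$ be the infimum of the lengths $\int_a^b F(c'(t))\,dt$ of the piecewise smooth curves $c:[a,b]\to M$ from $x$ to $y$. Geodesics are the regular smooth curves with $\ddot\gamma^i+2G^i(\gamma,\dot\gamma)=0$ in local coordinates, where $G^i=\frac14 g^{il}\{[F^2]_{x^ky^l}y^k-[F^2]_{x^l}\}$. Suppose that $(M,F)$ is positively complete: every geodesic $(a,b)\to M$ extends to a geodesic $(a,\infty)\to M$. For $p\in M$ and $t>0$ put $S(p,t)=\{x\in M: d(p,x)=t\}$, $d(x,S(p,t))=\inf_{z\in S(p,t)}d(x,z)$ and $b_p^t(x)=t-d(x,S(p,t))$. Then for every $p\in M$ the limit $b_p(x)=\lim_{t\to+\infty}b_p^t(x)$ (the Busemann function at $p$) exists for all $x\in M$, and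 for every $q\in M$ there is a ray $\sigma_q:[0,\infty)\to M$ with $\sigma_q(0)=q$, i.e. a unit speed geodesic with $d(\sigma_q(s),\sigma_q(t))=t-s$ for all $0\le s\le t$, such that (a) for every $t>0$ the function $b_p^{q,t}(x):=b_p(q)+t-d(x,\sigma_q(t))$ supports $b_p$ at $q$, that is, $b_p^{q,t}(x)\le b_p(x)$ for all $x\in M$ and $b_p^{q,t}(q)=b_p(q)$; (b) $b_p(\sigma_q(t))=b_p(q)+t$ for all $t\ge 0$. -/

import Mathlib

open Set Filter Topology
open scoped Manifold ContDiff

noncomputable section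

namespace Finsler

/-- The fundamental form `g_v(u, w) = ½ D²(f²)(v)(u, w)` of a function `f` on a vector space. In a
basis its matrix is `g_ij(v) = ½ [f²]_{v^i v^j}(v)`. -/
def fundamentalForm {V : Type*} [NormedAddCommGroup V] [NormedSpace ℝ V]
    (f : V → ℝ) (v u w : V) : ℝ :=
  (1 / 2) * fderiv ℝ (fderiv ℝ (fun z => f z ^ 2)) v u w

/-- Minkowski norms on a vector space (not assumed to be reversible). -/
structure IsMinkowskiNorm {V : Type*} [NormedAddCommGroup V] [NormedSpace ℝ V]
    (f : V → ℝ) : Prop where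
  nonneg : ∀ v, 0 ≤ f v
  smooth : ContDiffOn ℝ ∞ f {v | v ≠ 0}
  homogeneous : ∀ t : ℝ, 0 ≤ t → ∀ v, f (t • v) = t * f v
  stronglyConvex : ∀ v, v ≠ 0 → ∀ w, w ≠ 0 → 0 < fundamentalForm f v w w

section Manifold

variable {n : ℕ} {M : Type*} [TopologicalSpace M] [ChartedSpace (EuclideanSpace ℝ (Fin n)) M]

/-- Finsler metrics on an `n`-dimensional manifold: functions on the tangent bundle which are smooth
on the slit tangent bundle and restrict to a Minkowski norm on every tangent space. -/
structure IsFinslerMetric [IsManifold (𝓡 n) ∞ M] (F : TangentBundle (𝓡 n) M → ℝ) : Prop where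
  smooth : ContMDiffOn (𝓡 n).tangent 𝓘(ℝ, ℝ) ∞ F {v | v.2 ≠ 0}
  minkowski : ∀ x : M, IsMinkowskiNorm (fun v : EuclideanSpace ℝ (Fin n) => F ⟨x, v⟩)

/-- `c` is piecewise smooth on `[a, b]`: there is a partition `a = τ 0 ≤ ⋯ ≤ τ N = b` such that `c`
is smooth on every closed piece `[τ i, τ (i + 1)]` (so `c` is in particular continuous). -/
def IsPiecewiseSmooth (n : ℕ) {M : Type*} [TopologicalSpace M]
    [ChartedSpace (EuclideanSpace ℝ (Fin n)) M] (c : ℝ → M) (a b : ℝ) : Prop :=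
  ∃ (N : ℕ) (τ : ℕ → ℝ), Monotone τ ∧ τ 0 = a ∧ τ N = b ∧
    ∀ i < N, ContMDiffOn 𝓘(ℝ, ℝ) (𝓡 n) ∞ c (Icc (τ i) (τ (i + 1)))

/-- The length `∫_a^b F(c'(t)) dt`. -/
def length (F : TangentBundle (𝓡 n) M → ℝ) (c : ℝ → M) (a b : ℝ) : ℝ :=
  ∫ t in a..b, F ⟨c t, mfderiv 𝓘(ℝ, ℝ) (𝓡 n) c t (1 : ℝ)⟩

/-- The (in general not symmetric) distance from `p` to `q`: the infimum of the lengths of the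
piecewise smooth curves from `p` to `q`. -/
def dist (F : TangentBundle (𝓡 n) M → ℝ) (p q : M) : ℝ :=
  sInf {l | ∃ (c : ℝ → M) (a b : ℝ), a < b ∧ IsPiecewiseSmooth n c a b ∧
    c a = p ∧ c b = q ∧ l = length F c a b}

/-- `F` in the local coordinates given by the chart `φ`: the value of `F` at the tangent vector with
base point of coordinates `x` and components `y`. -/
def inChart (F : TangentBundle (𝓡 n) M → ℝ) (φ : OpenPartialHomeomorph M (EuclideanSpace ℝ (Fin n)))
    (x y : EuclideanSpace ℝ (Fin n)) : ℝ :=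
  F ⟨φ.symm x, mfderiv (𝓡 n) (𝓡 n) φ.symm x y⟩

/-- The matrix `g_ij(x, y)` of a metric `f = f(x, y)` written in coordinates. -/
def metricMatrix (f : EuclideanSpace ℝ (Fin n) → EuclideanSpace ℝ (Fin n) → ℝ)
    (x y : EuclideanSpace ℝ (Fin n)) : Matrix (Fin n) (Fin n) ℝ :=
  Matrix.of fun i j =>
    fundamentalForm (f x) y (EuclideanSpace.single i 1) (EuclideanSpace.single j 1)

/-- The geodesic spray coefficients
`G^i(x, y) = ¼ g^{il} ([f²]_{x^k y^l} y^k - [f²]_{x^l})` of a metric `f = f(x, y)` written in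
coordinates. The contraction with `y^k` is the derivative in `x` in the direction `y`. -/
def sprayCoeff (f : EuclideanSpace ℝ (Fin n) → EuclideanSpace ℝ (Fin n) → ℝ)
    (x y : EuclideanSpace ℝ (Fin n)) (i : Fin n) : ℝ :=
  (1 / 4) * ∑ l : Fin n, (metricMatrix f x y)⁻¹ i l *
    (fderiv ℝ (fun x' => fderiv ℝ (fun y' => f x' y' ^ 2) y (EuclideanSpace.single l 1)) x y
      - fderiv ℝ (fun x' => f x' y ^ 2) x (EuclideanSpace.single l 1))

/-- `γ` is a geodesic on the interval `J`: it is smooth and regular there, and it satisfies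
`(γ^i)'' + 2 G^i(γ, γ') = 0` in all local coordinates. (The spray is not defined by its formula at
`y = 0`; constant curves are not counted as geodesics.) -/
def IsGeodesicOn (F : TangentBundle (𝓡 n) M → ℝ) (γ : ℝ → M) (J : Set ℝ) : Prop :=
  ContMDiffOn 𝓘(ℝ, ℝ) (𝓡 n) ∞ γ J ∧
    ∀ φ ∈ IsManifold.maximalAtlas (𝓡 n) ∞ M, ∀ t ∈ J, γ t ∈ φ.source →
      derivWithin (φ ∘ γ) J t ≠ 0 ∧
      ∀ i : Fin n, derivWithin (derivWithin (φ ∘ γ) J) J t i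
        + 2 * sprayCoeff (inChart F φ) (φ (γ t)) (derivWithin (φ ∘ γ) J t) i = 0

/-- Positive completeness: every geodesic `(a, b) → M` extends to a geodesic `(a, ∞) → M`. -/
def IsPositivelyComplete (F : TangentBundle (𝓡 n) M → ℝ) : Prop :=
  ∀ (γ : ℝ → M) (a b : ℝ), a < b → IsGeodesicOn F γ (Ioo a b) →
    ∃ γ' : ℝ → M, IsGeodesicOn F γ' (Ioi a) ∧ EqOn γ' γ (Ioo a b)

/-- Rays `σ : [0, ∞) → M`: unit speed geodesics which minimize the distance between any two of their
points. (The values of `σ` at negative times are irrelevant.) -/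
def IsRay (F : TangentBundle (𝓡 n) M → ℝ) (σ : ℝ → M) : Prop :=
  IsGeodesicOn F σ (Ici 0) ∧
  (∀ t ∈ Ici (0 : ℝ), F ⟨σ t, mfderivWithin 𝓘(ℝ, ℝ) (𝓡 n) σ (Ici 0) t (1 : ℝ)⟩ = 1) ∧
  ∀ s t : ℝ, 0 ≤ s → s ≤ t → dist F (σ s) (σ t) = t - s

/-- The forward sphere `S(p, t)`. -/
def sphere (F : TangentBundle (𝓡 n) M → ℝ) (p : M) (t : ℝ) : Set M :=
  {x | dist F p x = t}

/-- The distance `d(x, A)` from a point to a set. -/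
def distToSet (F : TangentBundle (𝓡 n) M → ℝ) (x : M) (A : Set M) : ℝ :=
  sInf (dist F x '' A)

/-- `b_p^t(x) = t - d(x, S(p, t))`. -/
def busemannApprox (F : TangentBundle (𝓡 n) M → ℝ) (p : M) (t : ℝ) (x : M) : ℝ :=
  t - distToSet F x (sphere F p t)

/-- The Busemann function `b_p(x) = lim_{t → ∞} b_p^t(x)`. -/
def busemann (F : TangentBundle (𝓡 n) M → ℝ) (p : M) (x : M) : ℝ :=
  limUnder atTop (fun t : ℝ => busemannApprox F p t x)

/-- `g` supports `f` at `q` (from below). -/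
def Supports {X : Type*} (g f : X → ℝ) (q : X) : Prop :=
  (∀ x, g x ≤ f x) ∧ g q = f q

end Manifold

end Finsler

end

/-!
Regularity of minimizers replaces the exponential map throughout, so that no existence theory for
the geodesic equation is needed.

*The distance in a chart.* A Finsler metric is in a chart a family `f x` of Minkowski norms, with
locally uniform bounds (`IsChartMetric.exists_bounds`). Segments bound the distance from above, and
the differential of `f x` at `y - x`, which satisfies `D(f x)(y - x) v ≤ f x v`, calibrates curves
from `x` to `y` and bounds it from below. Hence `d(x, y) = f x (y - x) + O(‖y - x‖²)`
(`exists_hasExpansion`), and `d` is a length quasi-metric which induces the topology of the manifold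
(`isLengthQuasiMetric_dist`).

*Minimizers are geodesics.* Let `γ` be a curve with `d(γ s, γ t) = t - s`. By the expansion of `d`
and the strong convexity of the Minkowski norms, the difference quotients of `γ` over adjacent
intervals differ by `O((t - s)^(1/2))`, so `γ` is `C¹`
(`exists_continuousOn_hasDerivWithinAt`). Comparison with competing `C¹` curves and the lemma of
du Bois-Reymond give the Euler–Lagrange equation in integrated form; the Legendre transform is a
local diffeomorphism, so the velocity solves a first order system with smooth coefficients, and `γ`
is smooth (`HasExpansion.exists_contDiffOn_of_isMinimizer`). In coordinates this equation is the
geodesic equation (`IsChartMetric.add_two_mul_sprayCoeff_eq_zero`), so `γ` is a geodesic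
(`isGeodesicOn_of_isMinimizer`).

*The Hopf–Rinow theorem.* By positive completeness a minimizer on `[0, R)` therefore has a limit at
`R`. For a length quasi-metric on a locally compact space this forces closed forward balls to be
compact (`IsLengthQuasiMetric.isCompact_closedBall`): if the balls around `x` of radius less than `R`
are compact, then shortest arcs from `x` to points whose distance tends to `R` subconverge to a
minimizer on `[0, R)`, whose endpoint is a limit of these points; and every compact ball can be
enlarged.

*Busemann functions.* The function `t ↦ t - d(x, S(p, t))` is antitone and bounded below for
`t ≥ d(p, x)`, hence it converges. Shortest arcs from `q` to `S(p, t)` subconverge to a minimizer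
`σ : [0, ∞) → M` as `t → ∞`, and the triangle inequality gives the support property and
`b (σ t) = b q + t` in the limit (`IsLengthQuasiMetric.exists_busemann`). The minimizer `σ` is a ray
by the regularity theorem.
-/

noncomputable section

namespace Finsler

/-! ### Length quasi-metrics -/

/-- A not necessarily symmetric distance `d` on a topological space, whose forward and backward
balls both form neighbourhood bases, and which is a length distance: any `x` and `y` are joined by
approximately minimizing arcs. The arcs are parametrized by the distance from `x`; no continuity is
imposed on them, since only their limits are used. -/
structure IsLengthQuasiMetric {X : Type*} [TopologicalSpace X] (d : X → X → ℝ) : Prop where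
  nonneg : ∀ x y, 0 ≤ d x y
  self : ∀ x, d x x = 0
  triangle : ∀ x y z, d x z ≤ d x y + d y z
  tendsto_right : ∀ x, Tendsto (fun y => d x y) (𝓝 x) (𝓝 0)
  tendsto_left : ∀ x, Tendsto (fun y => d y x) (𝓝 x) (𝓝 0)
  mem_of_right : ∀ x, ∀ U ∈ 𝓝 x, ∃ ε > 0, ∀ y, d x y < ε → y ∈ U
  mem_of_left : ∀ x, ∀ U ∈ 𝓝 x, ∃ ε > 0, ∀ y, d y x < ε → y ∈ U
  approx : ∀ x y, ∀ ε > 0, ∃ c : ℝ → X, ∀ s t, 0 ≤ s → s ≤ t → t ≤ d x y →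
    d x (c s) = s ∧ d (c s) (c t) ≤ t - s + ε ∧ d (c s) y ≤ d x y - s + ε

/-- `γ` is minimizing and parametrized by arc length on `J`. -/
def IsMinimizer {X : Type*} (d : X → X → ℝ) (γ : ℝ → X) (J : Set ℝ) : Prop :=
  ∀ s ∈ J, ∀ t ∈ J, s ≤ t → d (γ s) (γ t) = t - s

namespace IsLengthQuasiMetric

variable {X : Type*} [TopologicalSpace X] {d : X → X → ℝ}

lemma continuous (hd : IsLengthQuasiMetric d) : Continuous (fun z : X × X => d z.1 z.2) := by
  rw [continuous_iff_continuousAt]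
  rintro ⟨x, y⟩
  have h1 : Tendsto (fun z : X × X => z.1) (𝓝 (x, y)) (𝓝 x) := continuous_fst.tendsto _
  have h2 : Tendsto (fun z : X × X => z.2) (𝓝 (x, y)) (𝓝 y) := continuous_snd.tendsto _
  have hlo : Tendsto (fun z : X × X => d x y - d x z.1 - d z.2 y) (𝓝 (x, y)) (𝓝 (d x y)) := by
    simpa using (tendsto_const_nhds.sub ((hd.tendsto_right x).comp h1)).sub
      ((hd.tendsto_left y).comp h2)
  have hhi : Tendsto (fun z : X × X => d x y + d z.1 x + d y z.2) (𝓝 (x, y)) (𝓝 (d x y)) := by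
    simpa using (tendsto_const_nhds.add ((hd.tendsto_left x).comp h1)).add
      ((hd.tendsto_right y).comp h2)
  refine tendsto_of_tendsto_of_tendsto_of_le_of_le hlo hhi (fun z => ?_) (fun z => ?_)
  · have := hd.triangle x z.1 y
    have := hd.triangle z.1 z.2 y
    show d x y - d x z.1 - d z.2 y ≤ d z.1 z.2
    linarith
  · have := hd.triangle z.1 x z.2
    have := hd.triangle x y z.2
    show d z.1 z.2 ≤ d x y + d z.1 x + d y z.2
    linarith

lemma continuous_right (hd : IsLengthQuasiMetric d) (x : X) : Continuous (fun y => d x y) :=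
  hd.continuous.comp (Continuous.prodMk_right x)

lemma eq_of_eq_zero [T1Space X] (hd : IsLengthQuasiMetric d) {x y : X} (h : d x y = 0) :
    x = y := by
  by_contra hne
  obtain ⟨ε, hε, hy⟩ := hd.mem_of_right x {y}ᶜ (isOpen_compl_singleton.mem_nhds hne)
  exact hy y (by rw [h]; exact hε) rfl

lemma isClosed_closedBall (hd : IsLengthQuasiMetric d) (x : X) (r : ℝ) :
    IsClosed {y | d x y ≤ r} :=
  isClosed_le (hd.continuous_right x) continuous_const

lemma isCompact_closedBall_mono (hd : IsLengthQuasiMetric d) {x : X} {r s : ℝ} (hrs : r ≤ s)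
    (h : IsCompact {y | d x y ≤ s}) : IsCompact {y | d x y ≤ r} :=
  h.of_isClosed_subset (hd.isClosed_closedBall x r) (fun _ hy => le_trans hy hrs)

/-- Minimizers are continuous. From the left this uses that backward balls form a neighbourhood
basis, from the right that forward balls do. -/
lemma continuousOn_of_isMinimizer (hd : IsLengthQuasiMetric d) {γ : ℝ → X} {J : Set ℝ}
    (hγ : IsMinimizer d γ J) : ContinuousOn γ J := by
  intro t ht U hU
  obtain ⟨ε₁, hε₁, h₁⟩ := hd.mem_of_right _ U hU
  obtain ⟨ε₂, hε₂, h₂⟩ := hd.mem_of_left _ U hU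
  have hI : Ioo (t - ε₂) (t + ε₁) ∈ 𝓝[J] t :=
    mem_nhdsWithin_of_mem_nhds (Ioo_mem_nhds (by linarith) (by linarith))
  change ∀ᶠ s in 𝓝[J] t, γ s ∈ U
  filter_upwards [hI, self_mem_nhdsWithin] with s hs hsJ
  rcases le_total s t with hst | hst
  · exact h₂ _ (by rw [hγ s hsJ t ht hst]; linarith [hs.1])
  · exact h₁ _ (by rw [hγ t ht s hsJ hst]; linarith [hs.2])

/-- Shortest arcs exist as soon as the smaller closed forward balls are compact: they are limits of
approximately minimizing arcs along an ultrafilter. -/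
lemma exists_minimizer [T1Space X] (hd : IsLengthQuasiMetric d) (x y : X)
    (hK : ∀ s < d x y, IsCompact {z | d x z ≤ s}) :
    ∃ γ : ℝ → X, γ 0 = x ∧ γ (d x y) = y ∧ IsMinimizer d γ (Icc 0 (d x y)) := by
  choose c hc using fun k : ℕ => hd.approx x y (1 / ((k : ℝ) + 1)) (by positivity)
  set 𝒰 : Ultrafilter ℕ := Ultrafilter.of atTop
  have h𝒰 : (𝒰 : Filter ℕ) ≤ atTop := Ultrafilter.of_le atTop
  have hε : Tendsto (fun k : ℕ => 1 / ((k : ℝ) + 1)) 𝒰 (𝓝 0) :=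
    tendsto_one_div_add_atTop_nhds_zero_nat.mono_left h𝒰
  have hlim : ∀ s, ∃ z, 0 ≤ s → s < d x y → Tendsto (fun k => c k s) 𝒰 (𝓝 z) := by
    intro s
    by_cases hs : 0 ≤ s ∧ s < d x y
    · obtain ⟨z, -, hz⟩ := (hK s hs.2).ultrafilter_le_nhds' (𝒰.map (fun k => c k s))
        (Ultrafilter.mem_map.2 (Eventually.of_forall (f := (𝒰 : Filter ℕ))
          fun k => ((hc k s s hs.1 le_rfl hs.2.le).1).le))
      exact ⟨z, fun _ _ => hz⟩
    · exact ⟨x, fun h0 h1 => absurd ⟨h0, h1⟩ hs⟩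
  choose g hg using hlim
  have hgx : ∀ s, 0 ≤ s → s < d x y → d x (g s) = s := by
    intro s h0 h1
    refine tendsto_nhds_unique (((hd.continuous_right x).tendsto _).comp (hg s h0 h1)) ?_
    exact tendsto_const_nhds.congr fun k => ((hc k s s h0 le_rfl h1.le).1).symm
  have hgt : ∀ s t, 0 ≤ s → s ≤ t → t < d x y → d (g s) (g t) = t - s := by
    intro s t h0 h1 h2
    apply le_antisymm
    · have hA := (hd.continuous.tendsto (g s, g t)).comp
        ((hg s h0 (h1.trans_lt h2)).prodMk_nhds (hg t (h0.trans h1) h2))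
      have hB : Tendsto (fun k : ℕ => t - s + 1 / ((k : ℝ) + 1)) 𝒰 (𝓝 (t - s)) := by
        simpa using (tendsto_const_nhds (x := t - s)).add hε
      exact le_of_tendsto_of_tendsto' hA hB fun k => (hc k s t h0 h1 h2.le).2.1
    · have := hd.triangle x (g s) (g t)
      rw [hgx s h0 (h1.trans_lt h2), hgx t (h0.trans h1) h2] at this
      linarith
  have hgy : ∀ s, 0 ≤ s → s < d x y → d (g s) y = d x y - s := by
    intro s h0 h1
    apply le_antisymm
    · have hA := (hd.continuous.tendsto (g s, y)).comp
        ((hg s h0 h1).prodMk_nhds (tendsto_const_nhds (x := y)))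
      have hB : Tendsto (fun k : ℕ => d x y - s + 1 / ((k : ℝ) + 1)) 𝒰 (𝓝 (d x y - s)) := by
        simpa using (tendsto_const_nhds (x := d x y - s)).add hε
      exact le_of_tendsto_of_tendsto' hA hB fun k => (hc k s s h0 le_rfl h1.le).2.2
    · have := hd.triangle x (g s) y
      rw [hgx s h0 h1] at this
      linarith
  -- compactness controls the limit only below `d x y`, so the endpoint is prescribed
  refine ⟨fun s => if s < d x y then g s else y, ?_, by simp, ?_⟩
  · rcases (hd.nonneg x y).eq_or_lt with h | h
    · rw [← h]
      simp only [lt_irrefl, if_false]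
      exact (hd.eq_of_eq_zero h.symm).symm
    · simp only [h, if_true]
      exact (hd.eq_of_eq_zero (hgx 0 le_rfl h)).symm
  · intro s hs t ht hst
    rcases ht.2.lt_or_eq with h | h
    · simp only [h, hst.trans_lt h, if_true]
      exact hgt s t hs.1 hst h
    · rcases hs.2.lt_or_eq with h' | h'
      · simp only [h', if_true, h, lt_irrefl, if_false]
        exact hgy s hs.1 h'
      · simp [h, h', hd.self]

/-! ### Compactness of closed forward balls -/

/-- A compact closed ball can be enlarged: it is covered by finitely many balls whose doubles lie in
compact sets. -/
lemma exists_isCompact_closedBall_add [LocallyCompactSpace X] (hd : IsLengthQuasiMetric d)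
    {x : X} {r : ℝ} (hr : 0 ≤ r) (hK : IsCompact {y | d x y ≤ r}) :
    ∃ ε > 0, IsCompact {y | d x y ≤ r + ε} := by
  have hloc : ∀ y : X, ∃ N : Set X, ∃ ε > 0, IsCompact N ∧ ∀ z, d y z < 2 * ε → z ∈ N := by
    intro y
    obtain ⟨N, hN, hyN⟩ := exists_compact_mem_nhds y
    obtain ⟨ε, hε, h⟩ := hd.mem_of_right y N hyN
    exact ⟨N, ε / 2, by positivity, hN, fun z hz => h z (by linarith)⟩
  choose N ε hε hN hNε using hloc
  have hnhds : ∀ y ∈ {y | d x y ≤ r}, {z | d y z < ε y} ∈ 𝓝 y := fun y _ =>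
    (hd.tendsto_right y).eventually (gt_mem_nhds (hε y))
  obtain ⟨T, -, hT⟩ := hK.elim_nhds_subcover _ hnhds
  have hTne : T.Nonempty := by
    have : x ∈ ⋃ y ∈ T, {z | d y z < ε y} := hT (by simpa [hd.self] using hr)
    simp only [mem_iUnion] at this
    obtain ⟨y, hy, -⟩ := this
    exact ⟨y, hy⟩
  obtain ⟨y₀, -, hy₀⟩ := T.exists_min_image ε hTne
  refine ⟨ε y₀ / 2, by linarith [hε y₀], ?_⟩
  refine (T.isCompact_biUnion (f := N) fun y _ => hN y).of_isClosed_subset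
    (hd.isClosed_closedBall _ _) ?_
  intro z hz
  -- the point at distance `min r (d x z)` from `x` on an almost shortest arc from `x` to `z`
  obtain ⟨c, hc⟩ := hd.approx x z (ε y₀ / 4) (by linarith [hε y₀])
  have hm := hc (min r (d x z)) (min r (d x z)) (le_min hr (hd.nonneg x z)) le_rfl
    (min_le_right _ _)
  set w := c (min r (d x z))
  have hwz : d w z < ε y₀ := by
    have h1 := hm.2.2
    have h2 : d x z ≤ r + ε y₀ / 2 := hz
    have h3 : d x z - min r (d x z) ≤ ε y₀ / 2 := by
      rcases min_cases r (d x z) with ⟨h, _⟩ | ⟨h, _⟩ <;> rw [h] <;> linarith [hε y₀]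
    linarith [hε y₀]
  have hw : w ∈ ⋃ y ∈ T, {z | d y z < ε y} := hT (by
    show d x w ≤ r
    rw [hm.1]; exact min_le_left _ _)
  simp only [mem_iUnion, mem_ofPred_eq] at hw ⊢
  obtain ⟨y, hyT, hy⟩ := hw
  exact ⟨y, hyT, hNε y z (by linarith [hd.triangle y w z, hy₀ y hyT])⟩

/-- If the minimizers issuing from `x` that are defined on half-open intervals converge, then
compactness of the balls of radius less than `R` passes to the ball of radius `R`. -/
lemma isCompact_closedBall_of_lt [T1Space X] (hd : IsLengthQuasiMetric d)
    (hext : ∀ (γ : ℝ → X) (R : ℝ), 0 < R → IsMinimizer d γ (Ico 0 R) →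
      ∃ z, Tendsto γ (𝓝[<] R) (𝓝 z))
    {x : X} {R : ℝ} (hR : 0 < R) (hK : ∀ r < R, IsCompact {y | d x y ≤ r}) :
    IsCompact {y | d x y ≤ R} := by
  rw [isCompact_iff_ultrafilter_le_nhds']
  intro 𝒰 h𝒰
  suffices ∃ z, (𝒰 : Filter X) ≤ 𝓝 z by
    obtain ⟨z, hz⟩ := this
    exact ⟨z, (hd.isClosed_closedBall x R).mem_of_tendsto (f := id) hz h𝒰, hz⟩
  -- unless a smaller ball belongs to the ultrafilter, `d x` tends to `R` along it
  by_cases hcase : ∃ r < R, {y | d x y ≤ r} ∈ 𝒰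
  · obtain ⟨r, hr, hmem⟩ := hcase
    obtain ⟨z, -, hz⟩ := (hK r hr).ultrafilter_le_nhds' 𝒰 hmem
    exact ⟨z, hz⟩
  push Not at hcase
  have hfar : ∀ r < R, ∀ᶠ y in (𝒰 : Filter X), r < d x y ∧ d x y ≤ R := by
    intro r hr
    have h1 : {y | d x y ≤ r}ᶜ ∈ 𝒰 := Ultrafilter.compl_mem_iff_notMem.2 (hcase r hr)
    filter_upwards [h1, h𝒰] with y hy hy'
    exact ⟨not_le.1 hy, hy'⟩
  have hmin : ∀ y, ∃ γ : ℝ → X, d x y ≤ R →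
      γ 0 = x ∧ γ (d x y) = y ∧ IsMinimizer d γ (Icc 0 (d x y)) := by
    intro y
    by_cases hy : d x y ≤ R
    · obtain ⟨γ, h⟩ := hd.exists_minimizer x y fun s hs => hK s (hs.trans_le hy)
      exact ⟨γ, fun _ => h⟩
    · exact ⟨fun _ => x, fun h => absurd h hy⟩
  choose γ hγ using hmin
  have hγx : ∀ y s, d x y ≤ R → 0 ≤ s → s ≤ d x y → d x (γ y s) = s := by
    intro y s hy h0 h1
    obtain ⟨e0, -, hm⟩ := hγ y hy
    have := hm 0 ⟨le_rfl, h0.trans h1⟩ s ⟨h0, h1⟩ h0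
    rwa [e0, sub_zero] at this
  have hlim : ∀ s, ∃ z, 0 ≤ s → s < R → Tendsto (fun y => γ y s) 𝒰 (𝓝 z) := by
    intro s
    by_cases hs : 0 ≤ s ∧ s < R
    · obtain ⟨z, -, hz⟩ := (hK s hs.2).ultrafilter_le_nhds' (𝒰.map (fun y => γ y s))
        (Ultrafilter.mem_map.2 ((hfar s hs.2).mono fun y hy => (hγx y s hy.2 hs.1 hy.1.le).le))
      exact ⟨z, fun _ _ => hz⟩
    · exact ⟨x, fun h0 h1 => absurd ⟨h0, h1⟩ hs⟩
  choose g hg using hlim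
  -- the limit of the shortest arcs `γ y` along the ultrafilter is a minimizer, and its endpoint is
  -- the limit of the ultrafilter
  have hgmin : IsMinimizer d g (Ico 0 R) := by
    intro s hs t ht hst
    have hA := (hd.continuous.tendsto (g s, g t)).comp
      ((hg s hs.1 hs.2).prodMk_nhds (hg t ht.1 ht.2))
    refine tendsto_nhds_unique hA (tendsto_const_nhds.congr' ?_)
    filter_upwards [hfar t ht.2] with y hy
    exact ((hγ y hy.2).2.2 s ⟨hs.1, hst.trans hy.1.le⟩ t ⟨ht.1, hy.1.le⟩ hst).symm
  obtain ⟨z, hz⟩ := hext g R hR hgmin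
  refine ⟨z, fun U hU => ?_⟩
  obtain ⟨ε, hε, hU⟩ := hd.mem_of_right z U hU
  have h1 : ∀ᶠ s in 𝓝[<] R, d z (g s) < ε / 3 :=
    ((hd.tendsto_right z).comp hz).eventually (gt_mem_nhds (by positivity))
  have h2 : ∀ᶠ s in 𝓝[<] R, s ∈ Ioo (max 0 (R - ε / 3)) R :=
    Ioo_mem_nhdsLT (max_lt hR (by linarith))
  obtain ⟨s, hs1, hs2⟩ := (h1.and h2).exists
  have hs0 : 0 ≤ s := (le_max_left _ _).trans hs2.1.le
  have h3 : ∀ᶠ y in (𝒰 : Filter X), d (g s) (γ y s) < ε / 3 :=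
    ((hd.tendsto_right (g s)).comp (hg s hs0 hs2.2)).eventually (gt_mem_nhds (by positivity))
  show ∀ᶠ y in (𝒰 : Filter X), y ∈ U
  filter_upwards [h3, hfar s hs2.2] with y hy1 hy2
  apply hU
  have h4 : d (γ y s) y = d x y - s := by
    obtain ⟨-, e1, hm⟩ := hγ y hy2.2
    have := hm s ⟨hs0, hy2.1.le⟩ (d x y) ⟨hd.nonneg x y, le_rfl⟩ hy2.1.le
    rwa [e1] at this
  have h5 := (le_max_right _ _).trans_lt hs2.1
  linarith [hd.triangle z (g s) y, hd.triangle (g s) (γ y s) y, hy2.2]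

/-- The Hopf–Rinow theorem for length quasi-metrics. -/
theorem isCompact_closedBall [T1Space X] [LocallyCompactSpace X] (hd : IsLengthQuasiMetric d)
    (hext : ∀ (γ : ℝ → X) (R : ℝ), 0 < R → IsMinimizer d γ (Ico 0 R) →
      ∃ z, Tendsto γ (𝓝[<] R) (𝓝 z)) (x : X) (r : ℝ) :
    IsCompact {y | d x y ≤ r} := by
  by_contra hr
  have h0 : IsCompact {y | d x y ≤ 0} := by
    convert isCompact_singleton (x := x)
    ext y
    simp only [mem_ofPred_eq, mem_singleton_iff]
    exact ⟨fun h => (hd.eq_of_eq_zero (le_antisymm h (hd.nonneg x y))).symm,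
      fun h => by rw [h, hd.self]⟩
  set A := {s : ℝ | IsCompact {y | d x y ≤ s}}
  have hA0 : (0 : ℝ) ∈ A := h0
  have hbdd : BddAbove A := ⟨r, fun s hs => by
    by_contra h
    exact hr (hd.isCompact_closedBall_mono (not_le.1 h).le hs)⟩
  obtain ⟨ε, hε, hεA⟩ := hd.exists_isCompact_closedBall_add le_rfl h0
  have hRpos : 0 < sSup A := lt_of_lt_of_le (by linarith) (le_csSup hbdd hεA)
  have hlt : ∀ s < sSup A, IsCompact {y | d x y ≤ s} := by
    intro s hs
    obtain ⟨t, ht, hst⟩ := exists_lt_of_lt_csSup ⟨0, hA0⟩ hs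
    exact hd.isCompact_closedBall_mono hst.le ht
  obtain ⟨δ, hδ, hδA⟩ := hd.exists_isCompact_closedBall_add hRpos.le
    (hd.isCompact_closedBall_of_lt hext hRpos hlt)
  linarith [le_csSup hbdd hδA]

/-! ### Busemann functions -/

section Busemann

variable (hd : IsLengthQuasiMetric d) (hK : ∀ x r, IsCompact {y | d x y ≤ r})
include hd hK

lemma exists_eq_of_noncompact [ConnectedSpace X] [NoncompactSpace X] (p : X) {t : ℝ}
    (ht : 0 ≤ t) : ∃ z, d p z = t := by
  obtain ⟨y, hy⟩ : ∃ y, t ≤ d p y := by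
    by_contra! h
    refine noncompact_univ X ?_
    convert hK p t
    exact (eq_univ_of_forall fun y => (h y).le).symm
  exact mem_range_of_exists_le_of_exists_ge (hd.continuous_right p) ⟨p, by rwa [hd.self]⟩ ⟨y, hy⟩

/-- Distances to forward spheres are attained. -/
lemma exists_foot [ConnectedSpace X] [NoncompactSpace X] (p : X) {t : ℝ} (ht : 0 ≤ t) (x : X) :
    ∃ z, d p z = t ∧ sInf (d x '' {z | d p z = t}) = d x z := by
  have hc : IsCompact {z | d p z = t} :=
    (hK p t).of_isClosed_subset (isClosed_eq (hd.continuous_right p) continuous_const)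
      fun _ hz => le_of_eq hz
  obtain ⟨z, hz, h, -⟩ := hc.exists_sInf_image_eq_and_le
    (hd.exists_eq_of_noncompact hK p ht) (hd.continuous_right x).continuousOn
  exact ⟨z, hz, h⟩

omit hK in
lemma sInf_image_le {x z p : X} {t : ℝ} (hz : d p z = t) :
    sInf (d x '' {z | d p z = t}) ≤ d x z :=
  csInf_le ⟨0, by rintro _ ⟨y, -, rfl⟩; exact hd.nonneg x y⟩ ⟨z, hz, rfl⟩

lemma sInf_image_le_add [ConnectedSpace X] [NoncompactSpace X] (p : X) {t : ℝ} (ht : 0 ≤ t)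
    (x y : X) :
    sInf (d x '' {z | d p z = t}) ≤ d x y + sInf (d y '' {z | d p z = t}) := by
  obtain ⟨z, hz, h⟩ := hd.exists_foot hK p ht y
  rw [h]
  exact (hd.sInf_image_le hz).trans (hd.triangle x y z)

/-- A shortest arc from `x` to the sphere of radius `t` crosses the sphere of radius `s`. -/
lemma sInf_image_add_le [T1Space X] [ConnectedSpace X] [NoncompactSpace X] (p x : X) {s t : ℝ}
    (hs : d p x ≤ s) (hst : s ≤ t) :
    sInf (d x '' {z | d p z = s}) + (t - s) ≤ sInf (d x '' {z | d p z = t}) := by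
  obtain ⟨z, hz, h⟩ := hd.exists_foot hK p ((hd.nonneg p x).trans (hs.trans hst)) x
  rw [h]
  obtain ⟨γ, h0, h1, hγ⟩ := hd.exists_minimizer x z fun s _ => hK x s
  have hcont : ContinuousOn (fun u => d p (γ u)) (Icc 0 (d x z)) :=
    (hd.continuous_right p).comp_continuousOn (hd.continuousOn_of_isMinimizer hγ)
  obtain ⟨u, hu, hus⟩ := intermediate_value_Icc (hd.nonneg x z) hcont
    (show s ∈ Icc (d p (γ 0)) (d p (γ (d x z))) by rw [h0, h1, hz]; exact ⟨hs, hst⟩)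
  have e1 := hγ 0 ⟨le_rfl, hd.nonneg x z⟩ u hu hu.1
  have e2 := hγ u hu _ ⟨hd.nonneg x z, le_rfl⟩ hu.2
  rw [h0] at e1
  rw [h1] at e2
  have h3 := hd.triangle p (γ u) z
  have h4 := hd.sInf_image_le (x := x) hus
  simp only at hus
  linarith

lemma exists_tendsto_busemann [T1Space X] [ConnectedSpace X] [NoncompactSpace X] (p x : X) :
    ∃ b, Tendsto (fun t => t - sInf (d x '' {z | d p z = t})) atTop (𝓝 b) := by
  set B : ℝ → ℝ := fun t => t - sInf (d x '' {z | d p z = t}) with hB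
  have hanti : Antitone (fun t => B (max t (d p x))) := by
    intro s t hst
    have := hd.sInf_image_add_le hK p x (le_max_right s (d p x)) (max_le_max_right (d p x) hst)
    simp only [hB]
    linarith
  have hbdd : BddBelow (range fun t => B (max t (d p x))) := by
    refine ⟨-d x p, ?_⟩
    rintro _ ⟨t, rfl⟩
    have h0 : 0 ≤ max t (d p x) := (hd.nonneg p x).trans (le_max_right _ _)
    have h1 := hd.sInf_image_le_add hK p h0 x p
    obtain ⟨z, hz⟩ := hd.exists_eq_of_noncompact hK p h0
    have h2 := hd.sInf_image_le (x := p) hz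
    simp only [hB]
    linarith
  refine ⟨_, (tendsto_atTop_ciInf hanti hbdd).congr' ?_⟩
  filter_upwards [eventually_ge_atTop (d p x)] with t ht
  simp [ht]

/-- The Busemann function of `p`, and the rays which are asymptotic to the system of forward spheres
around `p`. The ray at `q` is a limit of shortest arcs from `q` to the spheres of radius `t → ∞`. -/
theorem exists_busemann [T1Space X] [ConnectedSpace X] [NoncompactSpace X] (p : X) :
    ∃ b : X → ℝ, (∀ x, Tendsto (fun t => t - sInf (d x '' {z | d p z = t})) atTop (𝓝 (b x))) ∧
      ∀ q, ∃ σ : ℝ → X, σ 0 = q ∧ IsMinimizer d σ (Ici 0) ∧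
        (∀ t, 0 ≤ t → ∀ x, b q + t - d x (σ t) ≤ b x) ∧ ∀ t, 0 ≤ t → b (σ t) = b q + t := by
  choose b hb using hd.exists_tendsto_busemann hK p
  refine ⟨b, hb, fun q => ?_⟩
  have hfoot : ∀ t, ∃ z, 0 ≤ t → d p z = t ∧ sInf (d q '' {z | d p z = t}) = d q z := by
    intro t
    by_cases ht : 0 ≤ t
    · obtain ⟨z, h⟩ := hd.exists_foot hK p ht q
      exact ⟨z, fun _ => h⟩
    · exact ⟨q, fun h => absurd h ht⟩
  choose z hz using hfoot
  -- a shortest arc `γ t` from `q` to a closest point `z t` of the sphere of radius `t`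
  choose γ hγ0 hγ1 hγ using fun t => hd.exists_minimizer q (z t) fun s _ => hK q s
  have hfar : Tendsto (fun t => d q (z t)) atTop atTop := by
    refine tendsto_atTop_mono' (f₁ := fun t => -d p q + t) atTop ?_
      (tendsto_atTop_add_const_left _ _ tendsto_id)
    filter_upwards [eventually_ge_atTop 0] with t ht
    have := hd.triangle p q (z t)
    rw [(hz t ht).1] at this
    linarith
  set 𝒰 : Ultrafilter ℝ := Ultrafilter.of atTop
  have h𝒰 : (𝒰 : Filter ℝ) ≤ atTop := Ultrafilter.of_le atTop
  have hfar' : ∀ s, ∀ᶠ t in (𝒰 : Filter ℝ), s ≤ d q (z t) := fun s =>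
    h𝒰 (hfar.eventually (eventually_ge_atTop s))
  have hpos : ∀ᶠ t in (𝒰 : Filter ℝ), 0 ≤ t := h𝒰 (eventually_ge_atTop 0)
  have hγq : ∀ t s, 0 ≤ s → s ≤ d q (z t) → d q (γ t s) = s := by
    intro t s h0 h1
    have := hγ t 0 ⟨le_rfl, h0.trans h1⟩ s ⟨h0, h1⟩ h0
    rwa [hγ0, sub_zero] at this
  have hlim : ∀ s, ∃ w, 0 ≤ s → Tendsto (fun t => γ t s) 𝒰 (𝓝 w) := by
    intro s
    by_cases hs : 0 ≤ s
    · obtain ⟨w, -, hw⟩ := (hK q s).ultrafilter_le_nhds' (𝒰.map (fun t => γ t s))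
        (Ultrafilter.mem_map.2 ((hfar' s).mono fun t ht => (hγq t s hs ht).le))
      exact ⟨w, fun _ => hw⟩
    · exact ⟨q, fun h => absurd h hs⟩
  choose σ hσ using hlim
  have hσmin : IsMinimizer d σ (Ici 0) := by
    intro s hs t ht hst
    have hA := (hd.continuous.tendsto (σ s, σ t)).comp ((hσ s hs).prodMk_nhds (hσ t ht))
    refine tendsto_nhds_unique hA (tendsto_const_nhds.congr' ?_)
    filter_upwards [hfar' t] with u hu
    exact (hγ u s ⟨hs, hst.trans hu⟩ t ⟨ht, hu⟩ hst).symm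
  have hσ0 : σ 0 = q := by
    refine (hd.eq_of_eq_zero ?_).symm
    refine tendsto_nhds_unique (((hd.continuous_right q).tendsto _).comp (hσ 0 le_rfl))
      (tendsto_const_nhds.congr fun t => ?_)
    simp [hγ0, hd.self]
  have hsup : ∀ s, 0 ≤ s → ∀ x, b q + s - d x (σ s) ≤ b x := by
    intro s hs x
    have hx : Tendsto (fun t => d x (γ t s)) 𝒰 (𝓝 (d x (σ s))) :=
      ((hd.continuous_right x).tendsto _).comp (hσ s hs)
    refine le_of_tendsto_of_tendsto ((((hb q).mono_left h𝒰).add_const s).sub hx)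
      ((hb x).mono_left h𝒰) ?_
    filter_upwards [hpos, hfar' s] with t ht hst
    obtain ⟨hz1, hz2⟩ := hz t ht
    have h1 := hd.sInf_image_le (x := x) hz1
    have h2 := hd.triangle x (γ t s) (z t)
    have h3 := hγ t s ⟨hs, hst⟩ _ ⟨hd.nonneg _ _, le_rfl⟩ hst
    rw [hγ1] at h3
    linarith
  have hLip : ∀ x y, b y - d x y ≤ b x := by
    intro x y
    refine le_of_tendsto_of_tendsto ((hb y).sub_const _) (hb x) ?_
    filter_upwards [eventually_ge_atTop 0] with t ht
    linarith [hd.sInf_image_le_add hK p ht x y]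
  refine ⟨σ, hσ0, hσmin, hsup, fun t ht => le_antisymm ?_ ?_⟩
  · have h1 := hLip q (σ t)
    have h2 := hσmin 0 (mem_Ici.2 le_rfl) t ht ht
    rw [hσ0] at h2
    linarith
  · have := hsup t ht (σ t)
    rw [hd.self] at this
    linarith

end Busemann

end IsLengthQuasiMetric

/-! ### Minkowski norms -/

namespace IsMinkowskiNorm

variable {V : Type*} [NormedAddCommGroup V] [NormedSpace ℝ V] {f : V → ℝ}

lemma map_zero (hf : IsMinkowskiNorm f) : f 0 = 0 := by
  simpa using hf.homogeneous 0 le_rfl 0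

lemma contDiffAt (hf : IsMinkowskiNorm f) {v : V} (hv : v ≠ 0) : ContDiffAt ℝ ∞ f v :=
  hf.smooth.contDiffAt (isOpen_ne.mem_nhds hv)

lemma contDiffAt_sq (hf : IsMinkowskiNorm f) {v : V} (hv : v ≠ 0) :
    ContDiffAt ℝ ∞ (fun z => f z ^ 2) v :=
  (hf.contDiffAt hv).pow 2

lemma contDiffAt_fderiv_sq (hf : IsMinkowskiNorm f) {v : V} (hv : v ≠ 0) :
    ContDiffAt ℝ ∞ (fderiv ℝ (fun z => f z ^ 2)) v :=
  (hf.contDiffAt_sq hv).fderiv_right (by simp)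

lemma hasFDerivAt_sq (hf : IsMinkowskiNorm f) {v : V} (hv : v ≠ 0) :
    HasFDerivAt (fun z => f z ^ 2) (fderiv ℝ (fun z => f z ^ 2) v) v :=
  ((hf.contDiffAt_sq hv).differentiableAt (by simp)).hasFDerivAt

lemma hasFDerivAt_fderiv_sq (hf : IsMinkowskiNorm f) {v : V} (hv : v ≠ 0) :
    HasFDerivAt (fderiv ℝ (fun z => f z ^ 2)) (fderiv ℝ (fderiv ℝ (fun z => f z ^ 2)) v) v :=
  ((hf.contDiffAt_fderiv_sq hv).differentiableAt (by simp)).hasFDerivAt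

lemma fderiv_sq (hf : IsMinkowskiNorm f) {v : V} (hv : v ≠ 0) (w : V) :
    fderiv ℝ (fun z => f z ^ 2) v w = 2 * f v * fderiv ℝ f v w := by
  have h := ((hf.contDiffAt hv).differentiableAt (by simp)).hasFDerivAt.pow 2
  rw [h.fderiv]
  simp

lemma fderiv_sq_smul (hf : IsMinkowskiNorm f) {t : ℝ} (ht : 0 < t) (v : V) :
    fderiv ℝ (fun z => f z ^ 2) (t • v) = t • fderiv ℝ (fun z => f z ^ 2) v := by
  have h1 := fderiv_comp_smul (𝕜 := ℝ) (f := fun z => f z ^ 2) (x := v) t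
  have h2 : (fun z => f (t • z) ^ 2) = t ^ 2 • fun z => f z ^ 2 := by
    ext z
    simp only [hf.homogeneous t ht.le, Pi.smul_apply, smul_eq_mul]
    ring
  have : Invertible (t ^ 2) := invertibleOfNonzero (by positivity)
  rw [h2, fderiv_const_smul_of_invertible] at h1
  have h3 := congrArg (fun z => t⁻¹ • z) h1
  simp only [smul_smul, inv_mul_cancel₀ ht.ne', one_smul] at h3
  rw [← h3]
  congr 1
  field_simp

/-- The fundamental form is positively homogeneous of degree zero in the base vector. -/
lemma fundamentalForm_smul (hf : IsMinkowskiNorm f) {t : ℝ} (ht : 0 < t) {v : V} (hv : v ≠ 0)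
    (u w : V) :
    fundamentalForm f (t • v) u w = fundamentalForm f v u w := by
  have h1 := fderiv_comp_smul (𝕜 := ℝ) (f := fderiv ℝ (fun z => f z ^ 2)) (x := v) t
  have h2 : (fun z => fderiv ℝ (fun z => f z ^ 2) (t • z)) = t • fderiv ℝ (fun z => f z ^ 2) := by
    ext1 z
    exact hf.fderiv_sq_smul ht z
  have h4 : fderiv ℝ (t • fderiv ℝ (fun z => f z ^ 2)) v
      = t • fderiv ℝ (fderiv ℝ (fun z => f z ^ 2)) v :=
    ((hf.hasFDerivAt_fderiv_sq hv).const_smul t).fderiv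
  rw [h2, h4] at h1
  have h3 := congrArg (fun z => t⁻¹ • z) h1
  simp only [smul_smul, inv_mul_cancel₀ ht.ne', one_smul] at h3
  unfold fundamentalForm
  rw [h3]

lemma fderiv_sq_self (hf : IsMinkowskiNorm f) {v : V} (hv : v ≠ 0) :
    fderiv ℝ (fun z => f z ^ 2) v v = 2 * f v ^ 2 := by
  have h1 : HasDerivAt (fun s : ℝ => f (s • v) ^ 2) (fderiv ℝ (fun z => f z ^ 2) v v) 1 := by
    have := (hasDerivAt_id (1 : ℝ)).smul_const v
    have h2 : HasFDerivAt (fun z => f z ^ 2) (fderiv ℝ (fun z => f z ^ 2) v) ((1 : ℝ) • v) := by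
      simpa using hf.hasFDerivAt_sq hv
    have h5 := h2.comp_hasDerivAt (1 : ℝ) this
    rw [one_smul] at h5
    exact h5
  have h3 : HasDerivAt (fun s : ℝ => f (s • v) ^ 2) (2 * f v ^ 2) 1 := by
    have h4 : HasDerivAt (fun s : ℝ => s ^ 2 * f v ^ 2) (2 * f v ^ 2) 1 := by
      simpa using (hasDerivAt_pow 2 (1 : ℝ)).mul_const (f v ^ 2)
    refine h4.congr_of_eventuallyEq ?_
    filter_upwards [lt_mem_nhds (zero_lt_one (α := ℝ))] with s hs
    rw [hf.homogeneous s hs.le]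
    ring
  exact h1.unique h3

/-- Euler's relation `g_v(v, w) = ½ D(f²)(v)(w)`. -/
lemma fundamentalForm_self_left (hf : IsMinkowskiNorm f) {v : V} (hv : v ≠ 0) (w : V) :
    fundamentalForm f v v w = (1 / 2) * fderiv ℝ (fun z => f z ^ 2) v w := by
  have h1 : HasDerivAt (fun s : ℝ => fderiv ℝ (fun z => f z ^ 2) (s • v))
      (fderiv ℝ (fderiv ℝ (fun z => f z ^ 2)) v v) 1 := by
    have := (hasDerivAt_id (1 : ℝ)).smul_const v
    have h2 : HasFDerivAt (fderiv ℝ (fun z => f z ^ 2))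
        (fderiv ℝ (fderiv ℝ (fun z => f z ^ 2)) v) ((1 : ℝ) • v) := by
      simpa using hf.hasFDerivAt_fderiv_sq hv
    have h5 := h2.comp_hasDerivAt (1 : ℝ) this
    rw [one_smul] at h5
    exact h5
  have h3 : HasDerivAt (fun s : ℝ => fderiv ℝ (fun z => f z ^ 2) (s • v))
      (fderiv ℝ (fun z => f z ^ 2) v) 1 := by
    have h4 : HasDerivAt (fun s : ℝ => s • fderiv ℝ (fun z => f z ^ 2) v)
        (fderiv ℝ (fun z => f z ^ 2) v) 1 := by
      simpa using (hasDerivAt_id (1 : ℝ)).smul_const (fderiv ℝ (fun z => f z ^ 2) v)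
    refine h4.congr_of_eventuallyEq ?_
    filter_upwards [lt_mem_nhds (zero_lt_one (α := ℝ))] with s hs
    exact hf.fderiv_sq_smul hs v
  unfold fundamentalForm
  rw [h1.unique h3]

lemma fundamentalForm_self (hf : IsMinkowskiNorm f) {v : V} (hv : v ≠ 0) :
    fundamentalForm f v v v = f v ^ 2 := by
  rw [hf.fundamentalForm_self_left hv, hf.fderiv_sq_self hv]
  ring

lemma pos (hf : IsMinkowskiNorm f) {v : V} (hv : v ≠ 0) : 0 < f v := by
  have h := hf.stronglyConvex v hv v hv
  rw [hf.fundamentalForm_self hv] at h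
  exact lt_of_le_of_ne (hf.nonneg v) fun h0 => by simp [← h0] at h

/-- Uniform strong convexity of `f²`. When the segment from `v` to `w` meets the origin, where `f²`
is not twice differentiable, the inequality follows from homogeneity. -/
lemma sq_add_le_sq (hf : IsMinkowskiNorm f) {κ : ℝ}
    (hκ : ∀ v, v ≠ 0 → ∀ w, κ * ‖w‖ ^ 2 ≤ fundamentalForm f v w w) {v : V} (hv : v ≠ 0) (w : V) :
    f v ^ 2 + fderiv ℝ (fun z => f z ^ 2) v (w - v) + κ * ‖w - v‖ ^ 2 ≤ f w ^ 2 := by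
  by_cases h0 : ∃ s ∈ Icc (0 : ℝ) 1, v + s • (w - v) = 0
  · obtain ⟨s, hs, h⟩ := h0
    have hs0 : s ≠ 0 := by
      rintro rfl
      simp at h
      exact hv h
    have hspos : 0 < s := lt_of_le_of_ne hs.1 hs0.symm
    -- then `w = -σ v` with `σ ≥ 0`, and both sides are explicit
    set σ := 1 / s - 1 with hσ
    have hσ0 : 0 ≤ σ := by
      have : 1 ≤ 1 / s := by rw [le_div_iff₀ hspos]; linarith [hs.2]
      linarith
    have hwv : w - v = -(1 + σ) • v := by
      have h1 : s⁻¹ • (v + s • (w - v)) = 0 := by rw [h, smul_zero]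
      rw [smul_add, smul_smul, inv_mul_cancel₀ hs0, one_smul, add_comm, ← eq_neg_iff_add_eq_zero]
        at h1
      rw [h1, ← neg_smul]
      congr 1
      rw [hσ]; field_simp; ring
    have hw : w = σ • (-v) := by
      have : w = (w - v) + v := by abel
      rw [this, hwv, neg_add, add_smul]
      simp
    have h2 : κ * ‖v‖ ^ 2 ≤ f v ^ 2 := by
      rw [← hf.fundamentalForm_self hv]; exact hκ v hv v
    have h3 : κ * ‖v‖ ^ 2 ≤ f (-v) ^ 2 := by
      rw [← hf.fundamentalForm_self (neg_ne_zero.2 hv)]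
      simpa using hκ (-v) (neg_ne_zero.2 hv) (-v)
    have h4 : f w ^ 2 = σ ^ 2 * f (-v) ^ 2 := by
      rw [hw, hf.homogeneous σ hσ0]; ring
    rw [h4, hwv, map_smul, hf.fderiv_sq_self hv, norm_smul, Real.norm_eq_abs, mul_pow, sq_abs,
      smul_eq_mul]
    nlinarith [mul_le_mul_of_nonneg_left h2 (show 0 ≤ 1 + 2 * σ by linarith),
      mul_le_mul_of_nonneg_left h3 (sq_nonneg σ)]
  · -- otherwise `s ↦ f (v + s u) ^ 2 - κ ‖u‖ ^ 2 s ^ 2` is convex on `[0, 1]`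
    push Not at h0
    set u := w - v
    have hline : ∀ s : ℝ, HasDerivAt (fun s : ℝ => v + s • u) u s := fun s => by
      simpa using ((hasDerivAt_id s).smul_const u).const_add v
    have hk : ∀ s ∈ Icc (0 : ℝ) 1, HasDerivAt (fun s : ℝ => f (v + s • u) ^ 2 - κ * ‖u‖ ^ 2 * s ^ 2)
        (fderiv ℝ (fun z => f z ^ 2) (v + s • u) u - κ * ‖u‖ ^ 2 * (2 * s)) s := by
      intro s hs
      have h1 := (hf.hasFDerivAt_sq (h0 s hs)).comp_hasDerivAt s (hline s)
      have h2 : HasDerivAt (fun s : ℝ => κ * ‖u‖ ^ 2 * s ^ 2) (κ * ‖u‖ ^ 2 * (2 * s)) s := by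
        simpa using (hasDerivAt_pow 2 s).const_mul (κ * ‖u‖ ^ 2)
      exact h1.sub h2
    have hk' : ∀ s ∈ Icc (0 : ℝ) 1,
        HasDerivAt (fun s : ℝ => fderiv ℝ (fun z => f z ^ 2) (v + s • u) u - κ * ‖u‖ ^ 2 * (2 * s))
        (2 * fundamentalForm f (v + s • u) u u - κ * ‖u‖ ^ 2 * 2) s := by
      intro s hs
      have h1 : HasDerivAt (fun s : ℝ => fderiv ℝ (fun z => f z ^ 2) (v + s • u))
          (fderiv ℝ (fderiv ℝ (fun z => f z ^ 2)) (v + s • u) u) s :=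
        (hf.hasFDerivAt_fderiv_sq (h0 s hs)).comp_hasDerivAt s (hline s)
      have h2 : HasDerivAt (fun s : ℝ => fderiv ℝ (fun z => f z ^ 2) (v + s • u) u)
          (fderiv ℝ (fderiv ℝ (fun z => f z ^ 2)) (v + s • u) u u) s := by
        simpa using h1.clm_apply (hasDerivAt_const s u)
      have h3 : HasDerivAt (fun s : ℝ => κ * ‖u‖ ^ 2 * (2 * s)) (κ * ‖u‖ ^ 2 * 2) s := by
        simpa using ((hasDerivAt_id s).const_mul 2).const_mul (κ * ‖u‖ ^ 2)
      have h4 : 2 * fundamentalForm f (v + s • u) u u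
          = fderiv ℝ (fderiv ℝ (fun z => f z ^ 2)) (v + s • u) u u := by
        simp only [fundamentalForm]
        ring
      rw [h4]
      exact h2.sub h3
    have hmono : MonotoneOn
        (fun s : ℝ => fderiv ℝ (fun z => f z ^ 2) (v + s • u) u - κ * ‖u‖ ^ 2 * (2 * s))
        (Icc 0 1) := by
      apply monotoneOn_of_deriv_nonneg (convex_Icc 0 1)
      · exact fun s hs => (hk' s hs).continuousAt.continuousWithinAt
      · rw [interior_Icc]
        exact fun s hs => (hk' s (Ioo_subset_Icc_self hs)).differentiableAt.differentiableWithinAt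
      · rw [interior_Icc]
        intro s hs
        rw [(hk' s (Ioo_subset_Icc_self hs)).deriv]
        linarith [hκ _ (h0 s (Ioo_subset_Icc_self hs)) u]
    obtain ⟨s, hs, heq⟩ := exists_hasDerivAt_eq_slope _ _ (zero_lt_one (α := ℝ))
      (fun s hs => (hk s hs).continuousAt.continuousWithinAt)
      (fun s hs => hk s (Ioo_subset_Icc_self hs))
    have h5 := hmono (left_mem_Icc.2 zero_le_one) (Ioo_subset_Icc_self hs) hs.1.le
    simp only at h5 heq
    rw [heq] at h5
    have hw : v + u = w := by simp [u]
    simp only [zero_smul, add_zero, one_smul, hw] at h5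
    norm_num at h5
    linarith

/-- The fundamental inequality `D f(v)(w) ≤ f(w)` for Minkowski norms. -/
lemma fderiv_le (hf : IsMinkowskiNorm f) {v : V} (hv : v ≠ 0) (w : V) :
    fderiv ℝ f v w ≤ f w := by
  have hfv := hf.pos hv
  have key : ∀ t : ℝ, 0 ≤ t → 2 * f v * (t * fderiv ℝ f v w) - f v ^ 2 ≤ t ^ 2 * f w ^ 2 := by
    intro t ht
    have h := hf.sq_add_le_sq (κ := 0) (fun v hv w => by
      rcases eq_or_ne w 0 with rfl | hw
      · simp [fundamentalForm]
      · simpa using (hf.stronglyConvex v hv w hw).le) hv (t • w)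
    rw [map_sub, hf.fderiv_sq_self hv, hf.fderiv_sq hv, map_smul, hf.homogeneous t ht,
      smul_eq_mul] at h
    linarith
  rcases eq_or_ne w 0 with rfl | hw
  · simp [hf.map_zero]
  · -- the scaling for which `t • w` has the same length as `v`
    have hfw := hf.pos hw
    have h := key (f v / f w) (by positivity)
    rw [div_pow, div_mul_cancel₀ _ (by positivity)] at h
    have h2 : 2 * f v * (f v / f w * fderiv ℝ f v w) ≤ 2 * f v ^ 2 := by linarith
    have h3 : 2 * f v * (f v / f w * fderiv ℝ f v w) = 2 * f v ^ 2 * (fderiv ℝ f v w / f w) := by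
      ring
    rw [h3] at h2
    have h4 : fderiv ℝ f v w / f w ≤ 1 := by
      by_contra hc
      push Not at hc
      nlinarith [pow_pos hfv 2]
    rwa [div_le_one hfw] at h4

lemma fderiv_self (hf : IsMinkowskiNorm f) {v : V} (hv : v ≠ 0) : fderiv ℝ f v v = f v := by
  have h1 := hf.fderiv_sq_self hv
  rw [hf.fderiv_sq hv] at h1
  have := hf.pos hv
  have h2 : 2 * f v * (fderiv ℝ f v v - f v) = 0 := by linarith
  rcases mul_eq_zero.1 h2 with h | h <;> linarith

end IsMinkowskiNorm

/-! ### Finsler metrics in coordinates -/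

/-- A Finsler metric `f = f(x, y)` on an open subset `U` of a vector space. -/
structure IsChartMetric {E : Type*} [NormedAddCommGroup E] [NormedSpace ℝ E] (U : Set E)
    (f : E → E → ℝ) : Prop where
  isOpen : IsOpen U
  smooth : ContDiffOn ℝ ∞ (fun z : E × E => f z.1 z.2) (U ×ˢ {0}ᶜ)
  minkowski : ∀ x ∈ U, IsMinkowskiNorm (f x)

namespace IsChartMetric

variable {E : Type*} [NormedAddCommGroup E] [NormedSpace ℝ E] {U : Set E} {f : E → E → ℝ}

lemma contDiffAt (hf : IsChartMetric U f) {z : E × E} (h1 : z.1 ∈ U) (h2 : z.2 ≠ 0) :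
    ContDiffAt ℝ ∞ (fun z : E × E => f z.1 z.2) z :=
  hf.smooth.contDiffAt ((hf.isOpen.prod isOpen_compl_singleton).mem_nhds ⟨h1, h2⟩)

lemma contDiffAt_sq (hf : IsChartMetric U f) {z : E × E} (h1 : z.1 ∈ U) (h2 : z.2 ≠ 0) :
    ContDiffAt ℝ ∞ (fun z : E × E => f z.1 z.2 ^ 2) z :=
  (hf.contDiffAt h1 h2).pow 2

lemma contDiffAt_fderiv_left (hf : IsChartMetric U f) {z : E × E} (h1 : z.1 ∈ U) (h2 : z.2 ≠ 0) :
    ContDiffAt ℝ ∞ (fun z : E × E => fderiv ℝ (fun x => f x z.2) z.1) z := by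
  refine ContDiffAt.fderiv (f := fun (z : E × E) x => f x z.2) (g := fun z => z.1) (n := ∞) ?_
    contDiffAt_fst (by simp)
  have h := hf.contDiffAt (z := (z.1, z.2)) h1 h2
  exact ContDiffAt.comp (f := fun q : (E × E) × E => (q.2, q.1.2)) (z, z.1)
    (g := fun z : E × E => f z.1 z.2) h
    (contDiffAt_snd.prodMk (contDiffAt_snd.comp _ contDiffAt_fst))

lemma contDiffAt_fderiv_sq (hf : IsChartMetric U f) {z : E × E} (h1 : z.1 ∈ U) (h2 : z.2 ≠ 0) :
    ContDiffAt ℝ ∞ (fun z : E × E => fderiv ℝ (fun y => f z.1 y ^ 2) z.2) z := by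
  refine ContDiffAt.fderiv (f := fun (z : E × E) y => f z.1 y ^ 2) (g := fun z => z.2) (n := ∞) ?_
    contDiffAt_snd (by simp)
  have h := hf.contDiffAt_sq (z := (z.1, z.2)) h1 h2
  exact ContDiffAt.comp (f := fun q : (E × E) × E => (q.1.1, q.2)) (z, z.2)
    (g := fun z : E × E => f z.1 z.2 ^ 2) h
    ((contDiffAt_fst.comp _ contDiffAt_fst).prodMk contDiffAt_snd)

lemma contDiffAt_fderiv_fderiv_sq (hf : IsChartMetric U f) {z : E × E} (h1 : z.1 ∈ U)
    (h2 : z.2 ≠ 0) :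
    ContDiffAt ℝ ∞ (fun z : E × E => fderiv ℝ (fderiv ℝ (fun y => f z.1 y ^ 2)) z.2) z := by
  refine ContDiffAt.fderiv (f := fun (z : E × E) y => fderiv ℝ (fun y => f z.1 y ^ 2) y)
    (g := fun z => z.2) (n := ∞) ?_ contDiffAt_snd (by simp)
  have h := hf.contDiffAt_fderiv_sq (z := (z.1, z.2)) h1 h2
  exact ContDiffAt.comp (f := fun q : (E × E) × E => (q.1.1, q.2)) (z, z.2)
    (g := fun z : E × E => fderiv ℝ (fun y => f z.1 y ^ 2) z.2) h
    ((contDiffAt_fst.comp _ contDiffAt_fst).prodMk contDiffAt_snd)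

lemma differentiableAt_left (hf : IsChartMetric U f) {x y : E} (hx : x ∈ U) (hy : y ≠ 0) :
    DifferentiableAt ℝ (fun x => f x y) x := by
  have h := (hf.contDiffAt (z := (x, y)) hx hy).differentiableAt (by simp)
  exact DifferentiableAt.comp (f := fun x => (x, y)) x h
    (differentiableAt_id.prodMk (differentiableAt_const y))

/-- Uniform bounds for the metric `f` near a point: on `B` it is comparable to the given norm,
Lipschitz in the base point, and uniformly strongly convex. -/
structure Bounds (f : E → E → ℝ) (B : Set E) (A : ℝ) : Prop where
  pos : 0 < A
  norm_le : ∀ x ∈ B, ∀ y, ‖y‖ ≤ A * f x y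
  le_norm : ∀ x ∈ B, ∀ y, f x y ≤ A * ‖y‖
  lipschitz : ∀ x ∈ B, ∀ x' ∈ B, ∀ y, f x y ≤ f x' y + A * ‖x - x'‖ * ‖y‖
  convex : ∀ x ∈ B, ∀ y, y ≠ 0 → ∀ w, ‖w‖ ^ 2 ≤ A * fundamentalForm (f x) y w w

lemma exists_bounds [FiniteDimensional ℝ E] (hf : IsChartMetric U f) {x₀ : E} (hx₀ : x₀ ∈ U) :
    ∃ r > 0, Metric.closedBall x₀ r ⊆ U ∧ ∃ A, Bounds f (Metric.closedBall x₀ r) A := by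
  obtain ⟨r, hr, hrU⟩ := Metric.nhds_basis_closedBall.mem_iff.1 (hf.isOpen.mem_nhds hx₀)
  refine ⟨r, hr, hrU, ?_⟩
  set B := Metric.closedBall x₀ r
  have hS : ∀ y ∈ Metric.sphere (0 : E) 1, y ≠ 0 := by
    rintro y hy rfl
    simp at hy
  have hcB : IsCompact B := isCompact_closedBall x₀ r
  have hcS : IsCompact (Metric.sphere (0 : E) 1) := isCompact_sphere 0 1
  have hf1 : ContinuousOn (fun z : E × E => f z.1 z.2) (B ×ˢ Metric.sphere (0 : E) 1) := fun z hz =>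
    (hf.contDiffAt (hrU hz.1) (hS _ hz.2)).continuousAt.continuousWithinAt
  obtain ⟨C₁, h₁⟩ := (hcB.prod hcS).exists_bound_of_continuousOn hf1
  obtain ⟨C₂, h₂⟩ := (hcB.prod hcS).exists_bound_of_continuousOn
    (hf1.inv₀ fun z hz => ((hf.minkowski _ (hrU hz.1)).pos (hS _ hz.2)).ne')
  obtain ⟨C₃, h₃⟩ := (hcB.prod hcS).exists_bound_of_continuousOn
    (f := fun z : E × E => fderiv ℝ (fun x => f x z.2) z.1)
    (fun z hz => (hf.contDiffAt_fderiv_left (hrU hz.1) (hS _ hz.2)).continuousAt.continuousWithinAt)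
  have hff : ∀ q : (E × E) × E, q.1.1 ∈ B → q.1.2 ≠ 0 →
      ContinuousAt (fun q : (E × E) × E => fundamentalForm (f q.1.1) q.1.2 q.2 q.2) q := by
    intro q h1 h2
    have h := (hf.contDiffAt_fderiv_fderiv_sq (z := q.1) (hrU h1) h2).continuousAt
    have h' : ContinuousAt (fun q : (E × E) × E =>
        fderiv ℝ (fderiv ℝ (fun y => f q.1.1 y ^ 2)) q.1.2) q :=
      ContinuousAt.comp (f := fun q : (E × E) × E => q.1) h continuousAt_fst
    exact continuousAt_const.mul ((h'.clm_apply continuousAt_snd).clm_apply continuousAt_snd)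
  obtain ⟨C₄, h₄⟩ := ((hcB.prod hcS).prod hcS).exists_bound_of_continuousOn
    (f := fun q : (E × E) × E => (fundamentalForm (f q.1.1) q.1.2 q.2 q.2)⁻¹)
    (fun q hq => ((hff q hq.1.1 (hS _ hq.1.2)).inv₀ ((hf.minkowski _ (hrU hq.1.1)).stronglyConvex _
      (hS _ hq.1.2) _ (hS _ hq.2)).ne').continuousWithinAt)
  set A := 1 + |C₁| + |C₂| + |C₃| + |C₄|
  have hA : 0 < A := by positivity
  have hA₁ : C₁ ≤ A := by
    linarith [le_abs_self C₁, abs_nonneg C₂, abs_nonneg C₃, abs_nonneg C₄]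
  have hA₂ : C₂ ≤ A := by
    linarith [le_abs_self C₂, abs_nonneg C₁, abs_nonneg C₃, abs_nonneg C₄]
  have hA₃ : C₃ ≤ A := by
    linarith [le_abs_self C₃, abs_nonneg C₂, abs_nonneg C₁, abs_nonneg C₄]
  have hA₄ : C₄ ≤ A := by
    linarith [le_abs_self C₄, abs_nonneg C₂, abs_nonneg C₃, abs_nonneg C₁]
  -- by homogeneity it is enough to consider vectors of norm one
  have hunit : ∀ y : E, y ≠ 0 → ∃ u ∈ Metric.sphere (0 : E) 1, y = ‖y‖ • u := by
    intro y hy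
    have := norm_pos_iff.2 hy
    refine ⟨‖y‖⁻¹ • y, ?_, ?_⟩
    · simp [norm_smul, this.ne']
    · rw [smul_smul, mul_inv_cancel₀ this.ne', one_smul]
  refine ⟨A, hA, fun x hx y => ?_, fun x hx y => ?_, fun x hx x' hx' y => ?_,
    fun x hx y hy w => ?_⟩
  · have hm := hf.minkowski x (hrU hx)
    rcases eq_or_ne y 0 with rfl | hy
    · simp [hm.map_zero]
    obtain ⟨u, hu, e⟩ := hunit y hy
    have h := h₂ (x, u) ⟨hx, hu⟩
    have hp := hm.pos (hS u hu)
    have hfy : f x y = ‖y‖ * f x u := by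
      conv_lhs => rw [e]
      exact hm.homogeneous _ (norm_nonneg y) u
    have h' : (f x u)⁻¹ ≤ A := (le_abs_self _).trans (h.trans hA₂)
    rw [hfy]
    have : 1 ≤ A * f x u := by rwa [inv_le_iff_one_le_mul₀ hp] at h'
    nlinarith [norm_nonneg y]
  · have hm := hf.minkowski x (hrU hx)
    rcases eq_or_ne y 0 with rfl | hy
    · simp [hm.map_zero]
    obtain ⟨u, hu, e⟩ := hunit y hy
    have h : f x u ≤ A := (le_abs_self _).trans ((h₁ (x, u) ⟨hx, hu⟩).trans hA₁)
    have hfy : f x y = ‖y‖ * f x u := by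
      conv_lhs => rw [e]
      exact hm.homogeneous _ (norm_nonneg y) u
    rw [hfy, mul_comm]
    exact mul_le_mul_of_nonneg_right h (norm_nonneg y)
  · have hm := hf.minkowski x (hrU hx)
    have hm' := hf.minkowski x' (hrU hx')
    rcases eq_or_ne y 0 with rfl | hy
    · simp [hm.map_zero, hm'.map_zero]
    obtain ⟨u, hu, e⟩ := hunit y hy
    have hfy : f x y = ‖y‖ * f x u := by
      conv_lhs => rw [e]
      exact hm.homogeneous _ (norm_nonneg y) u
    have hfy' : f x' y = ‖y‖ * f x' u := by
      conv_lhs => rw [e]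
      exact hm'.homogeneous _ (norm_nonneg y) u
    have h := (convex_closedBall x₀ r).norm_image_sub_le_of_norm_fderiv_le (𝕜 := ℝ)
      (f := fun x => f x u) (C := A)
      (fun z hz => hf.differentiableAt_left (hrU hz) (hS u hu))
      (fun z hz => (h₃ (z, u) ⟨hz, hu⟩).trans hA₃) hx' hx
    have h' : f x u - f x' u ≤ A * ‖x - x'‖ := (le_abs_self _).trans h
    rw [hfy, hfy']
    nlinarith [norm_nonneg y, mul_le_mul_of_nonneg_right h' (norm_nonneg y)]
  · have hm := hf.minkowski x (hrU hx)
    rcases eq_or_ne w 0 with rfl | hw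
    · simp [fundamentalForm]
    obtain ⟨u, hu, e⟩ := hunit y hy
    obtain ⟨v, hv, e'⟩ := hunit w hw
    have hp := hm.stronglyConvex u (hS u hu) v (hS v hv)
    have h' : (fundamentalForm (f x) u v v)⁻¹ ≤ A :=
      (le_abs_self _).trans ((h₄ ((x, u), v) ⟨⟨hx, hu⟩, hv⟩).trans hA₄)
    have heq : fundamentalForm (f x) y w w = ‖w‖ ^ 2 * fundamentalForm (f x) u v v := by
      conv_lhs => rw [e, e']
      rw [hm.fundamentalForm_smul (norm_pos_iff.2 hy) (hS u hu)]
      simp only [fundamentalForm, map_smul, smul_apply, smul_eq_mul]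
      ring
    have : 1 ≤ A * fundamentalForm (f x) u v v := by rwa [inv_le_iff_one_le_mul₀ hp] at h'
    rw [heq]
    nlinarith [sq_nonneg ‖w‖]

namespace Bounds

variable {B : Set E} {A : ℝ}

lemma nonneg (hA : Bounds f B A) {x : E} (hx : x ∈ B) (y : E) : 0 ≤ f x y := by
  have h := hA.norm_le x hx y
  have := norm_nonneg y
  by_contra h0
  push Not at h0
  nlinarith [hA.pos]

lemma mono (hA : Bounds f B A) {B' : Set E} (h : B' ⊆ B) : Bounds f B' A :=
  ⟨hA.pos, fun x hx => hA.norm_le x (h hx), fun x hx => hA.le_norm x (h hx),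
    fun x hx x' hx' => hA.lipschitz x (h hx) x' (h hx'), fun x hx => hA.convex x (h hx)⟩

lemma sq_add_le_sq (hA : Bounds f B A) {x : E} (hx : x ∈ B) (hm : IsMinkowskiNorm (f x)) {v : E}
    (hv : v ≠ 0) (w : E) :
    f x v ^ 2 + fderiv ℝ (fun z => f x z ^ 2) v (w - v) + A⁻¹ * ‖w - v‖ ^ 2 ≤ f x w ^ 2 := by
  refine hm.sq_add_le_sq (fun v hv w => ?_) hv w
  rw [inv_mul_le_iff₀ hA.pos]
  exact hA.convex x hx v hv w

end Bounds

end IsChartMetric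

/-! ### Calculus on intervals -/

section DifferenceQuotients

variable {E : Type*} [NormedAddCommGroup E] [NormedSpace ℝ E] {γ : ℝ → E} {α β C : ℝ}

lemma slope_sub_slope_left {s m t : ℝ} (hsm : s ≠ m) (hst : s ≠ t) (hmt : m ≠ t) :
    slope γ s t - slope γ s m = ((t - m) / (t - s)) • (slope γ m t - slope γ s m) := by
  have h1 : m - s ≠ 0 := sub_ne_zero.2 hsm.symm
  have h2 : t - s ≠ 0 := sub_ne_zero.2 hst.symm
  have h3 : t - m ≠ 0 := sub_ne_zero.2 hmt.symm
  simp only [slope, vsub_eq_sub]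
  match_scalars <;> field_simp <;> ring

lemma slope_sub_slope_right {s m t : ℝ} (hsm : s ≠ m) (hst : s ≠ t) (hmt : m ≠ t) :
    slope γ s t - slope γ m t = ((m - s) / (t - s)) • (slope γ s m - slope γ m t) := by
  have h1 : m - s ≠ 0 := sub_ne_zero.2 hsm.symm
  have h2 : t - s ≠ 0 := sub_ne_zero.2 hst.symm
  have h3 : t - m ≠ 0 := sub_ne_zero.2 hmt.symm
  simp only [slope, vsub_eq_sub]
  match_scalars <;> field_simp <;> ring

variable (h : ∀ s m t, α ≤ s → s < m → m < t → t ≤ β →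
  (m - s) * (t - m) * ‖slope γ s m - slope γ m t‖ ^ 2 ≤ C * (t - s) ^ 3)
include h

/-- Passing to the longer, left part of an interval changes the difference quotient little. -/
lemma norm_slope_sub_left_le {s m t : ℝ} (hs : α ≤ s) (hsm : s < m) (hmt : m ≤ t) (ht : t ≤ β)
    (hm : t - m ≤ m - s) : ‖slope γ s t - slope γ s m‖ ≤ √(C * (t - s)) := by
  rcases hmt.eq_or_lt with rfl | hmt
  · simp
  apply Real.le_sqrt_of_sq_le
  have h1 := h s m t hs hsm hmt ht
  have p1 : 0 < m - s := by linarith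
  have p2 : 0 < t - m := by linarith
  have p3 : 0 < t - s := by linarith
  rw [slope_sub_slope_left hsm.ne (hsm.trans hmt).ne hmt.ne, norm_smul, mul_pow, Real.norm_eq_abs,
    sq_abs, norm_sub_rev, div_pow, div_mul_eq_mul_div, div_le_iff₀ (by positivity)]
  set N := ‖slope γ s m - slope γ m t‖ ^ 2
  have hN : 0 ≤ N := sq_nonneg _
  calc (t - m) ^ 2 * N = (t - m) * ((t - m) * N) := by ring
    _ ≤ (m - s) * ((t - m) * N) := by gcongr
    _ ≤ C * (t - s) ^ 3 := by linarith
    _ = _ := by ring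

/-- Passing to the longer, right part of an interval changes the difference quotient little. -/
lemma norm_slope_sub_right_le {s m t : ℝ} (hs : α ≤ s) (hsm : s ≤ m) (hmt : m < t) (ht : t ≤ β)
    (hm : m - s ≤ t - m) : ‖slope γ s t - slope γ m t‖ ≤ √(C * (t - s)) := by
  rcases hsm.eq_or_lt with rfl | hsm
  · simp
  apply Real.le_sqrt_of_sq_le
  have h1 := h s m t hs hsm hmt ht
  have p1 : 0 < m - s := by linarith
  have p2 : 0 < t - m := by linarith
  have p3 : 0 < t - s := by linarith
  rw [slope_sub_slope_right hsm.ne (hsm.trans hmt).ne hmt.ne, norm_smul, mul_pow, Real.norm_eq_abs,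
    sq_abs, div_pow, div_mul_eq_mul_div, div_le_iff₀ (by positivity)]
  set N := ‖slope γ s m - slope γ m t‖ ^ 2
  have hN : 0 ≤ N := sq_nonneg _
  calc (m - s) ^ 2 * N = (m - s) * ((m - s) * N) := by ring
    _ ≤ (t - m) * ((m - s) * N) := by gcongr
    _ ≤ C * (t - s) ^ 3 := by linarith
    _ = _ := by ring

/-- Difference quotients over nested intervals are close. Halving the outer interval repeatedly
gives a geometric series. -/
lemma norm_slope_sub_slope_le (hC : 0 ≤ C) {s s' t' t : ℝ} (hs : α ≤ s) (hss : s ≤ s')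
    (hst : s' < t') (htt : t' ≤ t) (ht : t ≤ β) :
    ‖slope γ s t - slope γ s' t'‖ ≤ 8 * √(C * (t - s)) := by
  obtain ⟨k, hk⟩ : ∃ k : ℕ, t - s ≤ 2 ^ k * (t' - s') := by
    obtain ⟨k, hk⟩ := pow_unbounded_of_one_lt ((t - s) / (t' - s')) (one_lt_two (α := ℝ))
    refine ⟨k, ?_⟩
    rw [div_lt_iff₀ (by linarith)] at hk
    exact hk.le
  induction k generalizing s t with
  | zero =>
    have e1 : s = s' := by linarith
    have e2 : t = t' := by linarith
    subst e1 e2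
    rw [sub_self, norm_zero]
    positivity
  | succ k ih =>
    have half : ∀ s' t', s ≤ s' → s' < t' → t' ≤ t → t - s ≤ 2 * (t' - s') →
        ‖slope γ s t - slope γ s' t'‖ ≤ 2 * √(C * (t - s)) := by
      intro s' t' hss hst htt hlen
      have h1 := norm_slope_sub_left_le h hs (show s < t' by linarith) htt ht (by linarith)
      have h2 := norm_slope_sub_right_le h hs hss hst (htt.trans ht) (by linarith)
      have h3 : √(C * (t' - s)) ≤ √(C * (t - s)) := by gcongr
      have h4 := norm_sub_le_norm_sub_add_norm_sub (slope γ s t) (slope γ s t') (slope γ s' t')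
      linarith
    by_cases hlen : t - s ≤ 2 * (t' - s')
    · have := half s' t' hss hst htt hlen
      have : 0 ≤ √(C * (t - s)) := Real.sqrt_nonneg _
      linarith
    · push Not at hlen
      obtain ⟨s₁, t₁, a1, a2, a3, a4, a5⟩ : ∃ s₁ t₁, s ≤ s₁ ∧ s₁ ≤ s' ∧ t' ≤ t₁ ∧ t₁ ≤ t ∧
          t₁ - s₁ = (t - s) / 2 := by
        refine ⟨min s' (t - (t - s) / 2), min s' (t - (t - s) / 2) + (t - s) / 2,
          ?_, ?_, ?_, ?_, ?_⟩
        · exact le_min hss (by linarith)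
        · exact min_le_left _ _
        · rcases min_cases s' (t - (t - s) / 2) with ⟨e, _⟩ | ⟨e, _⟩ <;> rw [e] <;> linarith
        · linarith [min_le_right s' (t - (t - s) / 2)]
        · ring
      have h1 := half s₁ t₁ a1 (by linarith) a4 (by linarith)
      have h2 := ih (hs.trans a1) a2 a3 (a4.trans ht) (by rw [a5]; rw [pow_succ] at hk; linarith)
      have h3 : √(C * (t₁ - s₁)) ≤ 3 / 4 * √(C * (t - s)) := by
        rw [Real.sqrt_le_left (by positivity), mul_pow, Real.sq_sqrt (by
          have : 0 ≤ t - s := by linarith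
          positivity), a5]
        have : 0 ≤ C * (t - s) := mul_nonneg hC (by linarith)
        linarith
      have h4 := norm_sub_le_norm_sub_add_norm_sub (slope γ s t) (slope γ s₁ t₁) (slope γ s' t')
      linarith

/-- A curve is continuously differentiable if its difference quotients over the two parts of a
subdivided interval of length `ℓ` differ by `O(√ℓ)`. The weight `(m - s) * (t - m) / (t - s) ^ 2` in
the hypothesis allows a larger difference if one of the parts is short. -/
theorem exists_continuousOn_hasDerivWithinAt [CompleteSpace E] (hC : 0 ≤ C) (hαβ : α < β) :
    ∃ v : ℝ → E, ContinuousOn v (Icc α β) ∧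
      ∀ t ∈ Icc α β, HasDerivWithinAt γ (v t) (Icc α β) t := by
  have hsub : ∀ s t u x, α ≤ s → s ≤ u → u ≤ t → s ≤ x → x ≤ t → t ≤ β → x ≠ u →
      ‖slope γ s t - slope γ u x‖ ≤ 8 * √(C * (t - s)) := by
    intro s t u x h1 h2 h3 h4 h5 h6 h7
    rcases lt_or_gt_of_ne h7 with h8 | h8
    · rw [slope_comm γ u x]
      exact norm_slope_sub_slope_le h hC h1 h4 h8 h3 h6
    · exact norm_slope_sub_slope_le h hC h1 h2 h8 h5 h6
  have hne : ∀ s t u : ℝ, s < t → u ∈ Icc s t → (𝓝[Icc s t \ {u}] u).NeBot := by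
    intro s t u hst hu
    rw [← accPt_principal_iff_nhdsWithin, ← uniqueDiffWithinAt_iff_accPt (𝕜 := ℝ)]
    exact uniqueDiffOn_Icc hst u hu
  have hex : ∀ t, ∃ v, t ∈ Icc α β → HasDerivWithinAt γ v (Icc α β) t := by
    intro u
    by_cases hu : u ∈ Icc α β
    swap
    · exact ⟨0, fun h => absurd h hu⟩
    have := hne α β u hαβ hu
    have hcauchy : Cauchy (map (slope γ u) (𝓝[Icc α β \ {u}] u)) := by
      rw [Metric.cauchy_iff]
      refine ⟨inferInstance, fun ε hε => ?_⟩
      set δ := ε ^ 2 / (1024 * (C + 1)) with hδ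
      have hδ0 : 0 < δ := by positivity
      set s := max α (u - δ)
      set t := min β (u + δ)
      have hb : 16 * √(C * (t - s)) < ε := by
        have h1 : t - s ≤ 2 * δ := by
          have := min_le_right β (u + δ)
          have := le_max_right α (u - δ)
          linarith
        have h2 : C * (t - s) ≤ (ε / 17) ^ 2 := by
          calc C * (t - s) ≤ (C + 1) * (2 * δ) := by
                have : 0 ≤ (C + 1) * (2 * δ) := by positivity
                nlinarith
            _ = ε ^ 2 / 512 := by rw [hδ]; field_simp; ring
            _ ≤ (ε / 17) ^ 2 := by nlinarith [sq_nonneg ε]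
        have h3 := (Real.sqrt_le_left (by positivity)).2 h2
        linarith
      have hsu : s ≤ u := max_le hu.1 (by linarith)
      have hut : u ≤ t := le_min hu.2 (by linarith)
      refine ⟨slope γ u '' (Icc α β \ {u} ∩ Ioo (u - δ) (u + δ)), ?_, ?_⟩
      · exact image_mem_map (inter_mem self_mem_nhdsWithin
          (mem_nhdsWithin_of_mem_nhds (Ioo_mem_nhds (by linarith) (by linarith))))
      · rintro _ ⟨x, ⟨⟨hx, hxu⟩, hx2⟩, rfl⟩ _ ⟨y, ⟨⟨hy, hyu⟩, hy2⟩, rfl⟩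
        have b1 := hsub s t u x (le_max_left _ _) hsu hut (max_le hx.1 hx2.1.le)
          (le_min hx.2 hx2.2.le) (min_le_left _ _) hxu
        have b2 := hsub s t u y (le_max_left _ _) hsu hut (max_le hy.1 hy2.1.le)
          (le_min hy.2 hy2.2.le) (min_le_left _ _) hyu
        rw [dist_eq_norm]
        have b3 := norm_sub_le_norm_sub_add_norm_sub (slope γ u x) (slope γ s t) (slope γ u y)
        rw [norm_sub_rev] at b1
        linarith
    obtain ⟨v, hv⟩ := cauchy_map_iff_exists_tendsto.1 hcauchy
    exact ⟨v, fun _ => hasDerivWithinAt_iff_tendsto_slope.2 hv⟩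
  choose v hv using hex
  have hbound : ∀ s t u, α ≤ s → s < t → t ≤ β → u ∈ Icc s t →
      ‖slope γ s t - v u‖ ≤ 8 * √(C * (t - s)) := by
    intro s t u h1 h2 h3 hu
    have := hne s t u h2 hu
    have hu' : u ∈ Icc α β := ⟨h1.trans hu.1, hu.2.trans h3⟩
    have hl : Tendsto (slope γ u) (𝓝[Icc s t \ {u}] u) (𝓝 (v u)) :=
      (hasDerivWithinAt_iff_tendsto_slope.1 (hv u hu')).mono_left
        (nhdsWithin_mono _ (sdiff_subset_sdiff_left (Icc_subset_Icc h1 h3)))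
    refine le_of_tendsto (tendsto_const_nhds.sub hl).norm ?_
    filter_upwards [self_mem_nhdsWithin] with x hx
    exact hsub s t u x h1 hu.1 hu.2 hx.1.1 hx.1.2 h3 hx.2
  have hv2 : ∀ s t, α ≤ s → s ≤ t → t ≤ β → ‖v s - v t‖ ≤ 16 * √(C * (t - s)) := by
    intro s t h1 h2 h3
    rcases h2.eq_or_lt with rfl | h2
    · simp
    have b1 := hbound s t s h1 h2 h3 ⟨le_rfl, h2.le⟩
    have b2 := hbound s t t h1 h2 h3 ⟨h2.le, le_rfl⟩
    have b3 := norm_sub_le_norm_sub_add_norm_sub (v s) (slope γ s t) (v t)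
    rw [norm_sub_rev] at b1
    linarith
  refine ⟨v, fun t ht => ?_, fun t ht => hv t ht⟩
  have hz : Tendsto (fun s => 16 * √(C * |s - t|)) (𝓝[Icc α β] t) (𝓝 0) := by
    have hc : Continuous fun s => 16 * √(C * |s - t|) := by fun_prop
    have := hc.tendsto t
    simp only [sub_self, abs_zero, mul_zero, Real.sqrt_zero] at this
    exact this.mono_left nhdsWithin_le_nhds
  refine tendsto_iff_norm_sub_tendsto_zero.2 (squeeze_zero' (Eventually.of_forall
    fun _ => norm_nonneg _) ?_ hz)
  filter_upwards [self_mem_nhdsWithin] with s hs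
  rcases le_total s t with h1 | h1
  · have := hv2 s t hs.1 h1 ht.2
    rwa [abs_sub_comm, abs_of_nonneg (by linarith)]
  · have := hv2 t s ht.1 h1 hs.2
    rwa [norm_sub_rev, abs_of_nonneg (by linarith)]

end DifferenceQuotients

/-- The du Bois-Reymond lemma. -/
theorem eq_add_integral_of_forall_integral_eq_zero {α β : ℝ} (hαβ : α < β) {p q : ℝ → ℝ}
    (hp : ContinuousOn p (Icc α β)) (hq : ContinuousOn q (Icc α β))
    (h : ∀ η η' : ℝ → ℝ, (∀ t, HasDerivAt η (η' t) t) → Continuous η' → η α = 0 → η β = 0 →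
      ∫ t in α..β, (q t * η t + p t * η' t) = 0) :
    ∀ t ∈ Icc α β, p t = p α + ∫ s in α..t, q s := by
  set P : ℝ → ℝ := IccExtend hαβ.le (domRestrict (Icc α β) p)
  set Q : ℝ → ℝ := IccExtend hαβ.le (domRestrict (Icc α β) q)
  have hP : Continuous P := (continuousOn_iff_continuous_domRestrict.1 hp).Icc_extend'
  have hQ : Continuous Q := (continuousOn_iff_continuous_domRestrict.1 hq).Icc_extend'
  have hPp : ∀ t ∈ Icc α β, P t = p t := fun t ht => IccExtend_of_mem hαβ.le _ ht
  have hQq : ∀ t ∈ Icc α β, Q t = q t := fun t ht => IccExtend_of_mem hαβ.le _ ht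
  set R : ℝ → ℝ := fun t => ∫ s in α..t, Q s
  have hR : ∀ t, HasDerivAt R (Q t) t := fun t =>
    intervalIntegral.integral_hasDerivAt_right (hQ.intervalIntegrable _ _)
      hQ.stronglyMeasurable.stronglyMeasurableAtFilter hQ.continuousAt
  have hRc : Continuous R := continuous_iff_continuousAt.2 fun t => (hR t).continuousAt
  set c : ℝ := (∫ t in α..β, (P t - R t)) / (β - α)
  -- the test function is a primitive of `P - R` minus its mean value
  set η' : ℝ → ℝ := fun t => P t - R t - c
  have hη' : Continuous η' := (hP.sub hRc).sub continuous_const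
  set η : ℝ → ℝ := fun t => ∫ s in α..t, η' s
  have hη : ∀ t, HasDerivAt η (η' t) t := fun t =>
    intervalIntegral.integral_hasDerivAt_right (hη'.intervalIntegrable _ _)
      hη'.stronglyMeasurable.stronglyMeasurableAtFilter hη'.continuousAt
  have hηc : Continuous η := continuous_iff_continuousAt.2 fun t => (hη t).continuousAt
  have hηα : η α = 0 := intervalIntegral.integral_same
  have hηβ : η β = 0 := by
    have h1 : η β = (∫ t in α..β, (P t - R t)) - ∫ t in α..β, c :=
      intervalIntegral.integral_sub ((hP.sub hRc).intervalIntegrable _ _)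
        (continuous_const.intervalIntegrable _ _)
    have h2 : β - α ≠ 0 := by linarith
    rw [h1, intervalIntegral.integral_const, smul_eq_mul, mul_div_cancel₀ _ h2, sub_self]
  have h1 : ∫ t in α..β, (Q t * η t + P t * η' t) = 0 := by
    rw [← h η η' hη hη' hηα hηβ]
    apply intervalIntegral.integral_congr
    intro t ht
    rw [uIcc_of_le hαβ.le] at ht
    simp only [hPp t ht, hQq t ht]
  have h2 : ∫ t in α..β, (Q t * η t + (R t + c) * η' t) = 0 := by
    rw [intervalIntegral.integral_eq_sub_of_hasDerivAt (f := fun t => (R t + c) * η t)]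
    · simp [hηα, hηβ]
    · intro t _
      exact ((hR t).add_const c).mul (hη t)
    · exact ((hQ.mul hηc).add ((hRc.add continuous_const).mul hη')).intervalIntegrable _ _
  have h3 : ∫ t in α..β, η' t ^ 2 = 0 := by
    have hi1 : IntervalIntegrable (fun t => Q t * η t + P t * η' t) MeasureTheory.volume α β :=
      ((hQ.mul hηc).add (hP.mul hη')).intervalIntegrable _ _
    have hi2 : IntervalIntegrable (fun t => Q t * η t + (R t + c) * η' t)
        MeasureTheory.volume α β :=
      ((hQ.mul hηc).add ((hRc.add continuous_const).mul hη')).intervalIntegrable _ _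
    have := intervalIntegral.integral_sub hi1 hi2
    rw [h1, h2, sub_zero] at this
    rw [← this]
    congr 1
    ext t
    simp only [η']
    ring
  have h4 : ∀ t ∈ Icc α β, η' t = 0 := by
    by_contra! hne
    obtain ⟨t, ht, hne⟩ := hne
    have := intervalIntegral.integral_pos hαβ (hη'.pow 2).continuousOn
      (fun t _ => sq_nonneg _) ⟨t, ht, show 0 < η' t ^ 2 by positivity⟩
    simp only [Pi.pow_apply] at this
    linarith
  intro t ht
  have e1 := h4 t ht
  have e2 := h4 α (left_mem_Icc.2 hαβ.le)
  have e3 : R α = 0 := intervalIntegral.integral_same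
  have e4 : R t = ∫ s in α..t, q s := by
    apply intervalIntegral.integral_congr
    intro s hs
    rw [uIcc_of_le ht.1] at hs
    exact hQq s ⟨hs.1, hs.2.trans ht.2⟩
  simp only [η'] at e1 e2
  rw [← hPp t ht, ← hPp α (left_mem_Icc.2 hαβ.le), ← e4]
  linarith

/-- Solutions of smooth autonomous differential equations are smooth. -/
theorem contDiffOn_of_hasDerivWithinAt {Z : Type*} [NormedAddCommGroup Z] [NormedSpace ℝ Z]
    {z : ℝ → Z} {Y : Z → Z} {W : Set Z} {S : Set ℝ} (hS : UniqueDiffOn ℝ S)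
    (hY : ContDiffOn ℝ ∞ Y W) (hzW : MapsTo z S W)
    (hz : ∀ t ∈ S, HasDerivWithinAt z (Y (z t)) S t) : ContDiffOn ℝ ∞ z S := by
  rw [contDiffOn_infty]
  intro k
  induction k with
  | zero => exact contDiffOn_zero.2 fun t ht => (hz t ht).continuousWithinAt
  | succ k ih =>
    rw [Nat.cast_succ, contDiffOn_succ_iff_derivWithin hS]
    refine ⟨fun t ht => (hz t ht).differentiableWithinAt, fun h => by simp at h, ?_⟩
    refine ContDiffOn.congr ((hY.of_le (by exact_mod_cast le_top)).comp ih hzW) fun t ht => ?_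
    exact (hz t ht).derivWithin (hS t ht)

/-! ### Curves which minimize a distance with prescribed first-order expansion -/

lemma hasDerivWithinAt_integral_Icc {G : Type*} [NormedAddCommGroup G] [NormedSpace ℝ G]
    [CompleteSpace G] {g : ℝ → G} {α β : ℝ} (hg : ContinuousOn g (Icc α β)) {t : ℝ}
    (ht : t ∈ Icc α β) :
    HasDerivWithinAt (fun u => ∫ s in α..u, g s) (g t) (Icc α β) t := by
  have : Fact (t ∈ Icc α β) := ⟨ht⟩
  refine intervalIntegral.integral_hasDerivWithinAt_right ?_
    (hg.stronglyMeasurableAtFilter_nhdsWithin measurableSet_Icc t) (hg t ht)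
  apply ContinuousOn.intervalIntegrable
  rw [uIcc_of_le ht.1]
  exact hg.mono (Icc_subset_Icc_right ht.2)

open IsChartMetric

section VectorSpace

variable {E : Type*} [NormedAddCommGroup E] [NormedSpace ℝ E] {U : Set E} {f : E → E → ℝ}

namespace IsChartMetric

lemma continuousAt [FiniteDimensional ℝ E] (hf : IsChartMetric U f) {z : E × E} (hz : z.1 ∈ U) :
    ContinuousAt (fun z : E × E => f z.1 z.2) z := by
  by_cases h : z.2 = 0
  · obtain ⟨r, hr, hrU, A, hA⟩ := hf.exists_bounds hz
    have hlim : Tendsto (fun q : E × E => A * ‖q.2‖) (𝓝 z) (𝓝 0) := by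
      have : Continuous fun q : E × E => A * ‖q.2‖ := by fun_prop
      simpa [h] using this.tendsto z
    have h0 : f z.1 z.2 = 0 := by rw [h, (hf.minkowski _ hz).map_zero]
    have hB : ∀ᶠ q : E × E in 𝓝 z, q.1 ∈ Metric.closedBall z.1 r :=
      continuousAt_fst.eventually (Metric.closedBall_mem_nhds _ hr)
    show Tendsto _ _ (𝓝 (f z.1 z.2))
    rw [h0]
    refine squeeze_zero' ?_ ?_ hlim
    · filter_upwards [hB] with q hq
      exact hA.nonneg hq _
    · filter_upwards [hB] with q hq
      exact hA.le_norm _ hq _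
  · exact (hf.contDiffAt hz h).continuousAt

lemma continuousOn_comp [FiniteDimensional ℝ E] (hf : IsChartMetric U f) {X : Type*}
    [TopologicalSpace X] {S : Set X} {c v : X → E} (hc : ContinuousOn c S) (hv : ContinuousOn v S)
    (hcU : MapsTo c S U) : ContinuousOn (fun t => f (c t) (v t)) S := fun t ht =>
  (hf.continuousAt (z := (c t, v t)) (hcU ht)).comp_continuousWithinAt
    (f := fun t => (c t, v t)) ((hc t ht).prodMk (hv t ht))

lemma differentiableAt (hf : IsChartMetric U f) {z : E × E} (h1 : z.1 ∈ U) (h2 : z.2 ≠ 0) :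
    DifferentiableAt ℝ (fun z : E × E => f z.1 z.2) z :=
  (hf.contDiffAt h1 h2).differentiableAt (by simp)

lemma fderiv_apply (hf : IsChartMetric U f) {x y : E} (hx : x ∈ U) (hy : y ≠ 0) (a b : E) :
    fderiv ℝ (fun z : E × E => f z.1 z.2) (x, y) (a, b)
      = fderiv ℝ (fun x => f x y) x a + fderiv ℝ (f x) y b := by
  have h := (hf.differentiableAt (z := (x, y)) hx hy).hasFDerivAt
  have h1 : HasFDerivAt (fun x => f x y) _ x :=
    h.comp (f := fun x => (x, y)) x ((hasFDerivAt_id x).prodMk (hasFDerivAt_const y x))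
  have h2 : HasFDerivAt (f x) _ y :=
    h.comp (f := fun y => (x, y)) y ((hasFDerivAt_const x y).prodMk (hasFDerivAt_id y))
  rw [h1.fderiv, h2.fderiv]
  simp only [ContinuousLinearMap.comp_apply, ContinuousLinearMap.prod_apply, ← map_add]
  simp

/-- The Legendre transform `(x, y) ↦ D_y(f²)(x, y)` (up to the factor `½`). -/
def legendre (f : E → E → ℝ) (z : E × E) : E →L[ℝ] ℝ := fderiv ℝ (fun y => f z.1 y ^ 2) z.2

/-- The differential of `f²` in the base point, `(x, y) ↦ D_x(f²)(x, y)`. -/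
def baseDeriv (f : E → E → ℝ) (z : E × E) : E →L[ℝ] ℝ := fderiv ℝ (fun x => f x z.2 ^ 2) z.1

lemma contDiffAt_legendre (hf : IsChartMetric U f) {z : E × E} (h1 : z.1 ∈ U) (h2 : z.2 ≠ 0) :
    ContDiffAt ℝ ∞ (legendre f) z := hf.contDiffAt_fderiv_sq h1 h2

lemma contDiffAt_baseDeriv (hf : IsChartMetric U f) {z : E × E} (h1 : z.1 ∈ U) (h2 : z.2 ≠ 0) :
    ContDiffAt ℝ ∞ (baseDeriv f) z := by
  refine ContDiffAt.fderiv (f := fun (z : E × E) x => f x z.2 ^ 2) (g := fun z => z.1) (n := ∞) ?_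
    contDiffAt_fst (by simp)
  have h := hf.contDiffAt_sq (z := (z.1, z.2)) h1 h2
  exact ContDiffAt.comp (f := fun q : (E × E) × E => (q.2, q.1.2)) (z, z.1)
    (g := fun z : E × E => f z.1 z.2 ^ 2) h
    (contDiffAt_snd.prodMk (contDiffAt_snd.comp _ contDiffAt_fst))

lemma legendre_apply (hf : IsChartMetric U f) {z : E × E} (h1 : z.1 ∈ U) (h2 : z.2 ≠ 0) (e : E) :
    legendre f z e = 2 * f z.1 z.2 * fderiv ℝ (f z.1) z.2 e :=
  (hf.minkowski _ h1).fderiv_sq h2 e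

lemma baseDeriv_apply (hf : IsChartMetric U f) {z : E × E} (h1 : z.1 ∈ U) (h2 : z.2 ≠ 0) (e : E) :
    baseDeriv f z e = 2 * f z.1 z.2 * fderiv ℝ (fun x => f x z.2) z.1 e := by
  have h := (hf.differentiableAt_left h1 h2).hasFDerivAt.pow 2
  rw [baseDeriv, h.fderiv]
  simp

end IsChartMetric

/-- `D` is a quasi-metric on a set `B` of a vector space (on which the metric `f` has the uniform
bounds `A`) such that `D(x, y) = f(x, y - x) + O(‖y - x‖²)`. -/
structure HasExpansion (f : E → E → ℝ) (B : Set E) (A C : ℝ) (D : E → E → ℝ) : Prop where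
  bounds : Bounds f B A
  nonneg : 0 ≤ C
  triangle : ∀ x ∈ B, ∀ y ∈ B, ∀ z ∈ B, D x z ≤ D x y + D y z
  continuousOn : ∀ x ∈ B, ContinuousOn (D x) B
  norm_le : ∀ x ∈ B, ∀ y ∈ B, ‖y - x‖ ≤ C * D x y
  upper : ∀ x ∈ B, ∀ y ∈ B, D x y ≤ f x (y - x) + C * ‖y - x‖ ^ 2
  lower : ∀ x ∈ B, ∀ y ∈ B, f x (y - x) ≤ D x y + C * ‖y - x‖ ^ 2

namespace HasExpansion

variable {B : Set E} {A C : ℝ} {D : E → E → ℝ} {γ w : ℝ → E} {α β : ℝ}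

section Slopes

variable (hD : HasExpansion f B A C D) (hγB : MapsTo γ (Icc α β) B)
  (hγ : IsMinimizer D γ (Icc α β))
include hD hγB hγ

lemma norm_sub_le {s t : ℝ} (hs : s ∈ Icc α β) (ht : t ∈ Icc α β) (hst : s ≤ t) :
    ‖γ t - γ s‖ ≤ C * (t - s) := by
  rw [← hγ s hs t ht hst]
  exact hD.norm_le _ (hγB hs) _ (hγB ht)

lemma sq_norm_sub_le {s t : ℝ} (hs : s ∈ Icc α β) (ht : t ∈ Icc α β) (hst : s ≤ t) :
    C * ‖γ t - γ s‖ ^ 2 ≤ C ^ 3 * (t - s) * (t - s) := by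
  calc C * ‖γ t - γ s‖ ^ 2 ≤ C * (C * (t - s)) ^ 2 := by
        have := hD.nonneg
        have := hD.norm_sub_le hγB hγ hs ht hst
        gcongr
    _ = _ := by ring

lemma map_slope_le (hfB : ∀ x ∈ B, IsMinkowskiNorm (f x)) {s t : ℝ} (hs : s ∈ Icc α β)
    (ht : t ∈ Icc α β) (hst : s < t) :
    f (γ s) (slope γ s t) ≤ 1 + C ^ 3 * (t - s) := by
  have p : 0 < t - s := sub_pos.2 hst
  have h1 := hD.lower _ (hγB hs) _ (hγB ht)
  have h2 := hD.sq_norm_sub_le hγB hγ hs ht hst.le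
  rw [hγ s hs t ht hst.le] at h1
  rw [slope, vsub_eq_sub, (hfB _ (hγB hs)).homogeneous _ (by positivity), inv_mul_le_iff₀ p]
  linarith

lemma le_map_slope (hfB : ∀ x ∈ B, IsMinkowskiNorm (f x)) {s t : ℝ} (hs : s ∈ Icc α β)
    (ht : t ∈ Icc α β) (hst : s < t) :
    1 - C ^ 3 * (t - s) ≤ f (γ s) (slope γ s t) := by
  have p : 0 < t - s := sub_pos.2 hst
  have h1 := hD.upper _ (hγB hs) _ (hγB ht)
  have h2 := hD.sq_norm_sub_le hγB hγ hs ht hst.le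
  rw [hγ s hs t ht hst.le] at h1
  rw [slope, vsub_eq_sub, (hfB _ (hγB hs)).homogeneous _ (by positivity), le_inv_mul_iff₀ p]
  linarith

/-- Strong convexity forces the velocities of a minimizer over the two parts of a short interval to
be close to each other, since their weighted mean has almost the same length as both of them. All
lengths are measured at `γ s`: the error `C ^ 3` comes from the expansion of `D`, and `A * C ^ 2`
from the change of the base point. -/
lemma norm_slope_sub_slope_sq_le (hfB : ∀ x ∈ B, IsMinkowskiNorm (f x))
    (hsmall : (C ^ 3 + A * C ^ 2) * (β - α) < 1) {s m t : ℝ} (hs : α ≤ s) (hsm : s < m)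
    (hmt : m < t) (ht : t ≤ β) :
    (m - s) * (t - m) * ‖slope γ s m - slope γ m t‖ ^ 2
      ≤ (4 * A * (C ^ 3 + A * C ^ 2)) * (t - s) ^ 3 := by
  have hA := hD.bounds.pos
  have hC := hD.nonneg
  have hsI : s ∈ Icc α β := ⟨hs, (hsm.trans hmt).le.trans ht⟩
  have hmI : m ∈ Icc α β := ⟨hs.trans hsm.le, hmt.le.trans ht⟩
  have htI : t ∈ Icc α β := ⟨hs.trans (hsm.trans hmt).le, ht⟩
  have hm := hfB _ (hγB hsI)
  set K := C ^ 3 + A * C ^ 2 with hK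
  have hK0 : 0 ≤ K := by positivity
  set x := γ s
  set v₁ := slope γ s m
  set v₂ := slope γ m t
  set v := slope γ s t
  have p1 : 0 < m - s := sub_pos.2 hsm
  have p2 : 0 < t - m := sub_pos.2 hmt
  have p : 0 < t - s := by linarith
  have hKC : C ^ 3 ≤ K := by have : 0 ≤ A * C ^ 2 := by positivity
                             linarith
  have b1 : f x v₁ ≤ 1 + K * (t - s) := by
    refine (hD.map_slope_le hγB hγ hfB hsI hmI hsm).trans ?_
    gcongr
  have b2 : f x v₂ ≤ 1 + K * (t - s) := by
    have h1 := hD.bounds.lipschitz _ (hγB hsI) _ (hγB hmI) v₂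
    have h2 := hD.map_slope_le hγB hγ hfB hmI htI hmt
    have h3 : ‖x - γ m‖ ≤ C * (t - s) := by
      rw [norm_sub_rev]
      refine (hD.norm_sub_le hγB hγ hsI hmI hsm.le).trans ?_
      gcongr
    have h4 : ‖v₂‖ ≤ C := by
      rw [show v₂ = (t - m)⁻¹ • (γ t - γ m) from rfl, norm_smul, norm_inv, Real.norm_eq_abs,
        abs_of_pos p2, inv_mul_le_iff₀ p2]
      linarith [hD.norm_sub_le hγB hγ hmI htI hmt.le]
    have h5 : A * ‖x - γ m‖ * ‖v₂‖ ≤ A * (C * (t - s)) * C := by gcongr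
    have h6 : C ^ 3 * (t - m) ≤ C ^ 3 * (t - s) := by gcongr
    calc f x v₂ ≤ 1 + C ^ 3 * (t - s) + A * (C * (t - s)) * C := by linarith
      _ = _ := by rw [hK]; ring
  have b3 : 1 - K * (t - s) ≤ f x v := by
    refine le_trans ?_ (hD.le_map_slope hγB hγ hfB hsI htI (hsm.trans hmt))
    have : C ^ 3 * (t - s) ≤ K * (t - s) := by gcongr
    linarith
  have hKs : K * (t - s) < 1 := lt_of_le_of_lt (by gcongr) hsmall
  have hv : v ≠ 0 := by
    intro h0
    rw [h0, hm.map_zero] at b3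
    linarith
  set l := (m - s) / (t - s) with hl
  have hl0 : 0 < l := by positivity
  have hl' : 1 - l = (t - m) / (t - s) := by rw [hl]; field_simp; ring
  have hl1 : 0 < 1 - l := by rw [hl']; positivity
  have e1 : v₁ - v = (1 - l) • (v₁ - v₂) := by
    rw [← neg_sub v, slope_sub_slope_left hsm.ne (hsm.trans hmt).ne hmt.ne, ← smul_neg, neg_sub,
      hl']
  have e2 : v₂ - v = (-l) • (v₁ - v₂) := by
    rw [← neg_sub v, slope_sub_slope_right hsm.ne (hsm.trans hmt).ne hmt.ne, ← neg_smul]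
  -- in the mean of these inequalities with weights `l` and `1 - l` the linear terms cancel
  have c1 := hD.bounds.sq_add_le_sq (hγB hsI) hm hv v₁
  have c2 := hD.bounds.sq_add_le_sq (hγB hsI) hm hv v₂
  rw [e1, map_smul, norm_smul, mul_pow, Real.norm_eq_abs, sq_abs, smul_eq_mul] at c1
  rw [e2, map_smul, norm_smul, mul_pow, Real.norm_eq_abs, sq_abs, smul_eq_mul] at c2
  set N := ‖v₁ - v₂‖ ^ 2
  set T := fderiv ℝ (fun z => f x z ^ 2) v (v₁ - v₂)
  have q1 : f x v₁ ^ 2 ≤ (1 + K * (t - s)) ^ 2 :=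
    pow_le_pow_left₀ (hD.bounds.nonneg (hγB hsI) _) b1 2
  have q2 : f x v₂ ^ 2 ≤ (1 + K * (t - s)) ^ 2 :=
    pow_le_pow_left₀ (hD.bounds.nonneg (hγB hsI) _) b2 2
  have q3 : (1 - K * (t - s)) ^ 2 ≤ f x v ^ 2 := pow_le_pow_left₀ (by linarith) b3 2
  have key : A⁻¹ * (l * (1 - l)) * N ≤ 4 * K * (t - s) := by
    have d1 := mul_le_mul_of_nonneg_left (c1.trans q1) hl0.le
    have d2 := mul_le_mul_of_nonneg_left (c2.trans q2) hl1.le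
    have d3 : l * (f x v ^ 2 + (1 - l) * T + A⁻¹ * ((1 - l) ^ 2 * N)) +
        (1 - l) * (f x v ^ 2 + -l * T + A⁻¹ * ((-l) ^ 2 * N)) =
        f x v ^ 2 + A⁻¹ * (l * (1 - l)) * N := by ring
    have d4 : (1 + K * (t - s)) ^ 2 - (1 - K * (t - s)) ^ 2 = 4 * K * (t - s) := by ring
    linarith
  have e3 : (m - s) * (t - m) = l * (1 - l) * (t - s) ^ 2 := by
    rw [hl', hl]; field_simp
  rw [e3]
  have e4 : l * (1 - l) * N ≤ A * (4 * K * (t - s)) := by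
    rw [mul_assoc] at key
    rwa [inv_mul_le_iff₀ hA] at key
  calc l * (1 - l) * (t - s) ^ 2 * N = (l * (1 - l) * N) * (t - s) ^ 2 := by ring
    _ ≤ (A * (4 * K * (t - s))) * (t - s) ^ 2 := by gcongr
    _ = _ := by ring

/-- Minimizers on short intervals are continuously differentiable curves of unit speed. -/
lemma exists_velocity [FiniteDimensional ℝ E] (hf : IsChartMetric U f) (hBU : B ⊆ U)
    (hsmall : (C ^ 3 + A * C ^ 2) * (β - α) < 1) (hαβ : α < β) :
    ∃ w : ℝ → E, ContinuousOn w (Icc α β) ∧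
      (∀ t ∈ Icc α β, HasDerivWithinAt γ (w t) (Icc α β) t) ∧ ∀ t ∈ Icc α β, f (γ t) (w t) = 1 := by
  have hfB : ∀ x ∈ B, IsMinkowskiNorm (f x) := fun x hx => hf.minkowski x (hBU hx)
  have : CompleteSpace E := FiniteDimensional.complete ℝ E
  have hA := hD.bounds.pos
  have hC := hD.nonneg
  obtain ⟨w, hw, hγw⟩ := exists_continuousOn_hasDerivWithinAt
    (fun s m t h1 h2 h3 h4 => hD.norm_slope_sub_slope_sq_le hγB hγ hfB hsmall h1 h2 h3 h4)
    (by positivity) hαβ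
  refine ⟨w, hw, hγw, ?_⟩
  have hcont : ContinuousOn (fun t => f (γ t) (w t)) (Icc α β) :=
    hf.continuousOn_comp (fun t ht => (hγw t ht).continuousWithinAt) hw
      fun t ht => hBU (hγB ht)
  have hIco : ∀ t ∈ Ico α β, f (γ t) (w t) = 1 := by
    intro t ht
    have htI := Ico_subset_Icc_self ht
    have h1 : Tendsto (slope γ t) (𝓝[Ioc t β] t) (𝓝 (w t)) :=
      (hasDerivWithinAt_iff_tendsto_slope.1 (hγw t htI)).mono_left
        (nhdsWithin_mono _ fun u hu => ⟨⟨ht.1.trans hu.1.le, hu.2⟩, hu.1.ne'⟩)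
    have h2 : Tendsto (fun u => f (γ t) (slope γ t u)) (𝓝[Ioc t β] t) (𝓝 (f (γ t) (w t))) :=
      (ContinuousAt.comp (f := fun v => (γ t, v))
        (hf.continuousAt (z := (γ t, w t)) (hBU (hγB htI))) (by fun_prop)).tendsto.comp h1
    have hne : (𝓝[Ioc t β] t).NeBot := by
      rw [nhdsWithin_Ioc_eq_nhdsGT ht.2]
      infer_instance
    have hlim : ∀ c : ℝ, Tendsto (fun u => 1 + c * (u - t)) (𝓝[Ioc t β] t) (𝓝 1) := by
      intro c
      have : Continuous fun u => 1 + c * (u - t) := by fun_prop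
      have := this.tendsto t
      simp only [sub_self, mul_zero, add_zero] at this
      exact this.mono_left nhdsWithin_le_nhds
    apply le_antisymm
    · refine le_of_tendsto_of_tendsto h2 (hlim (C ^ 3)) ?_
      filter_upwards [self_mem_nhdsWithin] with u hu
      exact hD.map_slope_le hγB hγ hfB htI ⟨ht.1.trans hu.1.le, hu.2⟩ hu.1
    · refine le_of_tendsto_of_tendsto (hlim (-C ^ 3)) h2 ?_
      filter_upwards [self_mem_nhdsWithin] with u hu
      have := hD.le_map_slope hγB hγ hfB htI ⟨ht.1.trans hu.1.le, hu.2⟩ hu.1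
      linarith
  intro t ht
  rcases ht.2.lt_or_eq with h | rfl
  · exact hIco t ⟨ht.1, h⟩
  · have hne : (𝓝[Ico α t] t).NeBot := by
      rw [nhdsWithin_Ico_eq_nhdsLT hαβ]
      infer_instance
    refine tendsto_nhds_unique ((hcont t ht).mono_left (nhdsWithin_mono _ Ico_subset_Icc_self))
      (tendsto_const_nhds.congr' ?_)
    filter_upwards [self_mem_nhdsWithin] with u hu
    exact (hIco u hu).symm

end Slopes

/-- The distance between the endpoints of a continuously differentiable curve is at most its
length. -/
lemma le_integral [FiniteDimensional ℝ E] (hD : HasExpansion f B A C D) (hf : IsChartMetric U f)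
    (hBU : B ⊆ U) {c v : ℝ → E} (hαβ : α ≤ β) (hcB : MapsTo c (Icc α β) B)
    (hv : ContinuousOn v (Icc α β)) (hc : ∀ t ∈ Icc α β, HasDerivWithinAt c (v t) (Icc α β) t) :
    D (c α) (c β) ≤ ∫ t in α..β, f (c t) (v t) := by
  have hcc : ContinuousOn c (Icc α β) := fun t ht => (hc t ht).continuousWithinAt
  have hg : ContinuousOn (fun t => f (c t) (v t)) (Icc α β) :=
    hf.continuousOn_comp hcc hv fun t ht => hBU (hcB ht)
  have hα : α ∈ Icc α β := left_mem_Icc.2 hαβ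
  -- by the triangle inequality the slopes of `t ↦ D (c α) (c t)` are at most `f (c t) (v t) + o(1)`
  refine image_le_of_liminf_slope_right_le_deriv_boundary (f := fun t => D (c α) (c t))
    (B := fun t => ∫ s in α..t, f (c s) (v s)) (B' := fun t => f (c t) (v t))
    ((hD.continuousOn _ (hcB hα)).comp hcc hcB) ?_
    (fun t ht => (hasDerivWithinAt_integral_Icc hg ht).continuousWithinAt)
    (fun t ht => (hasDerivWithinAt_integral_Icc hg (Ico_subset_Icc_self ht)).mono_of_mem_nhdsWithin
      (Icc_mem_nhdsGE_of_mem ht)) ?_ (right_mem_Icc.2 hαβ)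
  · have := hD.upper _ (hcB hα) _ (hcB hα)
    simpa [(hf.minkowski _ (hBU (hcB hα))).map_zero] using this
  · intro t ht r hr
    have htI := Ico_subset_Icc_self ht
    have hm := hf.minkowski _ (hBU (hcB htI))
    have h1 : Tendsto (slope c t) (𝓝[>] t) (𝓝 (v t)) := by
      rw [← nhdsWithin_Ioc_eq_nhdsGT ht.2]
      exact (hasDerivWithinAt_iff_tendsto_slope.1 (hc t htI)).mono_left
        (nhdsWithin_mono _ fun u hu => ⟨⟨ht.1.trans hu.1.le, hu.2⟩, hu.1.ne'⟩)
    have h2 : Tendsto (fun u => f (c t) (slope c t u)) (𝓝[>] t) (𝓝 (f (c t) (v t))) :=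
      (ContinuousAt.comp (f := fun v => (c t, v))
        (hf.continuousAt (z := (c t, v t)) (hBU (hcB htI))) (by fun_prop)).tendsto.comp h1
    have h3 : Tendsto (fun u => u - t) (𝓝[>] t) (𝓝 0) := by
      have : Continuous fun u : ℝ => u - t := by fun_prop
      simpa using (this.tendsto t).mono_left nhdsWithin_le_nhds
    have h4 : Tendsto (fun u => f (c t) (slope c t u) + C * (u - t) * ‖slope c t u‖ ^ 2) (𝓝[>] t)
        (𝓝 (f (c t) (v t))) := by
      simpa using h2.add ((h3.const_mul C).mul (h1.norm.pow 2))
    refine Eventually.frequently ?_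
    filter_upwards [h4.eventually (gt_mem_nhds hr), Ioc_mem_nhdsGT ht.2] with u hu huI
    refine lt_of_le_of_lt ?_ hu
    have p : 0 < u - t := sub_pos.2 huI.1
    have huI' : u ∈ Icc α β := ⟨ht.1.trans huI.1.le, huI.2⟩
    have t1 := hD.triangle _ (hcB hα) _ (hcB htI) _ (hcB huI')
    have t2 := hD.upper _ (hcB htI) _ (hcB huI')
    rw [slope_def_field, div_le_iff₀ p]
    have e1 : c u - c t = (u - t) • slope c t u := by
      simp [slope, smul_smul, p.ne']
    rw [e1, hm.homogeneous _ p.le, norm_smul, Real.norm_eq_abs, abs_of_pos p] at t2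
    calc D (c α) (c u) - D (c α) (c t) ≤ (u - t) * f (c t) (slope c t u) +
          C * ((u - t) * ‖slope c t u‖) ^ 2 := by linarith
      _ = _ := by ring

end HasExpansion

/-! ### The Euler–Lagrange equation -/

namespace IsChartMetric

variable {γ w : ℝ → E} {α β : ℝ}

/-- The first variation of length. -/
lemma integral_fderiv_eq_zero (hf : IsChartMetric U f) (hαβ : α < β) {W : Set E} (hW : IsOpen W)
    (hWU : W ⊆ U) (hγ : ContinuousOn γ (Icc α β)) (hw : ContinuousOn w (Icc α β))
    (hγW : MapsTo γ (Icc α β) W) (hw0 : ∀ t ∈ Icc α β, w t ≠ 0)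
    (hmin : ∀ ψ ψ' : ℝ → E, (∀ t, HasDerivAt ψ (ψ' t) t) → Continuous ψ' → ψ α = 0 → ψ β = 0 →
      (∀ t ∈ Icc α β, γ t + ψ t ∈ W) →
      ∫ t in α..β, f (γ t) (w t) ≤ ∫ t in α..β, f (γ t + ψ t) (w t + ψ' t))
    {ψ ψ' : ℝ → E} (hψ : ∀ t, HasDerivAt ψ (ψ' t) t) (hψ' : Continuous ψ') (hα : ψ α = 0)
    (hβ : ψ β = 0) :
    ∫ t in α..β, fderiv ℝ (fun z : E × E => f z.1 z.2) (γ t, w t) (ψ t, ψ' t) = 0 := by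
  have hψc : Continuous ψ := continuous_iff_continuousAt.2 fun t => (hψ t).continuousAt
  set g : E × E → ℝ := fun z => f z.1 z.2
  set O : Set (E × E) := W ×ˢ {0}ᶜ
  have hO : IsOpen O := hW.prod isOpen_compl_singleton
  set c : ℝ × ℝ → E × E := fun q => (γ q.2 + q.1 • ψ q.2, w q.2 + q.1 • ψ' q.2)
  have hc : ContinuousOn c (univ ×ˢ Icc α β) := by
    have h1 : ContinuousOn (fun q : ℝ × ℝ => γ q.2) (univ ×ˢ Icc α β) :=
      hγ.comp continuousOn_snd fun q hq => hq.2
    have h2 : ContinuousOn (fun q : ℝ × ℝ => w q.2) (univ ×ˢ Icc α β) :=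
      hw.comp continuousOn_snd fun q hq => hq.2
    exact (h1.add (by fun_prop)).prodMk (h2.add (by fun_prop))
  -- the variation stays in the region where `f` is smooth, for small values of the parameter
  obtain ⟨δ, hδ, hδO⟩ : ∃ δ > 0, ∀ ε : ℝ, |ε| ≤ δ → ∀ t ∈ Icc α β, c (ε, t) ∈ O := by
    have h1 : ∀ᶠ ε in 𝓝 (0 : ℝ), ∀ t ∈ Icc α β, c (ε, t) ∈ O := by
      have h2 : ∀ t ∈ Icc α β, ∀ᶠ q : ℝ × ℝ in 𝓝 (0 : ℝ) ×ˢ 𝓝[Icc α β] t, c q ∈ O := by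
        intro t ht
        have h3 : ContinuousWithinAt c (univ ×ˢ Icc α β) (0, t) := hc (0, t) ⟨mem_univ _, ht⟩
        have h4 : c (0, t) ∈ O := by
          simp only [c, zero_smul, add_zero]
          exact ⟨hγW ht, hw0 t ht⟩
        have h5 := h3.eventually (hO.mem_nhds h4)
        rwa [nhdsWithin_prod_eq, nhdsWithin_univ] at h5
      have h6 : ∀ t ∈ Icc α β, ∃ u ∈ 𝓝[Icc α β] t, ∀ᶠ ε in 𝓝 (0 : ℝ), ∀ s ∈ u, c (ε, s) ∈ O := by
        intro t ht
        obtain ⟨a, ha, b, hb, hab⟩ := Filter.eventually_prod_iff.1 (h2 t ht)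
        exact ⟨{s | b s}, hb, ha.mono fun ε hε s hs => hab hε hs⟩
      refine isCompact_Icc.induction_on (p := fun S => ∀ᶠ ε in 𝓝 (0 : ℝ), ∀ t ∈ S, c (ε, t) ∈ O)
        (by simp) (fun S T hST hT => hT.mono fun ε h t ht => h t (hST ht))
        (fun S T hS hT => (hS.and hT).mono fun ε h t ht => ht.elim (h.1 t) (h.2 t)) h6
    obtain ⟨δ, hδ, h⟩ := Metric.eventually_nhds_iff.1 h1
    refine ⟨δ / 2, by positivity, fun ε hε => h ?_⟩
    rw [Real.dist_eq, sub_zero]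
    linarith
  have hgd : ∀ z ∈ O, HasFDerivAt g (fderiv ℝ g z) z := fun z hz =>
    (hf.differentiableAt (hWU hz.1) hz.2).hasFDerivAt
  have hgc : ContinuousOn g O := fun z hz => (hgd z hz).continuousAt.continuousWithinAt
  have hgc' : ContinuousOn (fderiv ℝ g) O := fun z hz =>
    ((hf.contDiffAt (hWU hz.1) hz.2).fderiv_right (m := 0)
      (by simp)).continuousAt.continuousWithinAt
  set F' : ℝ → ℝ → ℝ := fun ε t => fderiv ℝ g (c (ε, t)) (ψ t, ψ' t)
  have hF'c : ContinuousOn (fun q : ℝ × ℝ => F' q.1 q.2) (Icc (-δ) δ ×ˢ Icc α β) := by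
    refine ContinuousOn.clm_apply (hgc'.comp (hc.mono (prod_mono_left (subset_univ _))) ?_)
      (by fun_prop)
    exact fun q hq => hδO q.1 (abs_le.2 hq.1) q.2 hq.2
  obtain ⟨K, hK⟩ := (isCompact_Icc.prod isCompact_Icc).exists_bound_of_continuousOn hF'c
  have hI : uIoc α β ⊆ Icc α β := by
    rw [uIoc_of_le hαβ.le]
    exact Ioc_subset_Icc_self
  have hcε : ∀ ε, ContinuousOn (fun t => c (ε, t)) (Icc α β) := fun ε =>
    hc.comp (by fun_prop) fun t ht => ⟨mem_univ _, ht⟩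
  have hδn : Icc (-δ) δ ∈ 𝓝 (0 : ℝ) := Icc_mem_nhds (by linarith) hδ
  have hmeas : ∀ h : ℝ → ℝ, ContinuousOn h (Icc α β) →
      MeasureTheory.AEStronglyMeasurable h (MeasureTheory.volume.restrict (uIoc α β)) := fun h hh =>
    (hh.mono hI).aestronglyMeasurable measurableSet_uIoc
  have hgce : ∀ ε ∈ Icc (-δ) δ, ContinuousOn (fun t => g (c (ε, t))) (Icc α β) := fun ε hε =>
    hgc.comp (hcε ε) fun t ht => hδO ε (abs_le.2 hε) t ht
  have h0 : (0 : ℝ) ∈ Icc (-δ) δ := ⟨by linarith, hδ.le⟩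
  have hder := (intervalIntegral.hasDerivAt_integral_of_dominated_loc_of_deriv_le
    (μ := MeasureTheory.volume) (a := α) (b := β) (F := fun ε t => g (c (ε, t))) (F' := F')
    (x₀ := (0 : ℝ)) (bound := fun _ => K) hδn
    (by
      filter_upwards [hδn] with ε hε
      exact hmeas _ (hgce ε hε))
    (ContinuousOn.intervalIntegrable (by rw [uIcc_of_le hαβ.le]; exact hgce 0 h0))
    (hmeas _ (hF'c.comp (f := fun t => ((0 : ℝ), t)) (by fun_prop) fun t ht => ⟨h0, ht⟩))
    (Eventually.of_forall fun t ht ε hε => hK (ε, t) ⟨hε, hI ht⟩)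
    intervalIntegrable_const
    (Eventually.of_forall fun t ht ε hε => by
      have h1 := hgd _ (hδO ε (abs_le.2 hε) t (hI ht))
      have h2 : HasDerivAt (fun ε => c (ε, t)) (ψ t, ψ' t) ε := by
        have a1 := ((hasDerivAt_id ε).smul_const (ψ t)).const_add (γ t)
        have a2 := ((hasDerivAt_id ε).smul_const (ψ' t)).const_add (w t)
        simpa using a1.prodMk a2
      exact h1.comp_hasDerivAt ε h2)).2
  have hloc : IsLocalMin (fun ε => ∫ t in α..β, g (c (ε, t))) 0 := by
    filter_upwards [hδn] with ε hε
    have := hmin (fun t => ε • ψ t) (fun t => ε • ψ' t) (fun t => (hψ t).const_smul ε)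
      (by fun_prop) (by simp [hα]) (by simp [hβ])
      (fun t ht => (hδO ε (abs_le.2 hε) t ht).1)
    simpa [g, c] using this
  have := hloc.hasDerivAt_eq_zero hder
  simpa [F', c] using this

/-- The Euler–Lagrange equation for curves of unit speed which minimize length among their
continuously differentiable variations. -/
lemma hasDerivWithinAt_legendre [FiniteDimensional ℝ E] (hf : IsChartMetric U f) (hαβ : α < β)
    {W : Set E} (hW : IsOpen W)
    (hWU : W ⊆ U) (hγ : ContinuousOn γ (Icc α β)) (hw : ContinuousOn w (Icc α β))
    (hγW : MapsTo γ (Icc α β) W) (hfw : ∀ t ∈ Icc α β, f (γ t) (w t) = 1)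
    (hmin : ∀ ψ ψ' : ℝ → E, (∀ t, HasDerivAt ψ (ψ' t) t) → Continuous ψ' → ψ α = 0 → ψ β = 0 →
      (∀ t ∈ Icc α β, γ t + ψ t ∈ W) →
      ∫ t in α..β, f (γ t) (w t) ≤ ∫ t in α..β, f (γ t + ψ t) (w t + ψ' t)) :
    ∀ t ∈ Icc α β, HasDerivWithinAt (fun t => legendre f (γ t, w t)) (baseDeriv f (γ t, w t))
      (Icc α β) t := by
  have hγU : MapsTo γ (Icc α β) U := fun t ht => hWU (hγW ht)
  have hw0 : ∀ t ∈ Icc α β, w t ≠ 0 := by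
    intro t ht h
    have := hfw t ht
    rw [h, (hf.minkowski _ (hγU ht)).map_zero] at this
    norm_num at this
  have hP : ContinuousOn (fun t => legendre f (γ t, w t)) (Icc α β) := fun t ht =>
    (hf.contDiffAt_legendre (z := (γ t, w t)) (hγU ht) (hw0 t ht)).continuousAt
      |>.comp_continuousWithinAt (f := fun t => (γ t, w t)) ((hγ t ht).prodMk (hw t ht))
  have hQ : ContinuousOn (fun t => baseDeriv f (γ t, w t)) (Icc α β) := fun t ht =>
    (hf.contDiffAt_baseDeriv (z := (γ t, w t)) (hγU ht) (hw0 t ht)).continuousAt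
      |>.comp_continuousWithinAt (f := fun t => (γ t, w t)) ((hγ t ht).prodMk (hw t ht))
  have hvec : ∀ t ∈ Icc α β, legendre f (γ t, w t) = legendre f (γ α, w α)
      + ∫ s in α..t, baseDeriv f (γ s, w s) := by
    intro t ht
    ext e
    have hint : IntervalIntegrable (fun s => baseDeriv f (γ s, w s)) MeasureTheory.volume α t := by
      apply ContinuousOn.intervalIntegrable
      rw [uIcc_of_le ht.1]
      exact hQ.mono (Icc_subset_Icc_right ht.2)
    rw [add_apply, ContinuousLinearMap.intervalIntegral_apply hint]
    refine eq_add_integral_of_forall_integral_eq_zero hαβ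
      (p := fun t => legendre f (γ t, w t) e) (q := fun t => baseDeriv f (γ t, w t) e)
      (hP.clm_apply continuousOn_const) (hQ.clm_apply continuousOn_const) ?_ t ht
    intro η η' hη hη' h1 h2
    have h := hf.integral_fderiv_eq_zero hαβ hW hWU hγ hw hγW hw0 hmin
      (ψ := fun t => η t • e) (ψ' := fun t => η' t • e) (fun t => (hη t).smul_const e)
      (by fun_prop) (by simp [h1]) (by simp [h2])
    -- `D(f²) = 2 D f` along the curve, because it has unit speed
    have h3 : (∫ t in α..β, (2 : ℝ) *
        fderiv ℝ (fun z : E × E => f z.1 z.2) (γ t, w t) (η t • e, η' t • e)) = 0 := by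
      rw [intervalIntegral.integral_const_mul, h, mul_zero]
    rw [← h3]
    apply intervalIntegral.integral_congr
    intro s hs
    rw [uIcc_of_le hαβ.le] at hs
    simp only
    rw [hf.fderiv_apply (hγU hs) (hw0 s hs), hf.legendre_apply (hγU hs) (hw0 s hs),
      hf.baseDeriv_apply (hγU hs) (hw0 s hs), hfw s hs, map_smul, map_smul, smul_eq_mul,
      smul_eq_mul]
    ring
  intro t ht
  refine HasDerivWithinAt.congr ?_ hvec (hvec t ht)
  exact (hasDerivWithinAt_integral_Icc hQ ht).const_add _

/-! ### Smoothness of solutions of the Euler–Lagrange equation -/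

/-- The Legendre transform as a map of pairs, `(x, y) ↦ (x, D_y(f²)(x, y))`. -/
def legendreMap (f : E → E → ℝ) (z : E × E) : E × (E →L[ℝ] ℝ) := (z.1, legendre f z)

lemma contDiffAt_legendreMap (hf : IsChartMetric U f) {z : E × E} (h1 : z.1 ∈ U) (h2 : z.2 ≠ 0) :
    ContDiffAt ℝ ∞ (legendreMap f) z :=
  contDiffAt_fst.prodMk (hf.contDiffAt_legendre h1 h2)

lemma fderiv_legendre_apply_snd (hf : IsChartMetric U f) {z : E × E} (h1 : z.1 ∈ U) (h2 : z.2 ≠ 0)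
    (b : E) :
    fderiv ℝ (legendre f) z (0, b) = fderiv ℝ (fderiv ℝ (fun y => f z.1 y ^ 2)) z.2 b := by
  have h : HasFDerivAt (legendre f) (fderiv ℝ (legendre f) z) (z.1, z.2) :=
    ((hf.contDiffAt_legendre h1 h2).differentiableAt (by simp)).hasFDerivAt
  have h3 : HasFDerivAt (fderiv ℝ (fun y => f z.1 y ^ 2)) _ z.2 :=
    h.comp (f := fun y => (z.1, y)) z.2 ((hasFDerivAt_const z.1 z.2).prodMk (hasFDerivAt_id z.2))
  rw [h3.fderiv]
  simp

lemma exists_equiv_hasFDerivAt_legendreMap [FiniteDimensional ℝ E] (hf : IsChartMetric U f)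
    {z : E × E} (h1 : z.1 ∈ U) (h2 : z.2 ≠ 0) :
    ∃ Λ : (E × E) ≃L[ℝ] E × (E →L[ℝ] ℝ),
      HasFDerivAt (legendreMap f) (Λ : E × E →L[ℝ] E × (E →L[ℝ] ℝ)) z := by
  have hL : HasFDerivAt (legendre f) (fderiv ℝ (legendre f) z) z :=
    ((hf.contDiffAt_legendre h1 h2).differentiableAt (by simp)).hasFDerivAt
  set T : E × E →L[ℝ] E × (E →L[ℝ] ℝ) :=
    (ContinuousLinearMap.fst ℝ E E).prod (fderiv ℝ (legendre f) z)
  have hT : HasFDerivAt (legendreMap f) T z := hasFDerivAt_fst.prodMk hL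
  have hinj : Function.Injective (T : E × E →ₗ[ℝ] E × (E →L[ℝ] ℝ)) := by
    rw [← LinearMap.ker_eq_bot, LinearMap.ker_eq_bot']
    rintro ⟨a, b⟩ hab
    have ha : a = 0 := congrArg Prod.fst hab
    subst ha
    have hb : fderiv ℝ (legendre f) z (0, b) = 0 := congrArg Prod.snd hab
    rw [hf.fderiv_legendre_apply_snd h1 h2] at hb
    by_contra hne
    have hb0 : b ≠ 0 := fun h => hne (by rw [h]; rfl)
    have := (hf.minkowski _ h1).stronglyConvex z.2 h2 b hb0
    simp [fundamentalForm, hb] at this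
  have hfin : Module.finrank ℝ (E × E) = Module.finrank ℝ (E × (E →L[ℝ] ℝ)) := by
    rw [Module.finrank_prod, Module.finrank_prod]
    congr 1
    rw [← (LinearMap.toContinuousLinearMap (𝕜 := ℝ) (E := E) (F' := ℝ)).finrank_eq]
    exact (Subspace.dual_finrank_eq (K := ℝ) (V := E)).symm
  have hsurj := (LinearMap.injective_iff_surjective_of_finrank_eq_finrank hfin).1 hinj
  refine ⟨(LinearEquiv.ofBijective (T : E × E →ₗ[ℝ] E × (E →L[ℝ] ℝ))
    ⟨hinj, hsurj⟩).toContinuousLinearEquiv, ?_⟩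
  convert hT
  exact ContinuousLinearMap.ext fun _ => rfl

/-- In the variables `(γ, D_y(f²)(γ, γ'))` the Euler–Lagrange equation is a smooth first-order
system, because the Legendre transform is a local diffeomorphism. Hence its solutions are smooth. -/
lemma contDiffOn_of_legendre [FiniteDimensional ℝ E] (hf : IsChartMetric U f) {S : Set ℝ}
    (hS : UniqueDiffOn ℝ S) (hw : ContinuousOn w S) (hγU : MapsTo γ S U) (hw0 : ∀ t ∈ S, w t ≠ 0)
    (hγ : ∀ t ∈ S, HasDerivWithinAt γ (w t) S t)
    (hP : ∀ t ∈ S, HasDerivWithinAt (fun t => legendre f (γ t, w t)) (baseDeriv f (γ t, w t)) S t) :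
    ContDiffOn ℝ ∞ (fun t => (γ t, w t)) S := by
  have : CompleteSpace E := FiniteDimensional.complete ℝ E
  intro t₀ ht₀
  obtain ⟨Λ, hΛ⟩ :=
    hf.exists_equiv_hasFDerivAt_legendreMap (z := (γ t₀, w t₀)) (hγU ht₀) (hw0 t₀ ht₀)
  set R := (hf.contDiffAt_legendreMap (z := (γ t₀, w t₀)) (hγU ht₀)
    (hw0 t₀ ht₀)).toOpenPartialHomeomorph (legendreMap f) hΛ (by simp)
  have hRf : ∀ z, R z = legendreMap f z := fun z => rfl
  have hmem : (γ t₀, w t₀) ∈ R.source :=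
    (hf.contDiffAt_legendreMap (z := (γ t₀, w t₀)) (hγU ht₀)
      (hw0 t₀ ht₀)).mem_toOpenPartialHomeomorph_source hΛ (by simp)
  have hc : ContinuousOn (fun t => (γ t, w t)) S := fun t ht =>
    (hγ t ht).continuousWithinAt.prodMk (hw t ht)
  obtain ⟨V, hV, ht₀V, hVS⟩ : ∃ V, IsOpen V ∧ t₀ ∈ V ∧ ∀ t ∈ S ∩ V, (γ t, w t) ∈ R.source := by
    obtain ⟨V, hV, h1, h2⟩ := mem_nhdsWithin.1 ((hc t₀ ht₀).preimage_mem_nhdsWithin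
      (R.open_source.mem_nhds hmem))
    exact ⟨V, hV, h1, fun t ht => h2 ⟨ht.2, ht.1⟩⟩
  set O : Set (E × E) := U ×ˢ {0}ᶜ
  have hO : IsOpen O := hf.isOpen.prod isOpen_compl_singleton
  set W : Set (E × (E →L[ℝ] ℝ)) := R.target ∩ R.symm ⁻¹' O
  have hR : ContDiffOn ℝ ∞ R.symm W := by
    rintro z ⟨hz1, hz2⟩
    obtain ⟨Λ', hΛ'⟩ := hf.exists_equiv_hasFDerivAt_legendreMap hz2.1 hz2.2
    exact (R.contDiffAt_symm hz1 hΛ' (hf.contDiffAt_legendreMap hz2.1 hz2.2)).contDiffWithinAt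
  set Y : E × (E →L[ℝ] ℝ) → E × (E →L[ℝ] ℝ) := fun z => ((R.symm z).2, baseDeriv f (R.symm z))
  have hY : ContDiffOn ℝ ∞ Y W := by
    refine (contDiff_snd.comp_contDiffOn hR).prodMk fun z hz => ?_
    exact (hf.contDiffAt_baseDeriv hz.2.1 hz.2.2).comp_contDiffWithinAt z (hR z hz)
  have hSV : UniqueDiffOn ℝ (S ∩ V) := hS.inter hV
  have hinv : ∀ t ∈ S ∩ V, R.symm (legendreMap f (γ t, w t)) = (γ t, w t) := fun t ht =>
    R.left_inv (hVS t ht)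
  have hzW : MapsTo (fun t => legendreMap f (γ t, w t)) (S ∩ V) W := by
    intro t ht
    refine ⟨R.map_source (hVS t ht), ?_⟩
    show R.symm (legendreMap f (γ t, w t)) ∈ O
    rw [hinv t ht]
    exact ⟨hγU ht.1, hw0 t ht.1⟩
  have hz : ContDiffOn ℝ ∞ (fun t => legendreMap f (γ t, w t)) (S ∩ V) := by
    refine contDiffOn_of_hasDerivWithinAt hSV hY hzW fun t ht => ?_
    have h1 : HasDerivWithinAt (fun t => legendreMap f (γ t, w t))
        (w t, baseDeriv f (γ t, w t)) (S ∩ V) t :=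
      ((hγ t ht.1).prodMk (hP t ht.1)).mono inter_subset_left
    simp only [Y, hinv t ht]
    exact h1
  have hfinal : ContDiffOn ℝ ∞ (fun t => (γ t, w t)) (S ∩ V) :=
    (hR.comp hz hzW).congr fun t ht => (hinv t ht).symm
  exact (hfinal t₀ ⟨ht₀, ht₀V⟩).mono_of_mem_nhdsWithin
    (inter_mem_nhdsWithin S (hV.mem_nhds ht₀V))

end IsChartMetric

/-- Minimizers of a quasi-metric which is infinitesimally given by `f` are smooth solutions of the
Euler–Lagrange equation. -/
theorem HasExpansion.exists_contDiffOn_of_isMinimizer [FiniteDimensional ℝ E] {B W : Set E}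
    {A C : ℝ} {D : E → E → ℝ} {γ : ℝ → E} {α β : ℝ} (hD : HasExpansion f B A C D)
    (hf : IsChartMetric U f) (hBU : B ⊆ U) (hW : IsOpen W) (hWB : W ⊆ B) (hαβ : α < β)
    (hsmall : (C ^ 3 + A * C ^ 2) * (β - α) < 1) (hγW : MapsTo γ (Icc α β) W)
    (hγ : IsMinimizer D γ (Icc α β)) :
    ∃ w : ℝ → E, ContDiffOn ℝ ∞ (fun t => (γ t, w t)) (Icc α β) ∧
      (∀ t ∈ Icc α β, HasDerivWithinAt γ (w t) (Icc α β) t) ∧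
      (∀ t ∈ Icc α β, f (γ t) (w t) = 1) ∧
      ∀ t ∈ Icc α β, HasDerivWithinAt (fun t => legendre f (γ t, w t)) (baseDeriv f (γ t, w t))
        (Icc α β) t := by
  have hγB : MapsTo γ (Icc α β) B := fun t ht => hWB (hγW ht)
  obtain ⟨w, hw, hγw, hfw⟩ := hD.exists_velocity hγB hγ hf hBU hsmall hαβ
  have hγc : ContinuousOn γ (Icc α β) := fun t ht => (hγw t ht).continuousWithinAt
  have hP := hf.hasDerivWithinAt_legendre hαβ hW (hWB.trans hBU) hγc hw hγW hfw (by
    intro ψ ψ' hψ hψ' h1 h2 hW'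
    have h3 := hD.le_integral hf hBU (c := fun t => γ t + ψ t) (v := fun t => w t + ψ' t) hαβ.le
      (fun t ht => hWB (hW' t ht)) (hw.add hψ'.continuousOn)
      (fun t ht => (hγw t ht).add (hψ t).hasDerivWithinAt)
    simp only [h1, h2, add_zero] at h3
    rw [hγ α (left_mem_Icc.2 hαβ.le) β (right_mem_Icc.2 hαβ.le) hαβ.le] at h3
    refine le_trans (le_of_eq ?_) h3
    rw [intervalIntegral.integral_congr (g := fun _ => (1 : ℝ))]
    · simp
    · intro t ht
      rw [uIcc_of_le hαβ.le] at ht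
      exact hfw t ht)
  refine ⟨w, ?_, hγw, hfw, hP⟩
  refine hf.contDiffOn_of_legendre (uniqueDiffOn_Icc hαβ) hw (fun t ht => hBU (hγB ht)) ?_ hγw hP
  intro t ht h
  have := hfw t ht
  rw [h, (hf.minkowski _ (hBU (hγB ht))).map_zero] at this
  norm_num at this

end VectorSpace

/-! ### The geodesic equation -/

namespace IsChartMetric

variable {n : ℕ} {U : Set (EuclideanSpace ℝ (Fin n))}
  {f : EuclideanSpace ℝ (Fin n) → EuclideanSpace ℝ (Fin n) → ℝ}

lemma metricMatrix_mulVec {x y : EuclideanSpace ℝ (Fin n)} (hm : IsMinkowskiNorm (f x))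
    (hy : y ≠ 0) (a : EuclideanSpace ℝ (Fin n)) (l : Fin n) :
    (metricMatrix f x y).mulVec a l = fundamentalForm (f x) y a (EuclideanSpace.single l 1) := by
  have hsymm : IsSymmSndFDerivAt ℝ (fun z => f x z ^ 2) y :=
    (hm.contDiffAt_sq hy).isSymmSndFDerivAt (by
      rw [minSmoothness_of_isRCLikeNormedField]
      exact WithTop.coe_le_coe.2 (le_top (a := (2 : ℕ∞))))
  have ha : a = ∑ i, a i • EuclideanSpace.single i (1 : ℝ) := by
    ext j
    simp [Finset.sum_apply, Pi.single_apply]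
  conv_rhs => rw [ha]
  simp only [Matrix.mulVec, dotProduct, metricMatrix, Matrix.of_apply, fundamentalForm, map_sum,
    map_smul, sum_apply, smul_apply, smul_eq_mul, Finset.mul_sum]
  refine Finset.sum_congr rfl fun i _ => ?_
  rw [hsymm.eq]
  ring

lemma isUnit_metricMatrix {x y : EuclideanSpace ℝ (Fin n)} (hm : IsMinkowskiNorm (f x))
    (hy : y ≠ 0) : IsUnit (metricMatrix f x y) := by
  rw [← Matrix.mulVec_injective_iff_isUnit]
  refine (injective_iff_map_eq_zero (metricMatrix f x y).mulVecLin).2 fun a ha => ?_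
  by_contra hne
  set b : EuclideanSpace ℝ (Fin n) := WithLp.toLp 2 a
  have hb : b ≠ 0 := fun h => hne (by simpa [b] using h)
  have hpos := hm.stronglyConvex y hy b hb
  have hz : ∀ l, fundamentalForm (f x) y b (EuclideanSpace.single l 1) = 0 := fun l => by
    rw [← metricMatrix_mulVec hm hy]
    exact congrFun ha l
  have hb' : b = ∑ i, b i • EuclideanSpace.single i (1 : ℝ) := by
    ext j
    simp [Finset.sum_apply, Pi.single_apply]
  have h0 : fundamentalForm (f x) y b b = ∑ i, b i *
      fundamentalForm (f x) y b (EuclideanSpace.single i 1) := by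
    conv_lhs => rw [show fundamentalForm (f x) y b b = fundamentalForm (f x) y b
      (∑ i, b i • EuclideanSpace.single i (1 : ℝ)) by rw [← hb']]
    simp only [fundamentalForm, map_sum, map_smul, smul_eq_mul, Finset.mul_sum]
    exact Finset.sum_congr rfl fun i _ => by ring
  rw [h0] at hpos
  simp [hz] at hpos

/-- The Euler–Lagrange equation, solved for the second derivative by means of the inverse of
`g_ij`, is the geodesic equation. -/
lemma add_two_mul_sprayCoeff_eq_zero (hf : IsChartMetric U f)
    {γ w : ℝ → EuclideanSpace ℝ (Fin n)} {S : Set ℝ} {t : ℝ} {a : EuclideanSpace ℝ (Fin n)}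
    (hS : UniqueDiffWithinAt ℝ S t) (hU : γ t ∈ U) (hw0 : w t ≠ 0)
    (hγ : HasDerivWithinAt γ (w t) S t) (hw : HasDerivWithinAt w a S t)
    (hP : HasDerivWithinAt (fun t => legendre f (γ t, w t)) (baseDeriv f (γ t, w t)) S t)
    (i : Fin n) : a i + 2 * sprayCoeff f (γ t) (w t) i = 0 := by
  set x := γ t
  set y := w t
  have hm := hf.minkowski x hU
  have hL : HasFDerivAt (legendre f) (fderiv ℝ (legendre f) (x, y)) (x, y) :=
    ((hf.contDiffAt_legendre (z := (x, y)) hU hw0).differentiableAt (by simp)).hasFDerivAt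
  have h0 : HasDerivWithinAt (fun t => legendre f (γ t, w t))
      (fderiv ℝ (legendre f) (x, y) (y, a)) S t :=
    HasFDerivAt.comp_hasDerivWithinAt (l := legendre f) (f := fun t => (γ t, w t)) t hL
      (hγ.prodMk hw)
  have h1 : fderiv ℝ (legendre f) (x, y) (y, a) = baseDeriv f (x, y) := hS.eq_deriv _ h0 hP
  have h2 : ∀ e, fderiv ℝ (fun x' => fderiv ℝ (fun y' => f x' y' ^ 2) y e) x y
      = fderiv ℝ (legendre f) (x, y) (y, 0) e := by
    intro e
    have h : HasFDerivAt (fun x' => legendre f (x', y)) _ x :=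
      hL.comp (f := fun x => (x, y)) x ((hasFDerivAt_id x).prodMk (hasFDerivAt_const y x))
    have h' : HasFDerivAt (fun x' => fderiv ℝ (fun y' => f x' y' ^ 2) y e) _ x :=
      h.clm_apply (hasFDerivAt_const e x)
    rw [h'.fderiv]
    simp
  have h3 : ∀ l, 2 * (metricMatrix f x y).mulVec a l =
      fderiv ℝ (fun x' => f x' y ^ 2) x (EuclideanSpace.single l 1) -
      fderiv ℝ (fun x' => fderiv ℝ (fun y' => f x' y' ^ 2) y (EuclideanSpace.single l 1)) x y := by
    intro l
    rw [h2, metricMatrix_mulVec hm hw0]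
    have h4 : fderiv ℝ (legendre f) (x, y) (y, a) = fderiv ℝ (legendre f) (x, y) (y, 0) +
        fderiv ℝ (legendre f) (x, y) (0, a) := by
      rw [← map_add]; simp
    rw [h4, hf.fderiv_legendre_apply_snd (z := (x, y)) hU hw0] at h1
    have h5 := congrArg (fun T => T (EuclideanSpace.single l 1)) h1
    simp only [add_apply] at h5
    have h6 : fderiv ℝ (fun x' => f x' y ^ 2) x = baseDeriv f (x, y) := rfl
    rw [h6, ← h5]
    simp only [fundamentalForm]
    ring
  have hdet : IsUnit (metricMatrix f x y).det :=
    (Matrix.isUnit_iff_isUnit_det _).1 (isUnit_metricMatrix hm hw0)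
  have h7 : a i = ((metricMatrix f x y)⁻¹.mulVec ((metricMatrix f x y).mulVec a)) i := by
    rw [Matrix.mulVec_mulVec, Matrix.nonsing_inv_mul _ hdet, Matrix.one_mulVec]
  rw [h7, sprayCoeff, Matrix.mulVec, dotProduct, ← mul_assoc, Finset.mul_sum,
    ← Finset.sum_add_distrib]
  refine Finset.sum_eq_zero fun l _ => ?_
  have := h3 l
  linear_combination (1 / 2) * (metricMatrix f x y)⁻¹ i l * this

end IsChartMetric

/-! ### Finsler metrics in charts -/

lemma IsMinkowskiNorm.comp_equiv {V V' : Type*} [NormedAddCommGroup V] [NormedSpace ℝ V]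
    [NormedAddCommGroup V'] [NormedSpace ℝ V'] {f : V' → ℝ} (hf : IsMinkowskiNorm f)
    (T : V ≃L[ℝ] V') : IsMinkowskiNorm (fun v => f (T v)) where
  nonneg v := hf.nonneg _
  smooth := hf.smooth.comp T.contDiff.contDiffOn fun v hv => by simpa using hv
  homogeneous t ht v := by rw [map_smul, hf.homogeneous t ht]
  stronglyConvex v hv w hw := by
    have h0 : T v ≠ 0 := by simpa using hv
    have h1 := hf.stronglyConvex (T v) h0 (T w) (by simpa using hw)
    have e : ∀ v, v ≠ 0 → fderiv ℝ (fun z => f (T z) ^ 2) v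
        = (fderiv ℝ (fun z => f z ^ 2) (T v)).comp (T : V →L[ℝ] V') := fun v hv =>
      ((hf.hasFDerivAt_sq (by simpa using hv)).comp v T.hasFDerivAt).fderiv
    have e2 : HasFDerivAt (fun v => (fderiv ℝ (fun z => f z ^ 2) (T v)).comp (T : V →L[ℝ] V'))
        ((ContinuousLinearMap.precomp ℝ (T : V →L[ℝ] V')).comp
          ((fderiv ℝ (fderiv ℝ (fun z => f z ^ 2)) (T v)).comp (T : V →L[ℝ] V'))) v := by
      have e4 : HasFDerivAt (fun v => fderiv ℝ (fun z => f z ^ 2) (T v))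
          ((fderiv ℝ (fderiv ℝ (fun z => f z ^ 2)) (T v)).comp (T : V →L[ℝ] V')) v :=
        (hf.hasFDerivAt_fderiv_sq h0).comp v T.hasFDerivAt
      exact ((ContinuousLinearMap.precomp ℝ (T : V →L[ℝ] V')).hasFDerivAt
        (x := fderiv ℝ (fun z => f z ^ 2) (T v))).comp v e4
    have e3 := (e2.congr_of_eventuallyEq (f₁ := fderiv ℝ (fun z => f (T z) ^ 2)) (by
      filter_upwards [isOpen_ne.mem_nhds hv] with z hz
      exact e z hz)).fderiv
    unfold fundamentalForm at h1 ⊢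
    rw [e3]
    exact h1

/-- The identification of `G × G` with the tangent bundle of a vector space `G` is smooth. -/
lemma contMDiff_toTangentBundle (G : Type*) [NormedAddCommGroup G] [NormedSpace ℝ G] :
    ContMDiff 𝓘(ℝ, G × G) 𝓘(ℝ, G).tangent ∞
      (fun z : G × G => (⟨z.1, z.2⟩ : TangentBundle 𝓘(ℝ, G) G)) := by
  have h := contMDiff_tangentBundleModelSpaceHomeomorph_symm (I := 𝓘(ℝ, G)) (n := ∞)
  have e : 𝓘(ℝ, G).tangent = 𝓘(ℝ, G × G) := by
    simp [ModelWithCorners.tangent, modelWithCornersSelf_prod]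
  rw [← e]
  exact h

variable {n : ℕ} {M : Type*} [TopologicalSpace M] [ChartedSpace (EuclideanSpace ℝ (Fin n)) M]
  [IsManifold (𝓡 n) ∞ M] {F : TangentBundle (𝓡 n) M → ℝ}
  {φ : OpenPartialHomeomorph M (EuclideanSpace ℝ (Fin n))}

omit [IsManifold (𝓡 n) ∞ M] in
lemma mdifferentiable_of_mem_maximalAtlas (hφ : φ ∈ IsManifold.maximalAtlas (𝓡 n) ∞ M) :
    φ.MDifferentiable (𝓡 n) (𝓡 n) :=
  ⟨(contMDiffOn_of_mem_maximalAtlas hφ).mdifferentiableOn (by simp),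
    (contMDiffOn_symm_of_mem_maximalAtlas hφ).mdifferentiableOn (by simp)⟩

theorem IsFinslerMetric.isChartMetric_inChart (hF : IsFinslerMetric F)
    (hφ : φ ∈ IsManifold.maximalAtlas (𝓡 n) ∞ M) : IsChartMetric φ.target (inChart F φ) where
  isOpen := φ.open_target
  smooth := by
    rw [← contMDiffOn_iff_contDiffOn]
    have h1 := (contMDiffOn_symm_of_mem_maximalAtlas hφ).contMDiffOn_tangentMapWithin (m := ∞)
      (by simp) φ.open_target.uniqueMDiffOn
    have h2 := h1.comp (contMDiff_toTangentBundle (EuclideanSpace ℝ (Fin n))).contMDiffOn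
      (s := φ.target ×ˢ {0}ᶜ) fun z hz => hz.1
    refine (hF.smooth.comp h2 fun z hz => ?_).congr fun z hz => ?_
    · have hinj := (mdifferentiable_of_mem_maximalAtlas hφ).symm.mfderiv_injective hz.1
      show mfderivWithin (𝓡 n) (𝓡 n) φ.symm φ.target z.1 z.2 ≠ 0
      rw [mfderivWithin_of_isOpen φ.open_target hz.1]
      exact fun h0 => hz.2 (hinj (h0.trans (map_zero _).symm))
    · simp only [inChart, Function.comp_apply, tangentMapWithin]
      rw [mfderivWithin_of_isOpen φ.open_target hz.1]
  minkowski x hx := by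
    let T : EuclideanSpace ℝ (Fin n) ≃L[ℝ] EuclideanSpace ℝ (Fin n) :=
      (mdifferentiable_of_mem_maximalAtlas hφ).symm.mfderiv hx
    exact (hF.minkowski (φ.symm x)).comp_equiv T

omit [IsManifold (𝓡 n) ∞ M] in
lemma inChart_apply_mfderiv (hφ : φ ∈ IsManifold.maximalAtlas (𝓡 n) ∞ M) {x : M}
    (hx : x ∈ φ.source) (v : TangentSpace (𝓡 n) x) :
    inChart F φ (φ x) (mfderiv (𝓡 n) (𝓡 n) φ x v) = F ⟨x, v⟩ := by
  have h := (mdifferentiable_of_mem_maximalAtlas hφ).symm_comp_deriv hx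
  have h' : mfderiv (𝓡 n) (𝓡 n) φ.symm (φ x) (mfderiv (𝓡 n) (𝓡 n) φ x v) = v :=
    congrArg (fun T => T v) h
  have key : ∀ y : M, y = x → F ⟨y, (v : EuclideanSpace ℝ (Fin n))⟩ = F ⟨x, v⟩ := by
    rintro y rfl
    rfl
  unfold inChart
  refine Eq.trans ?_ (key _ (φ.left_inv hx))
  congr 2

omit [IsManifold (𝓡 n) ∞ M] in
/-- The velocity of a curve in the chart `φ`. -/
lemma hasDerivAt_comp_chart (hφ : φ ∈ IsManifold.maximalAtlas (𝓡 n) ∞ M) {c : ℝ → M} {t : ℝ}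
    (hc : MDifferentiableAt 𝓘(ℝ, ℝ) (𝓡 n) c t) (ht : c t ∈ φ.source) :
    HasDerivAt (φ ∘ c) (mfderiv (𝓡 n) (𝓡 n) φ (c t) (mfderiv 𝓘(ℝ, ℝ) (𝓡 n) c t (1 : ℝ))) t := by
  have h1 := ((mdifferentiable_of_mem_maximalAtlas hφ).mdifferentiableAt ht).hasMFDerivAt
  let T : ℝ →L[ℝ] EuclideanSpace ℝ (Fin n) :=
    (mfderiv (𝓡 n) (𝓡 n) φ (c t)).comp (mfderiv 𝓘(ℝ, ℝ) (𝓡 n) c t)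
  have h2 : HasFDerivAt (φ ∘ c) T t := (h1.comp t hc.hasMFDerivAt).hasFDerivAt
  exact h2.hasDerivAt

omit [IsManifold (𝓡 n) ∞ M] in
lemma apply_mfderiv_eq_inChart (hφ : φ ∈ IsManifold.maximalAtlas (𝓡 n) ∞ M) {c : ℝ → M} {t : ℝ}
    (hc : MDifferentiableAt 𝓘(ℝ, ℝ) (𝓡 n) c t) (ht : c t ∈ φ.source) {v : EuclideanSpace ℝ (Fin n)}
    (hv : HasDerivAt (φ ∘ c) v t) :
    F ⟨c t, mfderiv 𝓘(ℝ, ℝ) (𝓡 n) c t (1 : ℝ)⟩ = inChart F φ (φ (c t)) v :=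
  (inChart_apply_mfderiv hφ ht _).symm.trans
    (congrArg (inChart F φ (φ (c t))) (hv.unique (hasDerivAt_comp_chart hφ hc ht)).symm)

theorem IsFinslerMetric.continuous (hF : IsFinslerMetric F) : Continuous F := by
  rw [continuous_iff_continuousAt]
  intro z
  set φ := chartAt (EuclideanSpace ℝ (Fin n)) z.1
  have hφ : φ ∈ IsManifold.maximalAtlas (𝓡 n) ∞ M := IsManifold.chart_mem_maximalAtlas z.1
  have hz : z.1 ∈ φ.source := mem_chart_source _ _
  have hO : IsOpen ((Bundle.TotalSpace.proj : TangentBundle (𝓡 n) M → M) ⁻¹' φ.source) :=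
    φ.open_source.preimage (FiberBundle.continuous_proj (EuclideanSpace ℝ (Fin n)) _)
  have h1 : ContinuousOn (tangentMapWithin (𝓡 n) (𝓡 n) φ φ.source) _ :=
    (contMDiffOn_of_mem_maximalAtlas hφ).continuousOn_tangentMapWithin (by simp)
    φ.open_source.uniqueMDiffOn
  have h2 := h1.continuousAt (hO.mem_nhds hz)
  have h3 : ContinuousAt (fun q : TangentBundle (𝓡 n) M =>
      ((φ q.1, mfderivWithin (𝓡 n) (𝓡 n) φ φ.source q.1 q.2) :
        EuclideanSpace ℝ (Fin n) × EuclideanSpace ℝ (Fin n))) z :=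
    ContinuousAt.comp (g := tangentBundleModelSpaceHomeomorph (𝓡 n))
      (tangentBundleModelSpaceHomeomorph (𝓡 n)).continuous.continuousAt h2
  have h4 := (hF.isChartMetric_inChart hφ).continuousAt
    (z := (φ z.1, mfderivWithin (𝓡 n) (𝓡 n) φ φ.source z.1 z.2)) (φ.map_source hz)
  refine (ContinuousAt.comp (f := fun q : TangentBundle (𝓡 n) M =>
      ((φ q.1, mfderivWithin (𝓡 n) (𝓡 n) φ φ.source q.1 q.2) :
        EuclideanSpace ℝ (Fin n) × EuclideanSpace ℝ (Fin n))) h4 h3).congr ?_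
  filter_upwards [hO.mem_nhds hz] with q hq
  simp only [Function.comp_apply]
  rw [mfderivWithin_of_isOpen φ.open_source hq]
  exact inChart_apply_mfderiv hφ hq q.2

/-! ### Piecewise smooth curves and their length -/

lemma intervalIntegrable_of_contMDiffOn (hF : IsFinslerMetric F) {c : ℝ → M} {a b : ℝ}
    (hab : a ≤ b) (hc : ContMDiffOn 𝓘(ℝ, ℝ) (𝓡 n) ∞ c (Icc a b)) :
    IntervalIntegrable (fun t => F ⟨c t, mfderiv 𝓘(ℝ, ℝ) (𝓡 n) c t (1 : ℝ)⟩)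
      MeasureTheory.volume a b := by
  rcases hab.eq_or_lt with rfl | hab
  · exact IntervalIntegrable.refl
  have hs : UniqueMDiffOn 𝓘(ℝ, ℝ) (Icc a b) := (uniqueDiffOn_Icc hab).uniqueMDiffOn
  have h1 := hc.continuousOn_tangentMapWithin (by simp) hs
  have h2 : Continuous (fun t : ℝ => (⟨t, (1 : ℝ)⟩ : TangentBundle 𝓘(ℝ, ℝ) ℝ)) :=
    (contMDiff_toTangentBundle ℝ).continuous.comp
      (by fun_prop : Continuous fun t : ℝ => (t, (1 : ℝ)))
  have h3 : ContinuousOn (fun t => F (tangentMapWithin 𝓘(ℝ, ℝ) (𝓡 n) c (Icc a b) ⟨t, (1 : ℝ)⟩))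
      (Icc a b) :=
    hF.continuous.comp_continuousOn (h1.comp h2.continuousOn fun t ht => ht)
  have h4 : IntervalIntegrable
      (fun t => F (tangentMapWithin 𝓘(ℝ, ℝ) (𝓡 n) c (Icc a b) ⟨t, (1 : ℝ)⟩))
      MeasureTheory.volume a b := ContinuousOn.intervalIntegrable (by rwa [uIcc_of_le hab.le])
  refine h4.congr_uIoo fun t ht => ?_
  rw [uIoo_of_le hab.le] at ht
  simp only [tangentMapWithin]
  rw [mfderivWithin_of_mem_nhds (Icc_mem_nhds ht.1 ht.2)]

namespace IsPiecewiseSmooth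

variable {c c' : ℝ → M} {a b e : ℝ}

omit [IsManifold (𝓡 n) ∞ M] in
lemma le (hc : IsPiecewiseSmooth n c a b) : a ≤ b := by
  obtain ⟨N, τ, hτ, rfl, rfl, -⟩ := hc
  exact hτ (Nat.zero_le N)

omit [IsManifold (𝓡 n) ∞ M] in
lemma of_contMDiffOn (hab : a ≤ b) (hc : ContMDiffOn 𝓘(ℝ, ℝ) (𝓡 n) ∞ c (Icc a b)) :
    IsPiecewiseSmooth n c a b := by
  refine ⟨1, fun i => if i = 0 then a else b, ?_, by simp, by simp, ?_⟩
  · refine monotone_nat_of_le_succ fun i => ?_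
    rcases Nat.eq_zero_or_pos i with rfl | hi
    · simpa using hab
    · simp [hi.ne']
  · intro i hi
    have : i = 0 := by omega
    subst this
    simpa using hc

omit [IsManifold (𝓡 n) ∞ M] in
lemma congr (hc : IsPiecewiseSmooth n c a b) (h : EqOn c' c (Icc a b)) :
    IsPiecewiseSmooth n c' a b := by
  obtain ⟨N, τ, hτ, h0, hN, hs⟩ := hc
  refine ⟨N, τ, hτ, h0, hN, fun i hi => (hs i hi).congr fun t ht => h ⟨?_, ?_⟩⟩
  · rw [← h0]; exact (hτ (Nat.zero_le i)).trans ht.1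
  · rw [← hN]; exact ht.2.trans (hτ hi)

omit [IsManifold (𝓡 n) ∞ M] in
lemma mono (hc : IsPiecewiseSmooth n c a b) {s t : ℝ} (hs : a ≤ s) (hst : s ≤ t) (ht : t ≤ b) :
    IsPiecewiseSmooth n c s t := by
  obtain ⟨N, τ, hτ, h0, hN, hsm⟩ := hc
  refine ⟨N, fun i => max s (min (τ i) t), fun i j hij =>
    max_le_max le_rfl (min_le_min (hτ hij) le_rfl), ?_, ?_, ?_⟩
  · simp only [h0]
    exact max_eq_left ((min_le_left _ _).trans hs)
  · simp only [hN]
    rw [min_eq_right ht, max_eq_right hst]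
  · intro i hi
    have hle : τ i ≤ τ (i + 1) := hτ (Nat.le_succ i)
    change ContMDiffOn _ _ _ _ (Icc (max s (min (τ i) t)) (max s (min (τ (i + 1)) t)))
    -- a piece of the new partition is contained in a piece of the old one, or it is a point
    by_cases hsub : τ i ≤ t ∧ s ≤ τ (i + 1)
    · refine (hsm i hi).mono (Icc_subset_Icc ?_ ?_)
      · rw [min_eq_left hsub.1]; exact le_max_right _ _
      · exact max_le hsub.2 (min_le_left _ _)
    · have hpt : max s (min (τ i) t) = max s (min (τ (i + 1)) t) := by
        by_cases h1 : τ i ≤ t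
        · have h2 : τ (i + 1) ≤ s := by
            by_contra h; exact hsub ⟨h1, (not_le.1 h).le⟩
          rw [max_eq_left ((min_le_left _ _).trans (hle.trans h2)),
            max_eq_left ((min_le_left _ _).trans h2)]
        · have h1' : t ≤ τ i := (not_le.1 h1).le
          rw [min_eq_right h1', min_eq_right (h1'.trans hle)]
      rw [← hpt, Icc_self]
      intro x hx
      rw [mem_singleton_iff.1 hx]
      refine contMDiffWithinAt_iff.2 ⟨continuousWithinAt_singleton, ?_⟩
      simp only [mfld_simps]
      exact contDiffWithinAt_singleton

omit [IsManifold (𝓡 n) ∞ M] in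
lemma trans (h₁ : IsPiecewiseSmooth n c a b) (h₂ : IsPiecewiseSmooth n c b e) :
    IsPiecewiseSmooth n c a e := by
  obtain ⟨N, τ, hτ, h0, hN, hs⟩ := h₁
  obtain ⟨N', τ', hτ', h0', hN', hs'⟩ := h₂
  have hval : ∀ i, N ≤ i → (if i ≤ N then τ i else τ' (i - N)) = τ' (i - N) := by
    intro i hi
    split_ifs with h
    · have : i = N := le_antisymm h hi
      subst this
      rw [hN, Nat.sub_self, h0']
    · rfl
  refine ⟨N + N', fun i => if i ≤ N then τ i else τ' (i - N), ?_, by simpa using h0, ?_, ?_⟩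
  · refine monotone_nat_of_le_succ fun i => ?_
    by_cases h : i + 1 ≤ N
    · simp only [h, (Nat.le_succ i).trans h, if_true]
      exact hτ (Nat.le_succ i)
    · rw [hval i (by omega), hval (i + 1) (by omega)]
      exact hτ' (by omega)
  · simp only
    rw [hval _ (by omega), Nat.add_sub_cancel_left, hN']
  · intro i hi
    by_cases h : i + 1 ≤ N
    · simp only [h, (Nat.le_succ i).trans h, if_true]
      exact hs i h
    · simp only
      rw [hval i (by omega), hval (i + 1) (by omega), show i + 1 - N = i - N + 1 by omega]
      exact hs' _ (by omega)

omit [IsManifold (𝓡 n) ∞ M] in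
lemma comp_add_const (hc : IsPiecewiseSmooth n c a b) (k : ℝ) :
    IsPiecewiseSmooth n (fun t => c (t + k)) (a - k) (b - k) := by
  obtain ⟨N, τ, hτ, h0, hN, hs⟩ := hc
  refine ⟨N, fun i => τ i - k, fun i j hij => by have := hτ hij; simp only; linarith,
    by simp [h0], by simp [hN], fun i hi => ?_⟩
  refine (hs i hi).comp (f := fun t : ℝ => t + k) (t := Icc (τ i) (τ (i + 1))) ?_ ?_
  · have : ContDiff ℝ ∞ (fun t : ℝ => t + k) := by fun_prop
    exact this.contMDiff.contMDiffOn
  · intro t ht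
    exact ⟨by linarith [ht.1], by linarith [ht.2]⟩

omit [IsManifold (𝓡 n) ∞ M] in
lemma continuousOn (hc : IsPiecewiseSmooth n c a b) : ContinuousOn c (Icc a b) := by
  obtain ⟨N, τ, hτ, rfl, rfl, hs⟩ := hc
  have key : ∀ i ≤ N, ContinuousOn c (Icc (τ 0) (τ i)) := by
    intro i
    induction i with
    | zero => intro _; simp
    | succ i ih =>
      intro hi
      rw [← Icc_union_Icc_eq_Icc (hτ (Nat.zero_le i)) (hτ (Nat.le_succ i))]
      exact (ih (by omega)).union_of_isClosed (hs i hi).continuousOn isClosed_Icc isClosed_Icc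
  exact key N le_rfl

lemma intervalIntegrable (hF : IsFinslerMetric F) (hc : IsPiecewiseSmooth n c a b) :
    IntervalIntegrable (fun t => F ⟨c t, mfderiv 𝓘(ℝ, ℝ) (𝓡 n) c t (1 : ℝ)⟩)
      MeasureTheory.volume a b := by
  obtain ⟨N, τ, hτ, rfl, rfl, hs⟩ := hc
  exact IntervalIntegrable.trans_iterate fun i hi =>
    intervalIntegrable_of_contMDiffOn hF (hτ (Nat.le_succ i)) (hs i hi)

end IsPiecewiseSmooth

section Length

variable {c c' : ℝ → M} {a b e : ℝ}

lemma length_nonneg (hF : IsFinslerMetric F) (hab : a ≤ b) : 0 ≤ length F c a b :=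
  intervalIntegral.integral_nonneg hab fun t _ => (hF.minkowski (c t)).nonneg _

lemma length_add (hF : IsFinslerMetric F) (h₁ : IsPiecewiseSmooth n c a b)
    (h₂ : IsPiecewiseSmooth n c b e) : length F c a b + length F c b e = length F c a e :=
  intervalIntegral.integral_add_adjacent_intervals (h₁.intervalIntegrable hF)
    (h₂.intervalIntegrable hF)

omit [IsManifold (𝓡 n) ∞ M] in
lemma length_congr (hab : a ≤ b) (h : EqOn c c' (Icc a b)) : length F c a b = length F c' a b := by
  refine intervalIntegral.integral_congr_uIoo fun t ht => ?_
  rw [uIoo_of_le hab] at ht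
  have he : c =ᶠ[𝓝 t] c' := by
    filter_upwards [Icc_mem_nhds ht.1 ht.2] with s hs
    exact h hs
  have h1 : c t = c' t := he.self_of_nhds
  have h2 : (mfderiv 𝓘(ℝ, ℝ) (𝓡 n) c t (1 : ℝ) : EuclideanSpace ℝ (Fin n))
      = mfderiv 𝓘(ℝ, ℝ) (𝓡 n) c' t (1 : ℝ) :=
    congrArg (fun T : ℝ →L[ℝ] EuclideanSpace ℝ (Fin n) => T 1) he.mfderiv_eq
  have key : ∀ (x y : M) (v w : EuclideanSpace ℝ (Fin n)), x = y → v = w →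
      F ⟨x, v⟩ = F ⟨y, w⟩ := by rintro x y v w rfl rfl; rfl
  exact key _ _ _ _ h1 h2

omit [IsManifold (𝓡 n) ∞ M] in
lemma length_comp_add_const (k : ℝ) :
    length F (fun t => c (t + k)) (a - k) (b - k) = length F c a b := by
  have h : ∀ t, (mfderiv 𝓘(ℝ, ℝ) (𝓡 n) (fun t => c (t + k)) t (1 : ℝ) : EuclideanSpace ℝ (Fin n))
      = mfderiv 𝓘(ℝ, ℝ) (𝓡 n) c (t + k) (1 : ℝ) := by
    intro t
    have hk : ∀ (k t : ℝ), HasMFDerivAt 𝓘(ℝ, ℝ) 𝓘(ℝ, ℝ) (fun t : ℝ => t + k) t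
        (ContinuousLinearMap.id ℝ ℝ) := fun k t =>
      ((hasFDerivAt_id t).add_const k).hasMFDerivAt
    by_cases hc : MDifferentiableAt 𝓘(ℝ, ℝ) (𝓡 n) c (t + k)
    · have h1 := (hc.hasMFDerivAt.comp t (hk k t)).mfderiv
      exact congrArg (fun T : ℝ →L[ℝ] EuclideanSpace ℝ (Fin n) => T 1) h1
    · have hc' : ¬ MDifferentiableAt 𝓘(ℝ, ℝ) (𝓡 n) (fun t => c (t + k)) t := by
        intro h
        apply hc
        have h3 : MDifferentiableAt 𝓘(ℝ, ℝ) (𝓡 n) (fun t => c (t + k)) (t + k + -k) := by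
          simpa using h
        have h4 := h3.comp (t + k) (hk (-k) (t + k)).mdifferentiableAt
        simpa [Function.comp_def] using h4
      rw [mfderiv_zero_of_not_mdifferentiableAt hc, mfderiv_zero_of_not_mdifferentiableAt hc']
      rfl
  have h2 : length F (fun t => c (t + k)) (a - k) (b - k) = ∫ t in (a - k)..(b - k),
      (fun t => F ⟨c t, mfderiv 𝓘(ℝ, ℝ) (𝓡 n) c t (1 : ℝ)⟩) (t + k) := by
    unfold length
    congr 1
    ext t
    have key : ∀ (x : M) (v w : EuclideanSpace ℝ (Fin n)), v = w → F ⟨x, v⟩ = F ⟨x, w⟩ := by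
      rintro x v w rfl; rfl
    exact key _ _ _ (h t)
  rw [h2, intervalIntegral.integral_comp_add_right
    (fun t => F ⟨c t, mfderiv 𝓘(ℝ, ℝ) (𝓡 n) c t (1 : ℝ)⟩)]
  simp [length]

end Length

/-! ### The distance of a Finsler metric -/

section Dist

lemma dist_nonneg (hF : IsFinslerMetric F) (p q : M) : 0 ≤ dist F p q :=
  Real.sInf_nonneg (by rintro _ ⟨c, a, b, hab, -, -, -, rfl⟩; exact length_nonneg hF hab.le)

lemma dist_le_length_of_lt (hF : IsFinslerMetric F) {c : ℝ → M} {a b : ℝ} (hab : a < b)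
    (hc : IsPiecewiseSmooth n c a b) : dist F (c a) (c b) ≤ length F c a b :=
  csInf_le ⟨0, by rintro _ ⟨c, a, b, hab, -, -, -, rfl⟩; exact length_nonneg hF hab.le⟩
    ⟨c, a, b, hab, hc, rfl, rfl, rfl⟩

lemma dist_self (hF : IsFinslerMetric F) (p : M) : dist F p p = 0 := by
  refine le_antisymm ?_ (dist_nonneg hF p p)
  have h := dist_le_length_of_lt hF (c := fun _ => p) zero_lt_one
    (IsPiecewiseSmooth.of_contMDiffOn (n := n) zero_le_one contMDiffOn_const)
  refine h.trans (le_of_eq ?_)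
  unfold length
  have : ∀ t : ℝ, F ⟨p, mfderiv 𝓘(ℝ, ℝ) (𝓡 n) (fun _ : ℝ => p) t (1 : ℝ)⟩ = 0 := by
    intro t
    rw [mfderiv_const]
    exact (hF.minkowski p).map_zero
  simp only [this, intervalIntegral.integral_zero]

lemma dist_le_length (hF : IsFinslerMetric F) {c : ℝ → M} {a b : ℝ}
    (hc : IsPiecewiseSmooth n c a b) : dist F (c a) (c b) ≤ length F c a b := by
  rcases hc.le.eq_or_lt with rfl | h
  · rw [dist_self hF]
    exact length_nonneg hF le_rfl
  · exact dist_le_length_of_lt hF h hc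

lemma length_mono (hF : IsFinslerMetric F) {c : ℝ → M} {a b s t : ℝ}
    (hc : IsPiecewiseSmooth n c a b) (hs : a ≤ s) (hst : s ≤ t) (ht : t ≤ b) :
    length F c s t ≤ length F c a b := by
  have h1 := length_add hF (hc.mono le_rfl hs (hst.trans ht)) (hc.mono hs (hst.trans ht) le_rfl)
  have h2 := length_add hF (hc.mono hs hst ht) (hc.mono (hs.trans hst) ht le_rfl)
  have h3 := length_nonneg hF (c := c) hs
  have h4 := length_nonneg hF (c := c) ht
  linarith

/-- Concatenation of curves. -/
lemma exists_concat (hF : IsFinslerMetric F) {c₁ c₂ : ℝ → M} {a₁ b₁ a₂ b₂ : ℝ} (h₁ : a₁ < b₁)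
    (h₂ : a₂ < b₂) (hc₁ : IsPiecewiseSmooth n c₁ a₁ b₁) (hc₂ : IsPiecewiseSmooth n c₂ a₂ b₂)
    (h : c₁ b₁ = c₂ a₂) : ∃ c a b, a < b ∧ IsPiecewiseSmooth n c a b ∧ c a = c₁ a₁ ∧ c b = c₂ b₂ ∧
      length F c a b = length F c₁ a₁ b₁ + length F c₂ a₂ b₂ := by
  set k := a₂ - b₁
  set c : ℝ → M := fun t => if t ≤ b₁ then c₁ t else c₂ (t + k)
  have e1 : EqOn c c₁ (Icc a₁ b₁) := fun t ht => if_pos ht.2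
  have e2 : EqOn c (fun t => c₂ (t + k)) (Icc b₁ (b₂ - k)) := by
    intro t ht
    rcases ht.1.eq_or_lt with rfl | hlt
    · have : b₁ + k = a₂ := by simp [k]
      simp only [c, le_refl, if_true, this, h]
    · exact if_neg (not_le.2 hlt)
  have hk : a₂ - k = b₁ := by simp [k]
  have hb : b₁ ≤ b₂ - k := by simp only [k]; linarith
  have p1 := hc₁.congr e1
  have hc₂' := hc₂.comp_add_const k
  have hl := length_comp_add_const (F := F) (c := c₂) (a := a₂) (b := b₂) k
  rw [hk] at hc₂' hl
  have p2 := hc₂'.congr e2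
  refine ⟨c, a₁, b₂ - k, by linarith, p1.trans p2, e1 ⟨le_rfl, h₁.le⟩, ?_, ?_⟩
  · rw [e2 ⟨hb, le_rfl⟩]
    simp
  · rw [← length_add hF p1 p2, length_congr h₁.le e1, length_congr hb e2, hl]

omit [IsManifold (𝓡 n) ∞ M] in
/-- A segment in a chart. -/
lemma exists_segment (hφ : φ ∈ IsManifold.maximalAtlas (𝓡 n) ∞ M)
    {x y : EuclideanSpace ℝ (Fin n)} (hxy : segment ℝ x y ⊆ φ.target) :
    ∃ c : ℝ → M, IsPiecewiseSmooth n c 0 1 ∧ c 0 = φ.symm x ∧ c 1 = φ.symm y ∧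
      length F c 0 1 = ∫ t in (0 : ℝ)..1, inChart F φ (x + t • (y - x)) (y - x) := by
  have hmem : ∀ t ∈ Icc (0 : ℝ) 1, x + t • (y - x) ∈ φ.target := fun t ht =>
    hxy (by rw [segment_eq_image']; exact mem_image_of_mem _ ht)
  have hs : ContMDiffOn 𝓘(ℝ, ℝ) (𝓡 n) ∞ (fun t : ℝ => φ.symm (x + t • (y - x))) (Icc 0 1) := by
    refine (contMDiffOn_symm_of_mem_maximalAtlas hφ).comp
      (f := fun t : ℝ => x + t • (y - x)) (t := φ.target) ?_ hmem
    have : ContDiff ℝ ∞ (fun t : ℝ => x + t • (y - x)) := by fun_prop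
    exact this.contMDiff.contMDiffOn
  refine ⟨fun t => φ.symm (x + t • (y - x)), .of_contMDiffOn zero_le_one hs, by simp, by simp, ?_⟩
  refine intervalIntegral.integral_congr_uIoo fun t ht => ?_
  rw [uIoo_of_le zero_le_one] at ht
  have hd : MDifferentiableAt 𝓘(ℝ, ℝ) (𝓡 n) (fun t : ℝ => φ.symm (x + t • (y - x))) t :=
    (hs.contMDiffAt (Icc_mem_nhds ht.1 ht.2)).mdifferentiableAt (by simp)
  have hu := hmem t ⟨ht.1.le, ht.2.le⟩
  have hv : HasDerivAt (φ ∘ fun t : ℝ => φ.symm (x + t • (y - x))) (y - x) t := by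
    have h1 : HasDerivAt (fun t : ℝ => x + t • (y - x)) (y - x) t := by
      simpa using ((hasDerivAt_id t).smul_const (y - x)).const_add x
    refine h1.congr_of_eventuallyEq ?_
    filter_upwards [Icc_mem_nhds ht.1 ht.2] with s hs
    exact φ.right_inv (hmem s hs)
  refine (apply_mfderiv_eq_inChart hφ hd (φ.map_target hu) hv).trans ?_
  exact congrArg (fun z => inChart F φ z (y - x)) (φ.right_inv hu)

/-- Points of a connected manifold are joined by piecewise smooth curves. -/
lemma exists_isPiecewiseSmooth [ConnectedSpace M] (hF : IsFinslerMetric F) (x y : M) :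
    ∃ c a b, a < b ∧ IsPiecewiseSmooth n c a b ∧ c a = x ∧ c b = y := by
  set R : M → M → Prop := fun x y =>
    ∃ c a b, a < b ∧ IsPiecewiseSmooth n c a b ∧ c a = x ∧ c b = y
  have htrans : ∀ x y z, R x y → R y z → R x z := by
    rintro x y z ⟨c₁, a₁, b₁, h₁, hc₁, rfl, rfl⟩ ⟨c₂, a₂, b₂, h₂, hc₂, h, rfl⟩
    obtain ⟨c, a, b, hab, hc, ha, hb, -⟩ := exists_concat hF h₁ h₂ hc₁ hc₂ h.symm
    exact ⟨c, a, b, hab, hc, ha, hb⟩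
  have hloc : ∀ z : M, ∃ V ∈ 𝓝 z, ∀ y ∈ V, R z y ∧ R y z := by
    intro z
    set ψ := chartAt (EuclideanSpace ℝ (Fin n)) z
    have hψ : ψ ∈ IsManifold.maximalAtlas (𝓡 n) ∞ M := IsManifold.chart_mem_maximalAtlas z
    have hz : z ∈ ψ.source := mem_chart_source _ _
    obtain ⟨r, hr, hball⟩ := Metric.mem_nhds_iff.1 (ψ.open_target.mem_nhds (ψ.map_source hz))
    refine ⟨ψ.source ∩ ψ ⁻¹' Metric.ball (ψ z) r,
      (ψ.isOpen_inter_preimage Metric.isOpen_ball).mem_nhds ⟨hz, Metric.mem_ball_self hr⟩, ?_⟩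
    rintro y ⟨hy, hyr⟩
    have hconv := convex_ball (ψ z) r
    have key : ∀ u w : M, u ∈ ψ.source → w ∈ ψ.source → ψ u ∈ Metric.ball (ψ z) r →
        ψ w ∈ Metric.ball (ψ z) r → R u w := by
      intro u w hu hw hu' hw'
      obtain ⟨c, hc, h0, h1, -⟩ := exists_segment (F := F) hψ
        ((hconv.segment_subset hu' hw').trans hball)
      exact ⟨c, 0, 1, zero_lt_one, hc, by rw [h0, ψ.left_inv hu], by rw [h1, ψ.left_inv hw]⟩
    exact ⟨key z y hz hy (Metric.mem_ball_self hr) hyr, key y z hy hz hyr (Metric.mem_ball_self hr)⟩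
  have hcl : IsClopen {y | R x y} := by
    constructor
    · rw [← isOpen_compl_iff, isOpen_iff_mem_nhds]
      intro z hz
      obtain ⟨V, hV, h⟩ := hloc z
      filter_upwards [hV] with y hy hxy
      exact hz (htrans _ _ _ hxy (h y hy).2)
    · rw [isOpen_iff_mem_nhds]
      intro z hz
      obtain ⟨V, hV, h⟩ := hloc z
      filter_upwards [hV] with y hy
      exact htrans _ _ _ hz (h y hy).1
  have hx : R x x := by
    obtain ⟨V, hV, h⟩ := hloc x
    exact (h x (mem_of_mem_nhds hV)).1
  have := hcl.eq_univ ⟨x, hx⟩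
  exact (this ▸ mem_univ y : y ∈ {y | R x y})

lemma exists_length_lt [ConnectedSpace M] (hF : IsFinslerMetric F) (x y : M) {ε : ℝ} (hε : 0 < ε) :
    ∃ c a b, a < b ∧ IsPiecewiseSmooth n c a b ∧ c a = x ∧ c b = y ∧
      length F c a b < dist F x y + ε := by
  obtain ⟨c, a, b, hab, hc, ha, hb⟩ := exists_isPiecewiseSmooth hF x y
  obtain ⟨l, ⟨c, a, b, hab, hc, ha, hb, rfl⟩, hl⟩ := exists_lt_of_csInf_lt
    (s := {l | ∃ (c : ℝ → M) (a b : ℝ), a < b ∧ IsPiecewiseSmooth n c a b ∧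
      c a = x ∧ c b = y ∧ l = length F c a b}) ⟨_, c, a, b, hab, hc, ha, hb, rfl⟩
    (lt_add_of_pos_right (dist F x y) hε)
  exact ⟨c, a, b, hab, hc, ha, hb, hl⟩

lemma dist_triangle [ConnectedSpace M] (hF : IsFinslerMetric F) (x y z : M) :
    dist F x z ≤ dist F x y + dist F y z := by
  refine le_of_forall_pos_le_add fun ε hε => ?_
  obtain ⟨c₁, a₁, b₁, h₁, hc₁, rfl, rfl, hl₁⟩ := exists_length_lt hF x y (half_pos hε)
  obtain ⟨c₂, a₂, b₂, h₂, hc₂, h, rfl, hl₂⟩ := exists_length_lt hF (c₁ b₁) z (half_pos hε)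
  obtain ⟨c, a, b, hab, hc, ha, hb, hl⟩ := exists_concat hF h₁ h₂ hc₁ hc₂ h.symm
  have := dist_le_length hF hc
  rw [ha, hb, hl] at this
  linarith

/-- Segments of a chart bound the distance from above. -/
lemma dist_symm_le (hF : IsFinslerMetric F) (hφ : φ ∈ IsManifold.maximalAtlas (𝓡 n) ∞ M)
    {B : Set (EuclideanSpace ℝ (Fin n))} {A : ℝ} (hB : Convex ℝ B) (hBt : B ⊆ φ.target)
    (hA : Bounds (inChart F φ) B A) {x y : EuclideanSpace ℝ (Fin n)} (hx : x ∈ B) (hy : y ∈ B) :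
    dist F (φ.symm x) (φ.symm y) ≤ inChart F φ x (y - x) + A * ‖y - x‖ ^ 2 := by
  have hseg := hB.segment_subset hx hy
  obtain ⟨c, hc, h0, h1, hl⟩ := exists_segment (F := F) hφ (hseg.trans hBt)
  have h := dist_le_length hF hc
  rw [h0, h1, hl] at h
  have hmem : ∀ t ∈ Icc (0 : ℝ) 1, x + t • (y - x) ∈ B := fun t ht =>
    hseg (by rw [segment_eq_image']; exact mem_image_of_mem _ ht)
  have hcont : ContinuousOn (fun t : ℝ => inChart F φ (x + t • (y - x)) (y - x)) (Icc 0 1) := by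
    intro t ht
    refine ContinuousAt.continuousWithinAt ?_
    refine ContinuousAt.comp (f := fun t : ℝ => (x + t • (y - x), y - x))
      (g := fun z : _ × _ => inChart F φ z.1 z.2) ?_ (by fun_prop)
    exact (hF.isChartMetric_inChart hφ).continuousAt (hBt (hmem t ht))
  have hle := intervalIntegral.integral_mono_on (μ := MeasureTheory.volume) zero_le_one
    (hcont.intervalIntegrable_of_Icc zero_le_one)
    (intervalIntegrable_const (c := inChart F φ x (y - x) + A * ‖y - x‖ ^ 2)) (fun t ht => by
      have h1 := hA.lipschitz _ (hmem t ht) x hx (y - x)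
      have h2 : ‖x + t • (y - x) - x‖ ≤ ‖y - x‖ := by
        rw [add_sub_cancel_left, norm_smul, Real.norm_eq_abs, abs_of_nonneg ht.1]
        exact mul_le_of_le_one_left (norm_nonneg _) ht.2
      have h3 : A * ‖x + t • (y - x) - x‖ * ‖y - x‖ ≤ A * ‖y - x‖ * ‖y - x‖ := by
        have := hA.pos.le
        gcongr
      nlinarith)
  rw [intervalIntegral.integral_const, sub_zero, one_smul] at hle
  exact h.trans hle

/-- Calibration: a function whose differential is bounded by `K F` along a curve grows at most by
`K` times the length of the curve. -/
lemma sub_le_mul_length (hF : IsFinslerMetric F) {h : M → ℝ}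
    {h' : M → EuclideanSpace ℝ (Fin n) →L[ℝ] ℝ} {K : ℝ} {c : ℝ → M} {a b : ℝ}
    (hc : IsPiecewiseSmooth n c a b)
    (hd : ∀ t ∈ Icc a b, HasMFDerivAt (𝓡 n) 𝓘(ℝ, ℝ) h (c t) (h' (c t)))
    (hle : ∀ t ∈ Icc a b, ∀ v, h' (c t) v ≤ K * F ⟨c t, v⟩) :
    h (c b) - h (c a) ≤ K * length F c a b := by
  have piece : ∀ s t, a ≤ s → s ≤ t → t ≤ b → ContMDiffOn 𝓘(ℝ, ℝ) (𝓡 n) ∞ c (Icc s t) →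
      h (c t) - h (c s) ≤ K * length F c s t := by
    intro s t has hst htb hs
    have hsub : Icc s t ⊆ Icc a b := Icc_subset_Icc has htb
    have hcont : ContinuousOn (fun u => h (c u)) (Icc s t) := fun u hu =>
      ContinuousAt.comp_continuousWithinAt (hd u (hsub hu)).mdifferentiableAt.continuousAt
        (hs.continuousOn u hu)
    have hint := intervalIntegrable_of_contMDiffOn hF hst hs
    have h1 := intervalIntegral.sub_le_integral_of_hasDeriv_right_of_le
      (g := fun u => h (c u))
      (g' := fun u => h' (c u) (mfderiv 𝓘(ℝ, ℝ) (𝓡 n) c u (1 : ℝ)))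
      (φ := fun u => K * F ⟨c u, mfderiv 𝓘(ℝ, ℝ) (𝓡 n) c u (1 : ℝ)⟩) hst hcont
      (fun u hu => by
        have hcu : MDifferentiableAt 𝓘(ℝ, ℝ) (𝓡 n) c u :=
          (hs.contMDiffAt (Icc_mem_nhds hu.1 hu.2)).mdifferentiableAt (by simp)
        let T : ℝ →L[ℝ] ℝ :=
          (h' (c u)).comp (mfderiv 𝓘(ℝ, ℝ) (𝓡 n) c u : ℝ →L[ℝ] EuclideanSpace ℝ (Fin n))
        have h2 : HasFDerivAt (fun u => h (c u)) T u :=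
          ((hd u (hsub (Ioo_subset_Icc_self hu))).comp u
            hcu.hasMFDerivAt).hasFDerivAt
        exact h2.hasDerivAt.hasDerivWithinAt)
      (((intervalIntegrable_iff_integrableOn_Icc_of_le hst).1 hint).const_mul K)
      (fun u hu => hle u (hsub (Ioo_subset_Icc_self hu)) _)
    rw [intervalIntegral.integral_const_mul] at h1
    exact h1
  have hc' := hc
  obtain ⟨N, τ, hτ, h0, hN, hs⟩ := hc
  have key : ∀ i ≤ N, h (c (τ i)) - h (c a) ≤ K * length F c a (τ i) := by
    intro i
    induction i with
    | zero =>
      intro _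
      rw [h0]
      simp [length]
    | succ i ih =>
      intro hi
      have ha : a ≤ τ i := h0 ▸ hτ (Nat.zero_le i)
      have hb : τ (i + 1) ≤ b := hN ▸ hτ hi
      have hii : τ i ≤ τ (i + 1) := hτ (Nat.le_succ i)
      have h1 := ih (by omega)
      have h2 := piece _ _ ha hii hb (hs i hi)
      rw [← length_add hF (hc'.mono le_rfl ha (hii.trans hb)) (hc'.mono ha hii hb)]
      linarith
  have := key N le_rfl
  rwa [hN] at this

lemma sub_le_mul_dist [ConnectedSpace M] (hF : IsFinslerMetric F) {h : M → ℝ}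
    {h' : M → EuclideanSpace ℝ (Fin n) →L[ℝ] ℝ} {K : ℝ} (hK : 0 ≤ K)
    (hd : ∀ x, HasMFDerivAt (𝓡 n) 𝓘(ℝ, ℝ) h x (h' x))
    (hle : ∀ x v, h' x v ≤ K * F ⟨x, v⟩) (x y : M) :
    h y - h x ≤ K * dist F x y := by
  refine le_of_forall_pos_le_add fun ε hε => ?_
  obtain ⟨c, a, b, hab, hc, rfl, rfl, hl⟩ := exists_length_lt hF x y
    (show 0 < ε / (K + 1) by positivity)
  have h1 := sub_le_mul_length hF hc (fun t _ => hd (c t)) (fun t _ => hle (c t))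
  have h2 := mul_le_mul_of_nonneg_left hl.le hK
  have h3 : K * (ε / (K + 1)) ≤ ε := by
    rw [mul_div_assoc', div_le_iff₀ (by positivity)]
    nlinarith
  nlinarith

end Dist

/-! ### The distance in a chart -/

section Chart

open scoped Classical in
/-- The function on the manifold which is `G` in the chart `φ`, extended by zero. -/
def chartExtend {E' : Type*} [Zero E'] (φ : OpenPartialHomeomorph M (EuclideanSpace ℝ (Fin n)))
    (G : EuclideanSpace ℝ (Fin n) → E') (x : M) : E' :=
  if x ∈ φ.source then G (φ x) else 0

omit [ChartedSpace (EuclideanSpace ℝ (Fin n)) M] [IsManifold (𝓡 n) ∞ M] in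
lemma chartExtend_of_mem {E' : Type*} [Zero E'] {G : EuclideanSpace ℝ (Fin n) → E'} {x : M}
    (hx : x ∈ φ.source) : chartExtend φ G x = G (φ x) := if_pos hx

omit [ChartedSpace (EuclideanSpace ℝ (Fin n)) M] [IsManifold (𝓡 n) ∞ M] in
lemma chartExtend_symm {E' : Type*} [Zero E'] {G : EuclideanSpace ℝ (Fin n) → E'}
    {z : EuclideanSpace ℝ (Fin n)} (hz : z ∈ φ.target) : chartExtend φ G (φ.symm z) = G z := by
  rw [chartExtend_of_mem (φ.map_target hz), φ.right_inv hz]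

omit [ChartedSpace (EuclideanSpace ℝ (Fin n)) M] [IsManifold (𝓡 n) ∞ M] in
lemma chartExtend_of_notMem {E' : Type*} [Zero E'] {G : EuclideanSpace ℝ (Fin n) → E'} {x : M}
    (hx : x ∉ φ.source) : chartExtend φ G x = 0 := if_neg hx

variable {z₀ : EuclideanSpace ℝ (Fin n)} {r A L : ℝ}

lemma chartExtend_sub_le_dist [T2Space M] [ConnectedSpace M] (hF : IsFinslerMetric F)
    (hφ : φ ∈ IsManifold.maximalAtlas (𝓡 n) ∞ M) (hr : Metric.closedBall z₀ r ⊆ φ.target)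
    (hA : Bounds (inChart F φ) (Metric.closedBall z₀ r) A)
    {G : EuclideanSpace ℝ (Fin n) → ℝ} (hG : Differentiable ℝ G)
    (hG0 : ∀ z ∉ Metric.closedBall z₀ r, G z = 0) (hL : ∀ z, ‖fderiv ℝ G z‖ ≤ L) (x y : M) :
    chartExtend φ G y - chartExtend φ G x ≤ L * A * dist F x y := by
  have hL0 : 0 ≤ L := (norm_nonneg _).trans (hL z₀)
  have hLA : 0 ≤ L * A := mul_nonneg hL0 hA.pos.le
  have hF0 : ∀ (x : M) (v : EuclideanSpace ℝ (Fin n)), 0 ≤ F ⟨x, v⟩ := fun x v =>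
    (hF.minkowski x).nonneg v
  have key : ∀ x : M, ∃ h' : EuclideanSpace ℝ (Fin n) →L[ℝ] ℝ,
      HasMFDerivAt (𝓡 n) 𝓘(ℝ, ℝ) (chartExtend φ G) x h' ∧ ∀ v, h' v ≤ L * A * F ⟨x, v⟩ := by
    intro x
    by_cases hx : x ∈ φ.source
    · let T : EuclideanSpace ℝ (Fin n) →L[ℝ] EuclideanSpace ℝ (Fin n) :=
        mfderiv (𝓡 n) (𝓡 n) φ x
      have h1 := ((mdifferentiable_of_mem_maximalAtlas hφ).mdifferentiableAt hx).hasMFDerivAt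
      have h2 : HasMFDerivAt (𝓡 n) 𝓘(ℝ, ℝ) G (φ x) (fderiv ℝ G (φ x)) :=
        (hG (φ x)).hasFDerivAt.hasMFDerivAt
      refine ⟨(fderiv ℝ G (φ x)).comp T, (h2.comp x h1).congr_of_eventuallyEq ?_, fun v => ?_⟩
      · filter_upwards [φ.open_source.mem_nhds hx] with y hy
        exact chartExtend_of_mem hy
      · have hT : inChart F φ (φ x) (T v) = F ⟨x, v⟩ := inChart_apply_mfderiv hφ hx v
        rw [ContinuousLinearMap.comp_apply]
        by_cases hxr : φ x ∈ Metric.closedBall z₀ r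
        · calc fderiv ℝ G (φ x) (T v) ≤ ‖fderiv ℝ G (φ x) (T v)‖ := le_abs_self _
            _ ≤ L * ‖T v‖ := (fderiv ℝ G (φ x)).le_of_opNorm_le (hL _) _
            _ ≤ L * (A * F ⟨x, v⟩) := by
              rw [← hT]
              exact mul_le_mul_of_nonneg_left (hA.norm_le _ hxr _) hL0
            _ = _ := by ring
        · have h0 : fderiv ℝ G (φ x) = 0 := by
            have : G =ᶠ[𝓝 (φ x)] fun _ => (0 : ℝ) := by
              filter_upwards [Metric.isClosed_closedBall.isOpen_compl.mem_nhds hxr] with z hz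
              exact hG0 z hz
            rw [this.fderiv_eq]
            simp
          rw [h0]
          exact mul_nonneg hLA (hF0 x v)
    · refine ⟨0, ?_, fun v => mul_nonneg hLA (hF0 x v)⟩
      -- the image of the closed ball is compact, hence closed
      have hK : IsClosed (φ.symm '' Metric.closedBall z₀ r) :=
        ((isCompact_closedBall z₀ r).image_of_continuousOn
          (φ.continuousOn_symm.mono hr)).isClosed
      have hxK : x ∉ φ.symm '' Metric.closedBall z₀ r := by
        rintro ⟨z, hz, rfl⟩
        exact hx (φ.map_target (hr hz))
      refine (hasMFDerivAt_const (0 : ℝ) x).congr_of_eventuallyEq ?_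
      filter_upwards [hK.isOpen_compl.mem_nhds hxK] with y hy
      by_cases hys : y ∈ φ.source
      · rw [chartExtend_of_mem hys]
        refine hG0 _ fun h => hy ⟨φ y, h, φ.left_inv hys⟩
      · exact chartExtend_of_notMem hys
  choose h' hh' hle using key
  exact sub_le_mul_dist hF hLA hh' hle x y

/-- A compactly supported function in a chart is Lipschitz for the Finsler distance. -/
lemma norm_chartExtend_sub_le_dist [T2Space M] [ConnectedSpace M] (hF : IsFinslerMetric F)
    (hφ : φ ∈ IsManifold.maximalAtlas (𝓡 n) ∞ M) (hr : Metric.closedBall z₀ r ⊆ φ.target)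
    (hA : Bounds (inChart F φ) (Metric.closedBall z₀ r) A)
    {E' : Type*} [NormedAddCommGroup E'] [NormedSpace ℝ E']
    {G : EuclideanSpace ℝ (Fin n) → E'} (hG : ContDiff ℝ ∞ G)
    (hG0 : ∀ z ∉ Metric.closedBall z₀ r, G z = 0) :
    ∃ K > 0, ∀ x y : M, ‖chartExtend φ G y - chartExtend φ G x‖ ≤ K * dist F x y := by
  have hsupp : HasCompactSupport G := HasCompactSupport.intro (isCompact_closedBall z₀ r) hG0
  obtain ⟨L, hL⟩ := (hsupp.fderiv ℝ).exists_bound_of_continuous (hG.continuous_fderiv (by simp))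
  have hL0 : 0 ≤ L := (norm_nonneg _).trans (hL z₀)
  refine ⟨L * A + 1, by have := hA.pos; positivity, fun x y => ?_⟩
  obtain ⟨ℓ, hℓ, hℓe⟩ := exists_dual_vector'' ℝ (chartExtend φ G y - chartExtend φ G x)
  have hcomp : ∀ x, chartExtend φ (fun z => ℓ (G z)) x = ℓ (chartExtend φ G x) := by
    intro x
    unfold chartExtend
    split_ifs <;> simp
  have hGd : Differentiable ℝ G := hG.differentiable (by simp)
  have h := chartExtend_sub_le_dist hF hφ hr hA (G := fun z => ℓ (G z)) (L := L)
    (ℓ.differentiable.comp hGd) (fun z hz => by rw [hG0 z hz, _root_.map_zero]) (fun z => by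
      have e : fderiv ℝ (fun z => ℓ (G z)) z = ℓ.comp (fderiv ℝ G z) :=
        (ℓ.hasFDerivAt.comp z (hGd z).hasFDerivAt).fderiv
      rw [e]
      refine (ContinuousLinearMap.opNorm_comp_le _ _).trans ?_
      exact (mul_le_of_le_one_left (norm_nonneg _) hℓ).trans (hL z)) x y
  rw [hcomp, hcomp, ← map_sub, hℓe] at h
  have := dist_nonneg hF x y
  simp only [RCLike.ofReal_real_eq_id, id_eq] at h
  linarith

/-- Small forward and backward balls of the Finsler distance lie in the chart domain. -/
lemma exists_dist_lt_imp_mem [T2Space M] [ConnectedSpace M] (hF : IsFinslerMetric F)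
    (hφ : φ ∈ IsManifold.maximalAtlas (𝓡 n) ∞ M) (hr0 : 0 < r)
    (hr : Metric.closedBall z₀ r ⊆ φ.target)
    (hA : Bounds (inChart F φ) (Metric.closedBall z₀ r) A) :
    ∃ δ > 0, ∀ x ∈ Metric.closedBall z₀ (r / 2), ∀ q : M,
      dist F (φ.symm x) q < δ ∨ dist F q (φ.symm x) < δ →
        q ∈ φ.source ∧ φ q ∈ Metric.closedBall z₀ r := by
  let χ : ContDiffBump z₀ := ⟨r / 2, r, by linarith, by linarith⟩
  have hχ0 : ∀ z ∉ Metric.closedBall z₀ r, χ z = 0 := fun z hz => χ.zero_of_le_dist (by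
    have := Metric.mem_closedBall.not.1 hz
    exact (not_le.1 this).le)
  obtain ⟨K, hK, h⟩ := norm_chartExtend_sub_le_dist hF hφ hr hA (χ.contDiff (n := ⊤)) hχ0
  refine ⟨1 / K, by positivity, fun x hx q hq => ?_⟩
  have hxt : x ∈ φ.target := hr (Metric.closedBall_subset_closedBall (by linarith) hx)
  have hx1 : chartExtend φ χ (φ.symm x) = 1 := by
    rw [chartExtend_symm hxt]
    exact χ.one_of_mem_closedBall hx
  have hne : chartExtend φ χ q ≠ 0 := by
    intro h0
    rcases hq with hq | hq
    · have h1 := h (φ.symm x) q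
      rw [h0, hx1, zero_sub, norm_neg, norm_one] at h1
      rw [lt_div_iff₀ hK] at hq
      linarith
    · have h1 := h q (φ.symm x)
      rw [h0, hx1, sub_zero, norm_one] at h1
      rw [lt_div_iff₀ hK] at hq
      linarith
  by_cases hqs : q ∈ φ.source
  · refine ⟨hqs, ?_⟩
    by_contra hqr
    rw [chartExtend_of_mem hqs] at hne
    exact hne (hχ0 _ hqr)
  · exact absurd (chartExtend_of_notMem hqs) hne

/-- In a chart the norm is locally bounded by the Finsler distance. -/
lemma exists_norm_sub_le_mul_dist [T2Space M] [ConnectedSpace M] (hF : IsFinslerMetric F)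
    (hφ : φ ∈ IsManifold.maximalAtlas (𝓡 n) ∞ M) (hr0 : 0 < r)
    (hr : Metric.closedBall z₀ r ⊆ φ.target)
    (hA : Bounds (inChart F φ) (Metric.closedBall z₀ r) A) :
    ∃ K > 0, ∀ x ∈ Metric.closedBall z₀ (r / 2), ∀ y ∈ Metric.closedBall z₀ (r / 2),
      ‖y - x‖ ≤ K * dist F (φ.symm x) (φ.symm y) := by
  let χ : ContDiffBump z₀ := ⟨r / 2, r, by linarith, by linarith⟩
  obtain ⟨K, hK, h⟩ := norm_chartExtend_sub_le_dist hF hφ hr hA (G := fun z => χ z • (z - z₀))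
    ((χ.contDiff (n := ⊤)).smul (contDiff_id.sub contDiff_const)) (fun z hz => by
      have := Metric.mem_closedBall.not.1 hz
      rw [χ.zero_of_le_dist (not_le.1 this).le, zero_smul])
  have hsub : Metric.closedBall z₀ (r / 2) ⊆ Metric.closedBall z₀ r :=
    Metric.closedBall_subset_closedBall (by linarith)
  refine ⟨K, hK, fun x hx y hy => ?_⟩
  have h1 := h (φ.symm x) (φ.symm y)
  rw [chartExtend_symm (hr (hsub hx)), chartExtend_symm (hr (hsub hy))] at h1
  simp only [χ.one_of_mem_closedBall hx, χ.one_of_mem_closedBall hy, one_smul,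
    sub_sub_sub_cancel_right] at h1
  exact h1

end Chart

/-! ### The Finsler distance is a length quasi-metric -/

lemma exists_chart_bounds (hF : IsFinslerMetric F)
    (hφ : φ ∈ IsManifold.maximalAtlas (𝓡 n) ∞ M) {z₀ : EuclideanSpace ℝ (Fin n)}
    (hz₀ : z₀ ∈ φ.target) : ∃ r > 0, Metric.closedBall z₀ r ⊆ φ.target ∧
      ∃ A, Bounds (inChart F φ) (Metric.closedBall z₀ r) A :=
  (hF.isChartMetric_inChart hφ).exists_bounds hz₀

lemma tendsto_dist (hF : IsFinslerMetric F) (x : M) :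
    Tendsto (fun y => dist F x y) (𝓝 x) (𝓝 0) ∧ Tendsto (fun y => dist F y x) (𝓝 x) (𝓝 0) := by
  set φ := chartAt (EuclideanSpace ℝ (Fin n)) x
  have hφ : φ ∈ IsManifold.maximalAtlas (𝓡 n) ∞ M := IsManifold.chart_mem_maximalAtlas x
  have hx : x ∈ φ.source := mem_chart_source _ _
  obtain ⟨r, hr0, hr, A, hA⟩ := exists_chart_bounds hF hφ (φ.map_source hx)
  set B := Metric.closedBall (φ x) r
  have hxB : φ x ∈ B := Metric.mem_closedBall_self hr0.le
  have hcont : Tendsto (fun y => ‖φ y - φ x‖) (𝓝 x) (𝓝 0) := by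
    simpa [ContinuousAt] using ((φ.continuousAt hx).sub (continuousAt_const (y := φ x))).norm
  have hcont' : Tendsto (fun y => A * ‖φ y - φ x‖ + A * ‖φ y - φ x‖ ^ 2) (𝓝 x) (𝓝 0) := by
    simpa using (hcont.const_mul A).add ((hcont.pow 2).const_mul A)
  have hev : ∀ᶠ y in 𝓝 x, y ∈ φ.source ∧ φ y ∈ B :=
    (φ.open_source.eventually_mem hx).and
      ((φ.continuousAt hx).eventually (Metric.closedBall_mem_nhds _ hr0))
  have main : ∀ u ∈ B, ∀ w ∈ B, dist F (φ.symm u) (φ.symm w) ≤ A * ‖w - u‖ + A * ‖w - u‖ ^ 2 :=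
    fun u hu w hw => (dist_symm_le hF hφ (convex_closedBall _ _) hr hA hu hw).trans
      (add_le_add_left (hA.le_norm _ hu _) _)
  constructor
  · refine tendsto_of_tendsto_of_tendsto_of_le_of_le' tendsto_const_nhds hcont'
      (Eventually.of_forall fun y => dist_nonneg hF x y) ?_
    filter_upwards [hev] with y hy
    have := main _ hxB _ hy.2
    rwa [φ.left_inv hx, φ.left_inv hy.1] at this
  · refine tendsto_of_tendsto_of_tendsto_of_le_of_le' tendsto_const_nhds hcont'
      (Eventually.of_forall fun y => dist_nonneg hF y x) ?_
    filter_upwards [hev] with y hy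
    have := main _ hy.2 _ hxB
    rwa [φ.left_inv hx, φ.left_inv hy.1, norm_sub_rev] at this

lemma exists_dist_lt_imp_mem_nhds [T2Space M] [ConnectedSpace M] (hF : IsFinslerMetric F) (x : M)
    {U : Set M} (hU : U ∈ 𝓝 x) : ∃ ε > 0, ∀ y, dist F x y < ε ∨ dist F y x < ε → y ∈ U := by
  set φ := chartAt (EuclideanSpace ℝ (Fin n)) x
  have hφ : φ ∈ IsManifold.maximalAtlas (𝓡 n) ∞ M := IsManifold.chart_mem_maximalAtlas x
  have hx : x ∈ φ.source := mem_chart_source _ _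
  obtain ⟨r, hr0, hr, A, hA⟩ := exists_chart_bounds hF hφ (φ.map_source hx)
  have hr' : Metric.closedBall (φ x) (r / 2) ⊆ Metric.closedBall (φ x) r :=
    Metric.closedBall_subset_closedBall (by linarith)
  obtain ⟨K, hK, h⟩ := exists_norm_sub_le_mul_dist hF hφ hr0 hr hA
  obtain ⟨δ, hδ, h'⟩ := exists_dist_lt_imp_mem hF hφ (half_pos hr0) (hr'.trans hr) (hA.mono hr')
  have hV : φ.symm ⁻¹' U ∈ 𝓝 (φ x) :=
    φ.symm.continuousAt (φ.map_source hx) (by simpa [φ.left_inv hx] using hU)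
  obtain ⟨ρ, hρ, hρU⟩ := Metric.mem_nhds_iff.1 hV
  refine ⟨min δ (ρ / K), by positivity, fun y hy => ?_⟩
  have hx4 : φ x ∈ Metric.closedBall (φ x) (r / 2 / 2) := Metric.mem_closedBall_self (by positivity)
  have hx2 : φ x ∈ Metric.closedBall (φ x) (r / 2) := Metric.mem_closedBall_self (by positivity)
  obtain ⟨hys, hyr⟩ := h' (φ x) hx4 y (by
    rw [φ.left_inv hx]
    exact hy.imp (fun h => h.trans_le (min_le_left _ _)) (fun h => h.trans_le (min_le_left _ _)))
  have hlt : ‖φ y - φ x‖ < ρ := by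
    rcases hy with hy | hy
    · have h1 := h _ hx2 _ hyr
      rw [φ.left_inv hx, φ.left_inv hys] at h1
      have h2 := hy.trans_le (min_le_right _ _)
      rw [lt_div_iff₀ hK] at h2
      linarith
    · have h1 := h _ hyr _ hx2
      rw [φ.left_inv hx, φ.left_inv hys, norm_sub_rev] at h1
      have h2 := hy.trans_le (min_le_right _ _)
      rw [lt_div_iff₀ hK] at h2
      linarith
  have : φ y ∈ φ.symm ⁻¹' U := hρU (by rwa [Metric.mem_ball, dist_eq_norm])
  rwa [mem_preimage, φ.left_inv hys] at this

theorem isLengthQuasiMetric_dist [T2Space M] [ConnectedSpace M] (hF : IsFinslerMetric F) :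
    IsLengthQuasiMetric (fun x y : M => dist F x y) where
  nonneg := dist_nonneg hF
  self := dist_self hF
  triangle := dist_triangle hF
  tendsto_right x := (tendsto_dist hF x).1
  tendsto_left x := (tendsto_dist hF x).2
  mem_of_right x U hU := by
    obtain ⟨ε, hε, h⟩ := exists_dist_lt_imp_mem_nhds hF x hU
    exact ⟨ε, hε, fun y hy => h y (Or.inl hy)⟩
  mem_of_left x U hU := by
    obtain ⟨ε, hε, h⟩ := exists_dist_lt_imp_mem_nhds hF x hU
    exact ⟨ε, hε, fun y hy => h y (Or.inr hy)⟩
  approx := by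
    intro x y ε hε
    obtain ⟨c, a, b, hab, hc, rfl, rfl, hl⟩ := exists_length_lt hF x y hε
    have hcont : ContinuousOn (fun t => dist F (c a) (c t)) (Icc a b) := by
      intro t ht
      refine ContinuousAt.comp_continuousWithinAt (g := fun z => dist F (c a) z) (f := c) ?_
        (hc.continuousOn t ht)
      have h0 := tendsto_dist hF (c t)
      have hlo : Tendsto (fun z => dist F (c a) (c t) - dist F z (c t)) (𝓝 (c t))
          (𝓝 (dist F (c a) (c t))) := by simpa using tendsto_const_nhds.sub h0.2
      have hhi : Tendsto (fun z => dist F (c a) (c t) + dist F (c t) z) (𝓝 (c t))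
          (𝓝 (dist F (c a) (c t))) := by simpa using tendsto_const_nhds.add h0.1
      refine tendsto_of_tendsto_of_tendsto_of_le_of_le hlo hhi (fun z => ?_) (fun z => ?_)
      · have := dist_triangle hF (c a) z (c t)
        show dist F (c a) (c t) - dist F z (c t) ≤ dist F (c a) z
        linarith
      · exact dist_triangle hF (c a) (c t) z
    -- reparametrize by the first time at which the distance from the initial point is `s`
    set S : ℝ → Set ℝ := fun s => {t ∈ Icc a b | s ≤ dist F (c a) (c t)}
    have hS : ∀ s, IsCompact (S s) := fun s =>
      isCompact_Icc.of_isClosed_subset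
        (hcont.preimage_isClosed_of_isClosed isClosed_Icc isClosed_Ici) fun t ht => ht.1
    have hSne : ∀ s, s ≤ dist F (c a) (c b) → (S s).Nonempty := fun s hs =>
      ⟨b, ⟨hab.le, le_rfl⟩, hs⟩
    set τ : ℝ → ℝ := fun s => sInf (S s)
    have hτ : ∀ s, s ≤ dist F (c a) (c b) → τ s ∈ S s := fun s hs => (hS s).sInf_mem (hSne s hs)
    have hτd : ∀ s, 0 ≤ s → s ≤ dist F (c a) (c b) → dist F (c a) (c (τ s)) = s := by
      intro s hs0 hs
      obtain ⟨hI, hge⟩ := hτ s hs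
      refine le_antisymm ?_ hge
      have hivt := intermediate_value_Icc hI.1
        (hcont.mono (Icc_subset_Icc_right hI.2))
      obtain ⟨u, hu, hus⟩ := hivt (show s ∈ Icc _ _ by rw [dist_self hF]; exact ⟨hs0, hge⟩)
      have h1 : τ s ≤ u := csInf_le (hS s).bddBelow ⟨⟨hu.1, hu.2.trans hI.2⟩, hus.ge⟩
      have h2 : u = τ s := le_antisymm hu.2 h1
      rw [← h2]
      exact hus.le
    refine ⟨fun s => c (τ s), fun s t hs hst ht => ?_⟩
    have hsI := (hτ s (hst.trans ht)).1
    have htI := (hτ t ht).1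
    have hmono : τ s ≤ τ t := csInf_le (hS s).bddBelow ⟨htI, hst.trans (hτ t ht).2⟩
    have l1 := dist_le_length hF (hc.mono le_rfl hsI.1 hsI.2)
    have l2 := dist_le_length hF (hc.mono hsI.1 hmono htI.2)
    have l3 := dist_le_length hF (hc.mono htI.1 htI.2 le_rfl)
    have l4 := dist_le_length hF (hc.mono hsI.1 hsI.2 le_rfl)
    have e1 := length_add hF (hc.mono le_rfl hsI.1 hsI.2) (hc.mono hsI.1 hsI.2 le_rfl)
    have e2 := length_add hF (hc.mono hsI.1 hmono htI.2) (hc.mono htI.1 htI.2 le_rfl)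
    have d1 := hτd s hs (hst.trans ht)
    have d2 := hτd t (hs.trans hst) ht
    have tr := dist_triangle hF (c a) (c (τ t)) (c b)
    refine ⟨d1, ?_, ?_⟩
    · show dist F (c (τ s)) (c (τ t)) ≤ t - s + ε
      linarith
    · show dist F (c (τ s)) (c b) ≤ dist F (c a) (c b) - s + ε
      linarith

/-! ### Expansion of the distance -/

/-- In a chart the Finsler distance agrees with the Minkowski norms up to terms of second order. -/
theorem exists_hasExpansion [T2Space M] [ConnectedSpace M] (hF : IsFinslerMetric F)
    (hφ : φ ∈ IsManifold.maximalAtlas (𝓡 n) ∞ M) {z₀ : EuclideanSpace ℝ (Fin n)}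
    (hz₀ : z₀ ∈ φ.target) : ∃ r > 0, Metric.ball z₀ r ⊆ φ.target ∧ ∃ A C,
      HasExpansion (inChart F φ) (Metric.ball z₀ r) A C
        (fun x y => dist F (φ.symm x) (φ.symm y)) := by
  obtain ⟨R, hR0, hR, A, hA⟩ := exists_chart_bounds hF hφ hz₀
  have hA0 := hA.pos
  have hR' : Metric.closedBall z₀ (R / 2) ⊆ Metric.closedBall z₀ R :=
    Metric.closedBall_subset_closedBall (by linarith)
  obtain ⟨K, hK, hKle⟩ := exists_norm_sub_le_mul_dist hF hφ hR0 hR hA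
  obtain ⟨δ, hδ, hδmem⟩ :=
    exists_dist_lt_imp_mem hF hφ (half_pos hR0) (hR'.trans hR) (hA.mono hR')
  -- the radius is chosen such that distances between points of the ball are less than `δ / 2`
  set r := min (R / 4) (min (1 / 2) (δ / (8 * A)))
  have hr0 : 0 < r := by positivity
  have hr1 : r ≤ R / 4 := min_le_left _ _
  have hr2 : r ≤ 1 / 2 := (min_le_right _ _).trans (min_le_left _ _)
  have hr3 : r ≤ δ / (8 * A) := (min_le_right _ _).trans (min_le_right _ _)
  have hB : Metric.ball z₀ r ⊆ Metric.closedBall z₀ R := fun z hz =>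
    Metric.mem_closedBall.2 (by have := Metric.mem_ball.1 hz; linarith)
  have hB2 : Metric.ball z₀ r ⊆ Metric.closedBall z₀ (R / 2) := fun z hz =>
    Metric.mem_closedBall.2 (by have := Metric.mem_ball.1 hz; linarith)
  have hB4 : Metric.ball z₀ r ⊆ Metric.closedBall z₀ (R / 2 / 2) := fun z hz =>
    Metric.mem_closedBall.2 (by have := Metric.mem_ball.1 hz; linarith)
  have hBt := hB.trans hR
  have hnorm : ∀ x ∈ Metric.ball z₀ r, ∀ y ∈ Metric.ball z₀ r, ‖y - x‖ < 2 * r := by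
    intro x hx y hy
    rw [mem_ball_iff_norm] at hx hy
    have : y - x = (y - z₀) - (x - z₀) := by abel
    rw [this]
    exact (norm_sub_le _ _).trans_lt (by linarith)
  have hup : ∀ x ∈ Metric.ball z₀ r, ∀ y ∈ Metric.ball z₀ r,
      dist F (φ.symm x) (φ.symm y) ≤ inChart F φ x (y - x) + A * ‖y - x‖ ^ 2 :=
    fun x hx y hy => dist_symm_le hF hφ (convex_ball _ _) hBt (hA.mono hB) hx hy
  have hup2 : ∀ x ∈ Metric.ball z₀ r, ∀ y ∈ Metric.ball z₀ r,
      dist F (φ.symm x) (φ.symm y) ≤ 2 * A * ‖y - x‖ := by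
    intro x hx y hy
    have h1 := hup x hx y hy
    have h2 := hA.le_norm x (hB hx) (y - x)
    have h3 := hnorm x hx y hy
    have h4 : ‖y - x‖ ^ 2 ≤ ‖y - x‖ := by nlinarith [norm_nonneg (y - x)]
    nlinarith
  set C := A + K + 4 * A ^ 4 * K
  have hCA : A ≤ C := by have : 0 ≤ K + 4 * A ^ 4 * K := by positivity
                         linarith
  have hCK : K ≤ C := by have : 0 ≤ A + 4 * A ^ 4 * K := by positivity
                         linarith
  have hC4 : 4 * A ^ 4 * K ≤ C := by have : 0 ≤ A + K := by positivity
                                     linarith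
  refine ⟨r, hr0, hBt, A, C, hA.mono hB, by positivity, fun x _ y _ z _ => dist_triangle hF _ _ _,
    fun x _ => ?_, fun x hx y hy => ?_, fun x hx y hy => ?_, fun x hx y hy => ?_⟩
  · exact ((isLengthQuasiMetric_dist hF).continuous_right _).comp_continuousOn
      (φ.continuousOn_symm.mono hBt)
  · exact (hKle x (hB2 hx) y (hB2 hy)).trans
      (mul_le_mul_of_nonneg_right hCK (dist_nonneg hF _ _))
  · exact (hup x hx y hy).trans (by gcongr)
  -- near-minimizing curves stay close to `x`, and are calibrated by the differential of `F x`
  rcases eq_or_ne x y with rfl | hxy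
  · rw [sub_self, ((hF.isChartMetric_inChart hφ).minkowski x (hBt hx)).map_zero]
    have := dist_nonneg hF (φ.symm x) (φ.symm x)
    positivity
  have hv : y - x ≠ 0 := sub_ne_zero.2 hxy.symm
  have hmink := (hF.isChartMetric_inChart hφ).minkowski x (hBt hx)
  set D := dist F (φ.symm x) (φ.symm y) with hD
  have hD0 : 0 ≤ D := dist_nonneg hF _ _
  have hDδ : D < δ / 2 := by
    have h1 := hup2 x hx y hy
    have h2 := hnorm x hx y hy
    have h3 : 2 * A * ‖y - x‖ < 2 * A * (2 * (δ / (8 * A))) := by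
      have : ‖y - x‖ < 2 * (δ / (8 * A)) := by linarith
      exact mul_lt_mul_of_pos_left this (by positivity)
    have h4 : 2 * A * (2 * (δ / (8 * A))) = δ / 2 := by field_simp; ring
    linarith
  have key : ∀ ε, 0 < ε → ε < δ / 2 →
      inChart F φ x (y - x) ≤ (1 + A ^ 2 * (K * (D + ε))) * (D + ε) := by
    intro ε hε hεδ
    obtain ⟨c, a, b, hab, hc, ha, hb, hl⟩ := exists_length_lt hF (φ.symm x) (φ.symm y) hε
    have hdist : ∀ t ∈ Icc a b, dist F (φ.symm x) (c t) ≤ D + ε := by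
      intro t ht
      have h1 := dist_le_length hF (hc.mono le_rfl ht.1 ht.2)
      have h2 := length_mono hF hc le_rfl ht.1 ht.2
      rw [ha] at h1
      linarith
    have hmem : ∀ t ∈ Icc a b, c t ∈ φ.source ∧ φ (c t) ∈ Metric.closedBall z₀ (R / 2) :=
      fun t ht => hδmem x (hB4 hx) (c t) (Or.inl ((hdist t ht).trans_lt (by linarith)))
    have hclose : ∀ t ∈ Icc a b, ‖φ (c t) - x‖ ≤ K * (D + ε) := by
      intro t ht
      have h1 := hKle x (hB2 hx) _ (hmem t ht).2
      rw [φ.left_inv (hmem t ht).1] at h1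
      exact h1.trans (mul_le_mul_of_nonneg_left (hdist t ht) hK.le)
    set ℓ := fderiv ℝ (inChart F φ x) (y - x)
    have hcal := sub_le_mul_length hF (h := fun q => ℓ (φ q))
      (h' := fun q => ℓ.comp (mfderiv (𝓡 n) (𝓡 n) φ q :
        EuclideanSpace ℝ (Fin n) →L[ℝ] EuclideanSpace ℝ (Fin n)))
      (K := 1 + A ^ 2 * (K * (D + ε))) hc (fun t ht => by
        have h1 := ((mdifferentiable_of_mem_maximalAtlas hφ).mdifferentiableAt
          (hmem t ht).1).hasMFDerivAt
        have h2 : HasMFDerivAt (𝓡 n) 𝓘(ℝ, ℝ) ℓ (φ (c t)) ℓ := ℓ.hasFDerivAt.hasMFDerivAt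
        exact h2.comp (c t) h1) (fun t ht v => by
        let T : EuclideanSpace ℝ (Fin n) →L[ℝ] EuclideanSpace ℝ (Fin n) :=
          mfderiv (𝓡 n) (𝓡 n) φ (c t)
        have hT : inChart F φ (φ (c t)) (T v) = F ⟨c t, v⟩ :=
          inChart_apply_mfderiv hφ (hmem t ht).1 v
        have hcR : φ (c t) ∈ Metric.closedBall z₀ R := hR' (hmem t ht).2
        rw [← hT]
        show ℓ (T v) ≤ _
        have h1 := hmink.fderiv_le hv (T v)
        have h2 := hA.lipschitz x (hB hx) _ hcR (T v)
        have h3 := hA.norm_le _ hcR (T v)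
        have h4 := hclose t ht
        rw [norm_sub_rev] at h4
        have h5 : A * ‖x - φ (c t)‖ * ‖T v‖ ≤
            A * (K * (D + ε)) * (A * inChart F φ (φ (c t)) (T v)) := by gcongr
        calc ℓ (T v) ≤ inChart F φ (φ (c t)) (T v) +
              A * (K * (D + ε)) * (A * inChart F φ (φ (c t)) (T v)) := by linarith
          _ = _ := by ring)
    simp only [ha, hb, φ.right_inv (hBt hx), φ.right_inv (hBt hy), ← map_sub] at hcal
    rw [show ℓ (y - x) = inChart F φ x (y - x) from hmink.fderiv_self hv] at hcal
    exact hcal.trans (mul_le_mul_of_nonneg_left hl.le (by positivity))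
  have hlim : Tendsto (fun ε => (1 + A ^ 2 * (K * (D + ε))) * (D + ε)) (𝓝[>] 0)
      (𝓝 ((1 + A ^ 2 * (K * (D + 0))) * (D + 0))) := by
    refine (Continuous.tendsto ?_ 0).mono_left nhdsWithin_le_nhds
    fun_prop
  have hle := ge_of_tendsto hlim (by
    filter_upwards [Ioo_mem_nhdsGT (show (0 : ℝ) < δ / 2 by linarith)] with ε hε
    exact key ε hε.1 hε.2)
  have hD2 : D ^ 2 ≤ (2 * A * ‖y - x‖) ^ 2 := pow_le_pow_left₀ hD0 (hup2 x hx y hy) 2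
  have h5 : A ^ 2 * K * D ^ 2 ≤ A ^ 2 * K * (2 * A * ‖y - x‖) ^ 2 := by gcongr
  have h6 : 4 * A ^ 4 * K * ‖y - x‖ ^ 2 ≤ C * ‖y - x‖ ^ 2 := by gcongr
  calc inChart F φ x (y - x) ≤ _ := hle
    _ = D + A ^ 2 * K * D ^ 2 := by ring
    _ ≤ D + C * ‖y - x‖ ^ 2 := by nlinarith

/-! ### Minimizers are geodesics -/

/-- Every point of `J` has nondegenerate compact intervals as arbitrarily small neighbourhoods in
`J`. This common property of `(a, b)` and `[a, ∞)` allows one to localize minimizers, also at an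
initial point. -/
def HasIccBasis (J : Set ℝ) : Prop :=
  ∀ t ∈ J, ∀ V ∈ 𝓝[J] t, ∀ δ > 0, ∃ α β, α < β ∧ β - α ≤ δ ∧ Icc α β ⊆ V ∩ J ∧ t ∈ Icc α β ∧
    Icc α β ∈ 𝓝[J] t

lemma hasIccBasis_Ioo (a b : ℝ) : HasIccBasis (Ioo a b) := by
  intro t ht V hV δ hδ
  rw [isOpen_Ioo.nhdsWithin_eq ht] at hV ⊢
  obtain ⟨ρ, hρ, h⟩ := Metric.nhds_basis_closedBall.mem_iff.1
    (inter_mem hV (isOpen_Ioo.mem_nhds ht))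
  rw [Real.closedBall_eq_Icc] at h
  have hm : 0 < min ρ (δ / 2) := by positivity
  have h1 := min_le_left ρ (δ / 2)
  have h2 := min_le_right ρ (δ / 2)
  exact ⟨t - min ρ (δ / 2), t + min ρ (δ / 2), by linarith, by linarith,
    (Icc_subset_Icc (by linarith) (by linarith)).trans h, ⟨by linarith, by linarith⟩,
    Icc_mem_nhds (by linarith) (by linarith)⟩

lemma hasIccBasis_Ici (a : ℝ) : HasIccBasis (Ici a) := by
  intro t ht V hV δ hδ
  obtain ⟨ρ, hρ, h⟩ := Metric.mem_nhdsWithin_iff.1 hV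
  set η := min (ρ / 2) (δ / 2)
  have hm : 0 < η := by positivity
  have h1 : η ≤ ρ / 2 := min_le_left _ _
  have h2 : η ≤ δ / 2 := min_le_right _ _
  have hat : a ≤ t := ht
  have hle : max a (t - η) ≤ t := max_le hat (by linarith)
  refine ⟨max a (t - η), t + η, by linarith, by linarith [le_max_right a (t - η)], ?_,
    ⟨hle, by linarith⟩, ?_⟩
  · intro s hs
    have hsa : a ≤ s := (le_max_left _ _).trans hs.1
    have hst : t - η ≤ s := (le_max_right _ _).trans hs.1
    refine ⟨h ⟨?_, hsa⟩, hsa⟩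
    rw [Real.ball_eq_Ioo]
    exact ⟨by linarith, by linarith [hs.2]⟩
  · filter_upwards [self_mem_nhdsWithin, mem_nhdsWithin_of_mem_nhds
      (Icc_mem_nhds (show t - η < t by linarith) (show t < t + η by linarith))] with s hs hs'
    exact ⟨max_le hs hs'.1, hs'.2⟩

/-- Local regularity of minimizers: in a chart they are smooth with a smooth velocity `w` of unit
length, and they satisfy the Euler–Lagrange equation. -/
lemma exists_velocity_of_isMinimizer [T2Space M] [ConnectedSpace M] (hF : IsFinslerMetric F)
    (hφ : φ ∈ IsManifold.maximalAtlas (𝓡 n) ∞ M) {γ : ℝ → M} {J : Set ℝ} (hJ : HasIccBasis J)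
    (hγ : IsMinimizer (fun x y => dist F x y) γ J) {t : ℝ} (ht : t ∈ J) (htφ : γ t ∈ φ.source) :
    ∃ α β, α < β ∧ t ∈ Icc α β ∧ Icc α β ⊆ J ∧ Icc α β ∈ 𝓝[J] t ∧
      (∀ s ∈ Icc α β, γ s ∈ φ.source) ∧ ∃ w : ℝ → EuclideanSpace ℝ (Fin n),
      ContDiffOn ℝ ∞ (fun s => ((φ ∘ γ) s, w s)) (Icc α β) ∧
      (∀ s ∈ Icc α β, HasDerivWithinAt (φ ∘ γ) (w s) (Icc α β) s) ∧
      (∀ s ∈ Icc α β, inChart F φ ((φ ∘ γ) s) (w s) = 1) ∧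
      ∀ s ∈ Icc α β, HasDerivWithinAt (fun s => legendre (inChart F φ) ((φ ∘ γ) s, w s))
        (baseDeriv (inChart F φ) ((φ ∘ γ) s, w s)) (Icc α β) s := by
  obtain ⟨r, hr, hrt, A, C, hD⟩ := exists_hasExpansion hF hφ (φ.map_source htφ)
  have hcont : ContinuousWithinAt γ J t :=
    (isLengthQuasiMetric_dist hF).continuousOn_of_isMinimizer hγ t ht
  have hV : γ ⁻¹' (φ.source ∩ φ ⁻¹' Metric.ball (φ (γ t)) r) ∈ 𝓝[J] t :=
    hcont ((φ.isOpen_inter_preimage Metric.isOpen_ball).mem_nhds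
      ⟨htφ, Metric.mem_ball_self hr⟩)
  have hA0 := hD.bounds.pos
  have hC0 := hD.nonneg
  obtain ⟨α, β, hαβ, hδ, hsub, htI, hnhds⟩ := hJ t ht _ hV (1 / (2 * (C ^ 3 + A * C ^ 2 + 1)))
    (by positivity)
  have hs : ∀ s ∈ Icc α β, γ s ∈ φ.source := fun s hs => (hsub hs).1.1
  refine ⟨α, β, hαβ, htI, fun s hs => (hsub hs).2, hnhds, hs, ?_⟩
  refine hD.exists_contDiffOn_of_isMinimizer (hF.isChartMetric_inChart hφ) hrt Metric.isOpen_ball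
    Subset.rfl hαβ ?_ (fun s hs => (hsub hs).1.2) ?_
  · rw [le_div_iff₀ (by positivity)] at hδ
    have h0 : 0 ≤ C ^ 3 + A * C ^ 2 := by positivity
    have h1 : 0 < β - α := sub_pos.2 hαβ
    nlinarith
  · intro u hu v hv huv
    have h := hγ u (hsub hu).2 v (hsub hv).2 huv
    simpa only [Function.comp_apply, φ.left_inv (hs u hu), φ.left_inv (hs v hv)] using h

theorem isGeodesicOn_of_isMinimizer [T2Space M] [ConnectedSpace M] (hF : IsFinslerMetric F)
    {γ : ℝ → M} {J : Set ℝ} (hJ : HasIccBasis J)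
    (hγ : IsMinimizer (fun x y => dist F x y) γ J) : IsGeodesicOn F γ J := by
  refine ⟨fun t ht => ?_, fun φ hφ t ht htφ => ?_⟩
  · set φ := chartAt (EuclideanSpace ℝ (Fin n)) (γ t)
    have hφ : φ ∈ IsManifold.maximalAtlas (𝓡 n) ∞ M := IsManifold.chart_mem_maximalAtlas (γ t)
    obtain ⟨α, β, -, htI, -, hnhds, hs, w, hw, -⟩ :=
      exists_velocity_of_isMinimizer hF hφ hJ hγ ht (mem_chart_source _ _)
    have h1 : ContMDiffOn 𝓘(ℝ, ℝ) (𝓡 n) ∞ (φ ∘ γ) (Icc α β) :=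
      (contDiff_fst.comp_contDiffOn hw).contMDiffOn
    have h2 : ContMDiffOn 𝓘(ℝ, ℝ) (𝓡 n) ∞ γ (Icc α β) :=
      ((contMDiffOn_symm_of_mem_maximalAtlas hφ).comp h1
        fun s h => φ.map_source (hs s h)).congr fun s h => (φ.left_inv (hs s h)).symm
    exact (h2 t htI).mono_of_mem_nhdsWithin hnhds
  · obtain ⟨α, β, hαβ, htI, hIJ, hnhds, hs, w, hw, hv, h1, hEL⟩ :=
      exists_velocity_of_isMinimizer hF hφ hJ hγ ht htφ
    have huI : UniqueDiffOn ℝ (Icc α β) := uniqueDiffOn_Icc hαβ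
    have hcm := hF.isChartMetric_inChart hφ
    have hev : derivWithin (φ ∘ γ) J =ᶠ[𝓝[J] t] w := by
      filter_upwards [eventually_eventually_nhdsWithin.2 hnhds, hnhds] with s hs hsI
      exact ((hv s hsI).mono_of_mem_nhdsWithin hs).derivWithin ((huI s hsI).mono hIJ)
    have hut : UniqueDiffWithinAt ℝ J t := (huI t htI).mono hIJ
    have hwt : derivWithin (φ ∘ γ) J t = w t := hev.self_of_nhdsWithin ht
    have hw' : HasDerivWithinAt w (derivWithin w (Icc α β) t) (Icc α β) t :=
      ((contDiff_snd.comp_contDiffOn hw).differentiableOn (by simp) t htI).hasDerivWithinAt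
    have ha : derivWithin (derivWithin (φ ∘ γ) J) J t = derivWithin w (Icc α β) t := by
      rw [hev.derivWithin_eq hwt]
      exact (hw'.mono_of_mem_nhdsWithin hnhds).derivWithin hut
    have hw0 : w t ≠ 0 := by
      intro h0
      have := h1 t htI
      rw [h0, Function.comp_apply, (hcm.minkowski _ (φ.map_source (hs t htI))).map_zero] at this
      exact zero_ne_one this
    rw [ha, hwt]
    exact ⟨hw0, fun i => hcm.add_two_mul_sprayCoeff_eq_zero (huI t htI)
      (φ.map_source (hs t htI)) hw0 (hv t htI) hw' (hEL t htI) i⟩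

theorem apply_mfderivWithin_eq_one_of_isMinimizer [T2Space M] [ConnectedSpace M]
    (hF : IsFinslerMetric F) {γ : ℝ → M} {J : Set ℝ} (hJ : HasIccBasis J)
    (hγ : IsMinimizer (fun x y => dist F x y) γ J) {t : ℝ} (ht : t ∈ J) :
    F ⟨γ t, mfderivWithin 𝓘(ℝ, ℝ) (𝓡 n) γ J t (1 : ℝ)⟩ = 1 := by
  set φ := chartAt (EuclideanSpace ℝ (Fin n)) (γ t)
  have hφ : φ ∈ IsManifold.maximalAtlas (𝓡 n) ∞ M := IsManifold.chart_mem_maximalAtlas (γ t)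
  obtain ⟨α, β, hαβ, htI, hIJ, hnhds, hs, w, hw, hv, h1, -⟩ :=
    exists_velocity_of_isMinimizer hF hφ hJ hγ ht (mem_chart_source _ _)
  have hut : UniqueDiffWithinAt ℝ J t := (uniqueDiffOn_Icc hαβ t htI).mono hIJ
  have hd : MDifferentiableWithinAt 𝓘(ℝ, ℝ) (𝓡 n) γ J t :=
    ((isGeodesicOn_of_isMinimizer hF hJ hγ).1 t ht).mdifferentiableWithinAt (by simp)
  have h2 := ((mdifferentiable_of_mem_maximalAtlas hφ).mdifferentiableAt (hs t htI)).hasMFDerivAt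
  let T : ℝ →L[ℝ] EuclideanSpace ℝ (Fin n) := mfderivWithin 𝓘(ℝ, ℝ) (𝓡 n) γ J t
  let S : EuclideanSpace ℝ (Fin n) →L[ℝ] EuclideanSpace ℝ (Fin n) := mfderiv (𝓡 n) (𝓡 n) φ (γ t)
  have h3 : HasFDerivWithinAt (φ ∘ γ) (S.comp T) J t :=
    (h2.comp_hasMFDerivWithinAt t hd.hasMFDerivWithinAt).hasFDerivWithinAt
  have h4 : S (T 1) = w t :=
    hut.eq_deriv J h3.hasDerivWithinAt ((hv t htI).mono_of_mem_nhdsWithin hnhds)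
  have h5 : inChart F φ (φ (γ t)) (S (T 1)) = 1 := by
    rw [h4]
    exact h1 t htI
  exact (inChart_apply_mfderiv hφ (hs t htI) _).symm.trans h5

/-- On a positively complete manifold, minimizers on bounded intervals have an endpoint. -/
lemma IsPositivelyComplete.exists_tendsto [T2Space M] [ConnectedSpace M] (hF : IsFinslerMetric F)
    (hcomplete : IsPositivelyComplete F) {γ : ℝ → M} {R : ℝ} (hR : 0 < R)
    (hγ : IsMinimizer (fun x y => dist F x y) γ (Ico 0 R)) :
    ∃ z, Tendsto γ (𝓝[<] R) (𝓝 z) := by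
  have hγ' : IsMinimizer (fun x y => dist F x y) γ (Ioo 0 R) := fun s hs t ht hst =>
    hγ s (Ioo_subset_Ico_self hs) t (Ioo_subset_Ico_self ht) hst
  obtain ⟨γ', hgeo, heq⟩ := hcomplete γ 0 R hR
    (isGeodesicOn_of_isMinimizer hF (hasIccBasis_Ioo 0 R) hγ')
  refine ⟨γ' R, ?_⟩
  have h1 : ContinuousAt γ' R := hgeo.1.continuousOn.continuousAt (Ioi_mem_nhds hR)
  refine (h1.tendsto.mono_left nhdsWithin_le_nhds).congr' ?_
  filter_upwards [Ioo_mem_nhdsLT hR] with s hs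
  exact heq hs

end Finsler

end

theorem mainTheorem4 {n : ℕ} {M : Type*} [TopologicalSpace M]
    [ChartedSpace (EuclideanSpace ℝ (Fin n)) M] [IsManifold (𝓡 n) ∞ M]
    [T2Space M] [SecondCountableTopology M] [ConnectedSpace M] [NoncompactSpace M]
    (F : TangentBundle (𝓡 n) M → ℝ) (hF : Finsler.IsFinslerMetric F)
    (hcomplete : Finsler.IsPositivelyComplete F) (p : M) :
    -- the limit which defines the Busemann function exists
    (∀ x : M, Tendsto (fun t : ℝ => Finsler.busemannApprox F p t x) atTop
      (𝓝 (Finsler.busemann F p x))) ∧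
    ∀ q : M, ∃ σ : ℝ → M, Finsler.IsRay F σ ∧ σ 0 = q ∧
      (∀ t : ℝ, 0 < t →
        Finsler.Supports (fun x => Finsler.busemann F p q + t - Finsler.dist F x (σ t))
          (Finsler.busemann F p) q) ∧
      ∀ t : ℝ, 0 ≤ t → Finsler.busemann F p (σ t) = Finsler.busemann F p q + t := by
  have hd := Finsler.isLengthQuasiMetric_dist hF
  have : LocallyCompactSpace M := ChartedSpace.locallyCompactSpace (EuclideanSpace ℝ (Fin n)) M
  obtain ⟨b, hb, hσ⟩ := hd.exists_busemann
    (hd.isCompact_closedBall fun γ R hR hγ => hcomplete.exists_tendsto hF hR hγ) p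
  have hlim : ∀ x, Tendsto (fun t : ℝ => Finsler.busemannApprox F p t x) atTop (𝓝 (b x)) := hb
  have hbus : Finsler.busemann F p = b := funext fun x => (hlim x).limUnder_eq
  rw [hbus]
  refine ⟨hlim, fun q => ?_⟩
  obtain ⟨σ, h0, hmin, hle, heq⟩ := hσ q
  have hJ := Finsler.hasIccBasis_Ici 0
  refine ⟨σ, ⟨Finsler.isGeodesicOn_of_isMinimizer hF hJ hmin, fun t ht =>
    Finsler.apply_mfderivWithin_eq_one_of_isMinimizer hF hJ hmin ht, fun s t hs hst =>
    hmin s hs t (hs.trans hst) hst⟩, h0, fun t ht => ⟨hle t ht.le, ?_⟩, heq⟩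
  have h1 : Finsler.dist F (σ 0) (σ t) = t - 0 := hmin 0 self_mem_Ici t ht.le ht.le
  rw [h0] at h1
  simp only [h1]
  ring
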